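/- **Conventions.** Let $S$ be a non-empty Polish space with a fixed compatible metric (it fixes which sets are bounded), $\pi$ a Borel probability measure on $S$, $m\ge 1$, $\lambda$ Lebesgue measure on $\mathbb R^m$, and $\|\cdot\|$ the Euclidean norm. An $\mathbb R^d$-valued Lévy basis with characteristic quadruplet $(\gamma,\Sigma,\nu,\pi)$ is a family $\Lambda=\{\Lambda(B)\}$ of $\mathbb R^d$-valued random variables, indexed by the bounded Borel sets $B\subset S\times\mathbb R^m$, that are infinitely divisible, independent for disjoint sets, almost surely $\sigma$-additive, and satisfy $E[e^{i\langle u,\Lambda(B)\rangle}]=e^{\Phi(u)(\pi\otimes\lambda)(B)}$ with $$\Phi(u)=i\langle\gamma,u\rangle-\tfrac12\langle u,\Sigma u\rangle+\int_{\mathbb R^d}\bigl(e^{i\langle u,x\rangle}-1-i\langle u,x\rangle 1_{\{\|x\|\le 1\}}\bigr)\nu(dx),$$ where $\Sigma$ is symmetric positive semidefinite and $\nu$ is a Lévy measure. A measurable matrix-valued function $k$ is $\Lambda$-integrable if there are simple functions $k_i$ of bounded support with $k_i\to k$ $(\pi\otimes\lambda)$-a.e. such that $\int_D k_i\,d\Lambda$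 converges in probability for every Borel set $D$; $\int k\,d\Lambda$ is the limit for $D=S\times\mathbb R^m$. Write $s<_{lex}t$ if $s_p<t_p$ at the first coordinate $p$ where $s$ and $t$ differ, and put $V_t=\{s: s<_{lex}t\}\cup\{t\}$ and $V_t^h=V_t\cap\{s:\|t-s\|_\infty\ge h\}$. For an $\mathbb R^n$-valued field $X=(X_t)_{t\in\mathbb R^m}$ let $$\theta_X(h)=\sup_{u\ge 1}\ \sup\ \frac{|Cov(F(X_{i_1},\dots,X_{i_u}),G(X_j))|}{\|F\|_\infty\, Lip(G)},$$ where the inner supremum is over bounded measurable $F:(\mathbb R^n)^u\to\mathbb R$, bounded Lipschitz $G:\mathbb R^n\to\mathbb R$, $j\in\mathbb R^m$, and distinct $i_1,\dots,i_u\in V_j^h$ (with $0/0=0$). $X$ is $\theta$-lex-weakly dependent if $\theta_X(h)\to0$ as $h\to\infty$. **Proposition.** Let $\Lambda$ be such a Lévy basis, $f:S\times\mathbb R^m\to M_{n\times d}(\mathbb R)$ Borel measurable, $A_0\subset\mathbb R^m$ a Borel set with $\lambda(A_0)>0$, $A_t=t+A_0$, and let $\alpha\in\mathbb R^m\setminus\{0\}$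 satisfy $$\sup_{x\in A_0,\,x\ne0}\frac{\alpha'x}{\|x\|}<0 .$$ Put $b=\sup_{x\in A_0,\,x\neq 0}\frac{\alpha'x}{\|\alpha\|\|x\|}$ and $\psi(h)=-bh/\sqrt m$. Let $O$ be an orthogonal transformation of $\mathbb R^m$ with $O\alpha=\|\alpha\|e_1$, where $e_1$ is the first unit vector ($O=I$ is allowed if $\alpha$ is a positive multiple of $e_1$). Consider $$X_t=\int_S\int_{A_t}f(A,t-s)\,\Lambda(dA,ds),\qquad \tilde X_t=X_{O^{-1}t},\qquad t\in\mathbb R^m$$ (so $\tilde X=X$ if $O=I$). Write $g(A,s)=f(A,-O^{-1}s)$, $R_h=OA_0\cap V_0^{\psi(h)}$, $\Sigma_\Lambda=\Sigma+\int_{\mathbb R^d} xx'\,\nu(dx)$, $\Sigma_{\Lambda_1}=\Sigma+\int_{\|x\|\le1}xx'\,\nu(dx)$, $\mu_\Lambda=\gamma+\int_{\|x\|>1}x\,\nu(dx)$, and $\gamma_0=\gamma-\int_{\|x\|\le1}x\,\nu(dx)$. In each of the following cases the integrals defining $X_t$ exist for all $t$, the field $\tilde X$ is $\theta$-lex-weakly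 dependent, and the stated bound holds for all $h>0$. (i) If $\int_{\|x\|>1}\|x\|^2\nu(dx)<\infty$, $\gamma+\int_{\|x\|>1}x\,\nu(dx)=0$ and $f\in L^2(\pi\otimes\lambda)$, then $$\theta_{\tilde X}(h)\le 2\Bigl(\int_S\int_{R_h}\mathrm{tr}(g(A,s)\Sigma_\Lambda g(A,s)')\,ds\,\pi(dA)\Bigr)^{1/2}.$$ (ii) If $\int_{\|x\|>1}\|x\|^2\nu(dx)<\infty$ and $f\in L^1(\pi\otimes\lambda)\cap L^2(\pi\otimes\lambda)$, then $$\theta_{\tilde X}(h)\le 2\Bigl(\int_S\int_{R_h}\mathrm{tr}(g(A,s)\Sigma_\Lambda g(A,s)')\,ds\,\pi(dA)+\Bigl\|\int_S\int_{R_h}g(A,s)\mu_\Lambda\,ds\,\pi(dA)\Bigr\|^2\Bigr)^{1/2}.$$ (iii) If $\int_{\mathbb R^d}\|x\|\nu(dx)<\infty$, $\Sigma=0$ and $f\in L^1(\pi\otimes\lambda)$, then $$\theta_{\tilde X}(h)\le 2\Bigl(\int_S\int_{R_h}\|g(A,s)\gamma_0\|\,ds\,\pi(dA)+\int_S\int_{R_h}\int_{\mathbb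 R^d}\|g(A,s)x\|\,\nu(dx)\,ds\,\pi(dA)\Bigr).$$ (iv) If $\int_{\|x\|>1}\|x\|\nu(dx)<\infty$ and $f\in L^1(\pi\otimes\lambda)\cap L^2(\pi\otimes\lambda)$, then $$\theta_{\tilde X}(h)\le 2\Bigl(\int_S\int_{R_h}\mathrm{tr}(g(A,s)\Sigma_{\Lambda_1} g(A,s)')\,ds\,\pi(dA)+\Bigl\|\int_S\int_{R_h}g(A,s)\gamma\,ds\,\pi(dA)\Bigr\|^2\Bigr)^{1/2}+2\int_S\int_{R_h}\int_{\|x\|>1}\|g(A,s)x\|\,\nu(dx)\,ds\,\pi(dA).$$ -/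

import Mathlib

open MeasureTheory ProbabilityTheory Filter Topology
open scoped ENNReal NNReal

namespace MMAF

/-- `ℝᵏ` with the Euclidean norm. -/
abbrev E (k : ℕ) : Type := EuclideanSpace ℝ (Fin k)

/-- The Euclidean product of a matrix and a vector. -/
noncomputable def mv {n d : ℕ} (M : Matrix (Fin n) (Fin d) ℝ) (x : E d) : E n :=
  WithLp.toLp 2 (M.mulVec (WithLp.ofLp x))

/-! ### The lexicographic order and weak dependence -/

/-- `y <_lex z`. -/
def LexLT {m : ℕ} (y z : E m) : Prop := ∃ p : Fin m, y p < z p ∧ ∀ q < p, y q = z q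

/-- `V_t = {s : s <_lex t} ∪ {t}`. -/
def V {m : ℕ} (t : E m) : Set (E m) := {s | LexLT s t} ∪ {t}

/-- `V_t^h = V_t ∩ {s : ‖t - s‖_∞ ≥ h}`; the norm on `Fin m → ℝ` is the maximum norm. -/
def Vh {m : ℕ} (t : E m) (h : ℝ) : Set (E m) := V t ∩ {s | h ≤ ‖WithLp.ofLp (t - s)‖}

/-- `‖F‖_∞`. -/
noncomputable def supNorm {T : Type*} (F : T → ℝ) : ℝ≥0∞ := ⨆ x, ‖F x‖ₑ

/-- `Lip(G) = sup_{x ≠ y} |G x - G y| / ‖x - y‖`. -/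
noncomputable def lipConst {n : ℕ} (G : E n → ℝ) : ℝ≥0∞ :=
  ⨆ (x : E n) (y : E n) (_ : x ≠ y), edist (G x) (G y) / edist x y

/-- `θ_u(h)`, with values in `[0, ∞]`. If `‖F‖_∞ Lip(G) = 0`, then `F = 0` or `G` is constant, the
covariance vanishes, and the quotient is `0 / 0 = 0`. -/
noncomputable def thetaLexU {Ω : Type*} [MeasurableSpace Ω] (P : Measure Ω) {m n : ℕ}
    (X : E m → Ω → E n) (u : ℕ) (h : ℝ) : ℝ≥0∞ :=
  ⨆ (F : (Fin u → E n) → ℝ) (_ : Measurable F ∧ ∃ C : ℝ, ∀ x, |F x| ≤ C)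
    (G : E n → ℝ) (_ : (∃ K : ℝ≥0, LipschitzWith K G) ∧ ∃ C : ℝ, ∀ x, |G x| ≤ C)
    (j : E m) (Γ : Fin u → E m) (_ : Function.Injective Γ ∧ ∀ a, Γ a ∈ Vh j h),
    ENNReal.ofReal |covariance (fun ω => F (fun a => X (Γ a) ω)) (fun ω => G (X j ω)) P| /
      (supNorm F * lipConst G)

/-- The coefficient `θ(h) = sup_{u ≥ 1} θ_u(h)`. -/
noncomputable def thetaLex {Ω : Type*} [MeasurableSpace Ω] (P : Measure Ω) {m n : ℕ}
    (X : E m → Ω → E n) (h : ℝ) : ℝ≥0∞ :=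
  ⨆ (u : ℕ) (_ : 1 ≤ u), thetaLexU P X u h

/-- θ-lex-weak dependence. -/
def IsThetaLexWeaklyDependent {Ω : Type*} [MeasurableSpace Ω] (P : Measure Ω) {m n : ℕ}
    (X : E m → Ω → E n) : Prop :=
  Tendsto (fun h : ℝ => thetaLex P X h) atTop (𝓝 0)

/-! ### Lévy bases -/

/-- Infinite divisibility of a probability measure: for every `k ≥ 1` it is the `k`-fold convolution
of a probability measure, expressed by characteristic functions. -/
def IsInfinitelyDivisible {d : ℕ} (μ : Measure (E d)) : Prop :=
  ∀ k : ℕ, 1 ≤ k → ∃ ρ : Measure (E d), IsProbabilityMeasure ρ ∧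
    ∀ u, charFun μ u = charFun ρ u ^ k

/-- Lévy measures on `ℝᵈ`. -/
def IsLevyMeasure {d : ℕ} (ν : Measure (E d)) : Prop :=
  ν {0} = 0 ∧ ∫⁻ x, min 1 (‖x‖ₑ ^ 2) ∂ν < ∞

/-- The cumulant transform `Φ` with characteristic triplet `(γ, Σ, ν)` and truncation function
`x ↦ x 1_{‖x‖ ≤ 1}`. -/
noncomputable def cumulant {d : ℕ} (γ : E d) (Sig : Matrix (Fin d) (Fin d) ℝ)
    (ν : Measure (E d)) (u : E d) : ℂ :=
  Complex.I * (inner ℝ γ u : ℝ) - (1 / 2 : ℂ) * (inner ℝ u (mv Sig u) : ℝ) +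
    ∫ x, (Complex.exp (Complex.I * (inner ℝ u x : ℝ)) - 1 -
      Complex.I * (Set.indicator {y : E d | ‖y‖ ≤ 1} (fun y => inner ℝ u y) x : ℝ)) ∂ν

/-- `Λ` is a (homogeneous, factorisable) `ℝᵈ`-valued Lévy basis on `S × ℝᵐ` with characteristic
quadruplet `(γ, Σ, ν, π)`. Only the values of `Λ` at bounded Borel sets matter. -/
structure IsLevyBasis {Ω S : Type*} [MeasurableSpace Ω] (P : Measure Ω)
    [MetricSpace S] [MeasurableSpace S] {m d : ℕ} (Λ : Set (S × E m) → Ω → E d)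
    (γ : E d) (Sig : Matrix (Fin d) (Fin d) ℝ) (ν : Measure (E d)) (π : Measure S) : Prop where
  posSemidef : Sig.PosSemidef
  levyMeasure : IsLevyMeasure ν
  measurable : ∀ B, MeasurableSet B → Bornology.IsBounded B → Measurable (Λ B)
  infDiv : ∀ B, MeasurableSet B → Bornology.IsBounded B → IsInfinitelyDivisible (P.map (Λ B))
  indep : ∀ (N : ℕ) (B : Fin N → Set (S × E m)),
    (∀ i, MeasurableSet (B i) ∧ Bornology.IsBounded (B i)) →
    Pairwise (fun i j => Disjoint (B i) (B j)) → iIndepFun (fun i => Λ (B i)) P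
  sigmaAdditive : ∀ B : ℕ → Set (S × E m),
    (∀ i, MeasurableSet (B i)) → Bornology.IsBounded (⋃ i, B i) →
    Pairwise (fun i j => Disjoint (B i) (B j)) →
    ∀ᵐ ω ∂P, Tendsto (fun N => ∑ i ∈ Finset.range N, Λ (B i) ω) atTop (𝓝 (Λ (⋃ i, B i) ω))
  charFun_eq : ∀ B, MeasurableSet B → Bornology.IsBounded B → ∀ u,
    charFun (P.map (Λ B)) u =
      Complex.exp (cumulant γ Sig ν u * (((π.prod (volume : Measure (E m))).real B : ℝ) : ℂ))

/-! ### Stochastic integration of deterministic kernels (in the sense of Rajput and Rosiński) -/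

/-- `∫_D g dΛ = ∑_c c Λ({g = c} ∩ D)` for a matrix-valued simple function `g`; the value `c = 0`
contributes `0`, and for `g` of bounded support the other sets are bounded. -/
noncomputable def simpleInt {Ω S : Type*} [MeasurableSpace S] {m n d : ℕ}
    (Λ : Set (S × E m) → Ω → E d) (g : SimpleFunc (S × E m) (Matrix (Fin n) (Fin d) ℝ))
    (D : Set (S × E m)) (ω : Ω) : E n :=
  ∑ c ∈ g.range, mv c (Λ (g ⁻¹' {c} ∩ D) ω)

/-- `Y` is (a version of) the stochastic integral `∫ k dΛ`: there are simple functions `g_i` of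
bounded support, converging to `k` almost everywhere with respect to the measure `ctrl`, such that
`∫_D g_i dΛ` converges in probability for every Borel set `D`, and `Y` is the limit for the whole
space. -/
def IsStochInt {Ω S : Type*} [MeasurableSpace Ω] (P : Measure Ω)
    [MetricSpace S] [MeasurableSpace S] {m n d : ℕ}
    (Λ : Set (S × E m) → Ω → E d) (ctrl : Measure (S × E m))
    (k : S × E m → Matrix (Fin n) (Fin d) ℝ) (Y : Ω → E n) : Prop :=
  ∃ g : ℕ → SimpleFunc (S × E m) (Matrix (Fin n) (Fin d) ℝ),
    (∀ i, Bornology.IsBounded (Function.support (g i))) ∧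
    (∀ᵐ p ∂ctrl, Tendsto (fun i => g i p) atTop (𝓝 (k p))) ∧
    (∀ D, MeasurableSet D → ∃ Z : Ω → E n,
      TendstoInMeasure P (fun i => simpleInt Λ (g i) D) atTop Z) ∧
    TendstoInMeasure P (fun i => simpleInt Λ (g i) Set.univ) atTop Y

/-- `Λ`-integrability. -/
def IsLevyIntegrable {Ω S : Type*} [MeasurableSpace Ω] (P : Measure Ω)
    [MetricSpace S] [MeasurableSpace S] {m n d : ℕ}
    (Λ : Set (S × E m) → Ω → E d) (ctrl : Measure (S × E m))
    (k : S × E m → Matrix (Fin n) (Fin d) ℝ) : Prop :=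
  ∃ Y : Ω → E n, IsStochInt P Λ ctrl k Y

/-- The translation invariant sphere of influence `A_t = t + A₀`. -/
def sphere {m : ℕ} (A₀ : Set (E m)) (t : E m) : Set (E m) := (fun x => t + x) '' A₀

open Classical in
/-- The integrand `(A, s) ↦ f(A, t - s) 1_{A_t}(s)` of `X_t = ∫_S ∫_{A_t} f(A, t - s) Λ(dA, ds)`. -/
noncomputable def kernelAt {S : Type*} {m n d : ℕ} (f : S × E m → Matrix (Fin n) (Fin d) ℝ)
    (A₀ : Set (E m)) (t : E m) (p : S × E m) : Matrix (Fin n) (Fin d) ℝ :=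
  if p.2 ∈ sphere A₀ t then f (p.1, t - p.2) else 0

/-- `X` is the field `X_t = ∫_S ∫_{A_t} f(A, t - s) Λ(dA, ds)`, where `A_t = t + A₀`. -/
def IsInfluencedMMAF {Ω S : Type*} [MeasurableSpace Ω] (P : Measure Ω)
    [MetricSpace S] [MeasurableSpace S] {m n d : ℕ} (Λ : Set (S × E m) → Ω → E d)
    (π : Measure S) (f : S × E m → Matrix (Fin n) (Fin d) ℝ) (A₀ : Set (E m))
    (X : E m → Ω → E n) : Prop :=
  ∀ t, Measurable (X t) ∧ IsStochInt P Λ (π.prod volume) (kernelAt f A₀ t) (X t)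

/-- `f ∈ L^q(S × ℝᵐ, π ⊗ λ)` for a matrix-valued `f` (entrywise, all norms on matrices being
equivalent). -/
def KernelMemLp {S : Type*} [MeasurableSpace S] {m n d : ℕ}
    (f : S × E m → Matrix (Fin n) (Fin d) ℝ) (q : ℝ≥0∞) (π : Measure S) : Prop :=
  ∀ i j, MemLp (fun p => f p i j) q (π.prod (volume : Measure (E m)))

/-! ### The cone condition and the truncation radius -/

/-- `α ≠ 0` and `sup_{x ∈ A₀, x ≠ 0} α'x / ‖x‖ < 0`. -/
def ScalarProductCond {m : ℕ} (A₀ : Set (E m)) (α : E m) : Prop :=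
  α ≠ 0 ∧ sSup ((fun x => inner ℝ α x / ‖x‖) '' (A₀ \ {0})) < 0

/-- `b = sup_{x ∈ A₀, x ≠ 0} α'x / (‖α‖ ‖x‖)`. -/
noncomputable def bConst {m : ℕ} (A₀ : Set (E m)) (α : E m) : ℝ :=
  sSup ((fun x => inner ℝ α x / (‖α‖ * ‖x‖)) '' (A₀ \ {0}))

/-- `ψ(h) = -b h / √m`. -/
noncomputable def psi {m : ℕ} (A₀ : Set (E m)) (α : E m) (h : ℝ) : ℝ :=
  -bConst A₀ α * h / Real.sqrt m

/-! ### Moments of the Lévy basis and the bounds -/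

/-- The matrix `∫_B x x' ν(dx)`. -/
noncomputable def secondMoment {d : ℕ} (ν : Measure (E d)) (B : Set (E d)) :
    Matrix (Fin d) (Fin d) ℝ :=
  Matrix.of fun i j => ∫ x in B, x i * x j ∂ν

/-- `∫_S ∫_R tr(g(A, s) Q g(A, s)') ds π(dA)`. -/
noncomputable def traceTerm {S : Type*} [MeasurableSpace S] {m n d : ℕ} (π : Measure S)
    (g : S → E m → Matrix (Fin n) (Fin d) ℝ) (R : Set (E m)) (Q : Matrix (Fin d) (Fin d) ℝ) : ℝ :=
  ∫ a, ∫ s in R, (g a s * Q * (g a s).transpose).trace ∂volume ∂π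

/-- `∫_S ∫_R g(A, s) v ds π(dA)`. -/
noncomputable def meanTerm {S : Type*} [MeasurableSpace S] {m n d : ℕ} (π : Measure S)
    (g : S → E m → Matrix (Fin n) (Fin d) ℝ) (R : Set (E m)) (v : E d) : E n :=
  ∫ a, ∫ s in R, mv (g a s) v ∂volume ∂π

/-- `∫_S ∫_R ‖g(A, s) v‖ ds π(dA)`. -/
noncomputable def normTerm {S : Type*} [MeasurableSpace S] {m n d : ℕ} (π : Measure S)
    (g : S → E m → Matrix (Fin n) (Fin d) ℝ) (R : Set (E m)) (v : E d) : ℝ :=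
  ∫ a, ∫ s in R, ‖mv (g a s) v‖ ∂volume ∂π

/-- `∫_S ∫_R ∫_B ‖g(A, s) x‖ ν(dx) ds π(dA)`. -/
noncomputable def jumpTerm {S : Type*} [MeasurableSpace S] {m n d : ℕ} (π : Measure S)
    (g : S → E m → Matrix (Fin n) (Fin d) ℝ) (R : Set (E m)) (ν : Measure (E d))
    (B : Set (E d)) : ℝ :=
  ∫ a, ∫ s in R, ∫ x in B, ‖mv (g a s) x‖ ∂ν ∂volume ∂π

/-- `Σ_Λ = Σ + ∫ x x' ν(dx)`. -/
noncomputable def sigmaLambda {d : ℕ} (Sig : Matrix (Fin d) (Fin d) ℝ) (ν : Measure (E d)) :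
    Matrix (Fin d) (Fin d) ℝ :=
  Sig + secondMoment ν Set.univ

/-- `Σ_{Λ₁} = Σ + ∫_{‖x‖ ≤ 1} x x' ν(dx)`. -/
noncomputable def sigmaLambdaOne {d : ℕ} (Sig : Matrix (Fin d) (Fin d) ℝ) (ν : Measure (E d)) :
    Matrix (Fin d) (Fin d) ℝ :=
  Sig + secondMoment ν {x | ‖x‖ ≤ 1}

/-- `μ_Λ = γ + ∫_{‖x‖ > 1} x ν(dx)`. -/
noncomputable def muLambda {d : ℕ} (γ : E d) (ν : Measure (E d)) : E d :=
  γ + ∫ x in {x | 1 < ‖x‖}, x ∂ν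

/-- `γ₀ = γ - ∫_{‖x‖ ≤ 1} x ν(dx)`. -/
noncomputable def gammaZero {d : ℕ} (γ : E d) (ν : Measure (E d)) : E d :=
  γ - ∫ x in {x | ‖x‖ ≤ 1}, x ∂ν

/-- The truncated region `O A₀ ∩ V_0^{ψ(h)}`. -/
def region {m : ℕ} (O : E m ≃ₗᵢ[ℝ] E m) (A₀ : Set (E m)) (α : E m) (h : ℝ) : Set (E m) :=
  (O '' A₀) ∩ Vh 0 (psi A₀ α h)

/-- `(A, s) ↦ f(A, -O⁻¹ s)`; for `O = 1` this is `f(A, -s)`. -/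
noncomputable def reflKernel {S : Type*} {m n d : ℕ} (O : E m ≃ₗᵢ[ℝ] E m)
    (f : S × E m → Matrix (Fin n) (Fin d) ℝ) (a : S) (s : E m) : Matrix (Fin n) (Fin d) ℝ :=
  f (a, -(O.symm s))

/-- The field `X̃_t = X_{O⁻¹ t}`; for `O = 1` this is `X`. -/
noncomputable def rotate {Ω : Type*} {m n : ℕ} (O : E m ≃ₗᵢ[ℝ] E m) (X : E m → Ω → E n) (t : E m) : Ω → E n :=
  X (O.symm t)

/-- `X` is θ-lex-weakly dependent, and `θ_X(h) ≤ bound h` for all `h > 0`. -/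
def ThetaLexWithBound {Ω : Type*} [MeasurableSpace Ω] (P : Measure Ω) {m n : ℕ}
    (X : E m → Ω → E n) (bound : ℝ → ℝ) : Prop :=
  IsThetaLexWeaklyDependent P X ∧ ∀ h : ℝ, 0 < h → thetaLex P X h ≤ ENNReal.ofReal (bound h)

/-- The integrals `∫_S ∫_{A_t} f(A, t - s) Λ(dA, ds)` exist for all `t`, and, for every field `X`
formed by versions of them, the field `X_{O⁻¹ t}` is θ-lex-weakly dependent with the given bound. -/
def InfluencedThetaLex {Ω S : Type*} [MeasurableSpace Ω] (P : Measure Ω)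
    [MetricSpace S] [MeasurableSpace S] {m n d : ℕ} (Λ : Set (S × E m) → Ω → E d)
    (π : Measure S) (f : S × E m → Matrix (Fin n) (Fin d) ℝ) (A₀ : Set (E m))
    (O : E m ≃ₗᵢ[ℝ] E m) (bound : ℝ → ℝ) : Prop :=
  (∀ t, IsLevyIntegrable P Λ (π.prod volume) (kernelAt f A₀ t)) ∧
  ∀ X : E m → Ω → E n, IsInfluencedMMAF P Λ π f A₀ X → ThetaLexWithBound P (rotate O X) bound

end MMAF

open MMAF

namespace MMAF

/-! After the rotation, the cone condition says that every point y of the rotated sphere of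
influence has first coordinate at most b‖y‖, with b < 0. If i lies in the lexicographic past of j at
maximum distance at least h, the spheres of i and j therefore meet only where the offset from j lies
in R_h (`ScalarProductCond.mem_region`). Split the integral at j into Z, over the points with offset
in R_h, and Y', over the rest of the sphere. Values of Λ on disjoint sets are independent, so Y' is
independent of the whole past vector, and only Z contributes to the covariance, which is at most
2‖F‖_∞ Lip(G) E‖Z‖ (`abs_covariance_le`). Since R_h decreases to ∅, a suitable bound for E‖Z‖ also
gives weak dependence.

One bound for E‖Z‖ serves all four cases. Choose a set K such that ν integrates ‖x‖² on K and ‖x‖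
off K, compensate exactly the jumps in K, and adjust the drift (`IsSplit`). Gaussian part, drift and
compensated jumps are square integrable and give a square root of second moments; the remaining
jumps are estimated in mean (`momentBound`). K is the whole space in (i) and (ii), empty in (iii),
the closed unit ball in (iv). For simple integrands the characteristic function is explicit. The
bound is then read off from approximating laws, a Gaussian vector plus a random walk of pairs, since
first moments are lower semicontinuous under weak convergence (`lintegral_enorm_le_of_charFun_eq`).

For general kernels, the integral may be a limit along any sequence of simple functions g_i
converging a.e., without domination, so the moment bounds of the g_i need not converge. On sets
where all g_i are uniformly bounded, dominated convergence applies. That the integrals over the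
complements are negligible, uniformly for large i, is a Nikodym type statement proved by Baire
category (`IsLevyBasis.exists_uniform_tail`). Together they give `IsLevyBasis.lintegral_limit_le`.
Existence is easier: for dominated simple approximations the moment bound of the differences tends
to 0, so their integrals are Cauchy in mean. -/

/-! ### Random walks of pairs and their moments -/

/-- The characteristic function of `y' + y''` under a measure on pairs `(y', y'')`. -/
noncomputable def pairChar {n : ℕ} (M : Measure (E n × E n)) (u : E n) : ℂ :=
  ∫ y, Complex.exp (Complex.I * (inner ℝ u (y.1 + y.2) : ℝ)) ∂M

lemma norm_exp_I_real (r : ℝ) : ‖Complex.exp (Complex.I * (r : ℂ))‖ = 1 := by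
  rw [mul_comm]; exact Complex.norm_exp_ofReal_mul_I r

lemma continuous_pairExp {n : ℕ} (u : E n) :
    Continuous fun y : E n × E n => Complex.exp (Complex.I * (inner ℝ u (y.1 + y.2) : ℝ)) := by
  fun_prop

lemma integrable_pairExp {n : ℕ} (M : Measure (E n × E n)) [IsFiniteMeasure M] (u : E n) :
    Integrable (fun y : E n × E n => Complex.exp (Complex.I * (inner ℝ u (y.1 + y.2) : ℝ))) M :=
  (integrable_const (1 : ℝ)).mono' (continuous_pairExp u).aestronglyMeasurable
    (Eventually.of_forall fun _ => (norm_exp_I_real _).le)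

/-- Addition of a centred independent pair: second moments add in the first coordinate, first
moments are subadditive in the second one. -/
lemma exists_pair_add {n : ℕ} (M κ : Measure (E n × E n)) [IsProbabilityMeasure M]
    [IsProbabilityMeasure κ] (hM1 : MemLp Prod.fst 2 M) (hM2 : Integrable Prod.snd M)
    (hκ1 : MemLp Prod.fst 2 κ) (hκ2 : Integrable Prod.snd κ) (hκ0 : ∫ y, y.1 ∂κ = 0) :
    ∃ M' : Measure (E n × E n), IsProbabilityMeasure M' ∧ MemLp Prod.fst 2 M' ∧
      Integrable Prod.snd M' ∧
      ∫ y, ‖y.1‖ ^ 2 ∂M' = ∫ y, ‖y.1‖ ^ 2 ∂M + ∫ y, ‖y.1‖ ^ 2 ∂κ ∧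
      ∫ y, ‖y.2‖ ∂M' ≤ ∫ y, ‖y.2‖ ∂M + ∫ y, ‖y.2‖ ∂κ ∧
      ∀ u, pairChar M' u = pairChar M u * pairChar κ u := by
  have hadd : Measurable fun z : (E n × E n) × (E n × E n) => z.1 + z.2 := by fun_prop
  have hfst : Measurable fun z : E n × E n => z.1 := by fun_prop
  have a1 : MemLp (fun z : (E n × E n) × (E n × E n) => z.1.1) 2 (M.prod κ) := hM1.comp_fst κ
  have a2 : MemLp (fun z : (E n × E n) × (E n × E n) => z.2.1) 2 (M.prod κ) := hκ1.comp_snd M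
  have b1 : Integrable (fun z : (E n × E n) × (E n × E n) => z.1.2) (M.prod κ) := hM2.comp_fst κ
  have b2 : Integrable (fun z : (E n × E n) × (E n × E n) => z.2.2) (M.prod κ) := hκ2.comp_snd M
  refine ⟨(M.prod κ).map fun z => z.1 + z.2, Measure.isProbabilityMeasure_map hadd.aemeasurable,
    ?_, ?_, ?_, ?_, ?_⟩
  · rw [memLp_map_measure_iff (by fun_prop) hadd.aemeasurable]
    exact a1.add a2
  · rw [integrable_map_measure (by fun_prop) hadd.aemeasurable]
    exact b1.add b2
  · rw [integral_map hadd.aemeasurable (by fun_prop)]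
    have e : ∀ z : (E n × E n) × (E n × E n), ‖(z.1 + z.2).1‖ ^ 2 =
        ‖z.1.1‖ ^ 2 + 2 * inner ℝ z.1.1 z.2.1 + ‖z.2.1‖ ^ 2 := fun z => by
      rw [Prod.fst_add, norm_add_sq_real]
    simp_rw [e]
    have i1 : Integrable (fun z : (E n × E n) × (E n × E n) => ‖z.1.1‖ ^ 2) (M.prod κ) :=
      a1.integrable_norm_pow (by norm_num)
    have i2 : Integrable (fun z : (E n × E n) × (E n × E n) => ‖z.2.1‖ ^ 2) (M.prod κ) :=
      a2.integrable_norm_pow (by norm_num)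
    have i3 : Integrable (fun z : (E n × E n) × (E n × E n) => inner ℝ z.1.1 z.2.1) (M.prod κ) := by
      refine (i1.add i2).mono' (by fun_prop) (Eventually.of_forall fun z => ?_)
      have := norm_inner_le_norm (𝕜 := ℝ) z.1.1 z.2.1
      simp only [Pi.add_apply]
      nlinarith [sq_nonneg (‖z.1.1‖ - ‖z.2.1‖), sq_nonneg ‖z.1.1‖, sq_nonneg ‖z.2.1‖]
    -- The cross term vanishes because the first coordinate of the added step is centred.
    have hi : ∫ z, inner ℝ z.1.1 z.2.1 ∂(M.prod κ) = 0 := by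
      rw [integral_prod _ i3]
      have : ∀ x : E n × E n, ∫ y : E n × E n, inner ℝ x.1 y.1 ∂κ = 0 := fun x => by
        rw [integral_inner (hκ1.integrable (by norm_num)) x.1, hκ0, inner_zero_right]
      simp [this]
    rw [integral_add (f := fun z : (E n × E n) × (E n × E n) =>
        ‖z.1.1‖ ^ 2 + 2 * inner ℝ z.1.1 z.2.1) (i1.add (i3.const_mul 2)) i2,
      integral_add i1 (i3.const_mul 2), integral_const_mul, hi, mul_zero, add_zero]
    congr 1
    · rw [integral_fun_fst (μ := M) (ν := κ) (fun y : E n × E n => ‖y.1‖ ^ 2)]; simp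
    · rw [integral_fun_snd (μ := M) (ν := κ) (fun y : E n × E n => ‖y.1‖ ^ 2)]; simp
  · rw [integral_map hadd.aemeasurable (by fun_prop)]
    calc ∫ z, ‖(z.1 + z.2).2‖ ∂(M.prod κ) ≤ ∫ z, (‖z.1.2‖ + ‖z.2.2‖) ∂(M.prod κ) :=
          integral_mono (b1.add b2).norm (b1.norm.add b2.norm) fun z => norm_add_le _ _
      _ = _ := by
          rw [integral_add b1.norm b2.norm,
            integral_fun_fst (μ := M) (ν := κ) (fun y : E n × E n => ‖y.2‖),
            integral_fun_snd (μ := M) (ν := κ) (fun y : E n × E n => ‖y.2‖)]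
          simp
  · intro u
    unfold pairChar
    rw [integral_map hadd.aemeasurable (continuous_pairExp u).aestronglyMeasurable,
      ← integral_prod_mul]
    congr 1 with z
    rw [← Complex.exp_add, ← mul_add, ← Complex.ofReal_add, ← inner_add_right]
    congr 4
    simp only [Prod.fst_add, Prod.snd_add]; abel

/-- Keeping pairs allows the two coordinates to depend on each other within a step, while the first
is measured in mean square and the second in mean. -/
lemma exists_pair_walk {n : ℕ} (M κ : Measure (E n × E n)) [IsProbabilityMeasure M]
    [IsProbabilityMeasure κ] (hM1 : MemLp Prod.fst 2 M) (hM2 : Integrable Prod.snd M)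
    (hκ1 : MemLp Prod.fst 2 κ) (hκ2 : Integrable Prod.snd κ) (hκ0 : ∫ y, y.1 ∂κ = 0) (k : ℕ) :
    ∃ M' : Measure (E n × E n), IsProbabilityMeasure M' ∧ MemLp Prod.fst 2 M' ∧
      Integrable Prod.snd M' ∧
      ∫ y, ‖y.1‖ ^ 2 ∂M' = ∫ y, ‖y.1‖ ^ 2 ∂M + k * ∫ y, ‖y.1‖ ^ 2 ∂κ ∧
      ∫ y, ‖y.2‖ ∂M' ≤ ∫ y, ‖y.2‖ ∂M + k * ∫ y, ‖y.2‖ ∂κ ∧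
      ∀ u, pairChar M' u = pairChar M u * pairChar κ u ^ k := by
  induction k with
  | zero => exact ⟨M, inferInstance, hM1, hM2, by simp, by simp, by simp⟩
  | succ k ih =>
    obtain ⟨N, hN, h1, h2, h3, h4, h5⟩ := ih
    obtain ⟨N', hN', h1', h2', h3', h4', h5'⟩ := exists_pair_add N κ h1 h2 hκ1 hκ2 hκ0
    refine ⟨N', hN', h1', h2', ?_, ?_, fun u => ?_⟩
    · rw [h3', h3]; push_cast; ring
    · push_cast; linarith
    · rw [h5', h5, pow_succ]; ring

/-- The variance of `‖X‖` is nonnegative. -/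
lemma sq_integral_norm_le {α F : Type*} [MeasurableSpace α] [NormedAddCommGroup F]
    (μ : Measure α) [IsProbabilityMeasure μ] {X : α → F} (hX : MemLp X 2 μ) :
    ∫ x, ‖X x‖ ∂μ ≤ Real.sqrt (∫ x, ‖X x‖ ^ 2 ∂μ) := by
  apply Real.le_sqrt_of_sq_le
  have h := variance_nonneg (fun x => ‖X x‖) μ
  rw [variance_eq_sub hX.norm] at h
  simpa using h

lemma integral_norm_sq_multivariateGaussian {n : ℕ} (a : E n) {S : Matrix (Fin n) (Fin n) ℝ}
    (hS : S.PosSemidef) :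
    ∫ x, ‖x‖ ^ 2 ∂(multivariateGaussian a S) = S.trace + ‖a‖ ^ 2 := by
  have hm : MemLp (id : E n → E n) 2 (multivariateGaussian a S) := IsGaussian.memLp_two_id
  have hmi : ∀ i, MemLp (fun x : E n => x i) 2 (multivariateGaussian a S) := fun i =>
    hm.continuousLinearMap_comp (EuclideanSpace.proj (𝕜 := ℝ) i)
  have hi : ∀ i, ∫ x : E n, (x i) ^ 2 ∂(multivariateGaussian a S) = S i i + (a i) ^ 2 := fun i => by
    have h1 := variance_eval_multivariateGaussian (μ := a) hS i
    have h2 : ∫ x : E n, x i ∂(multivariateGaussian a S) = a i := by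
      have := (EuclideanSpace.proj i : E n →L[ℝ] ℝ).integral_comp_id_comm
        (μ := multivariateGaussian a S) (hm.integrable (by norm_num))
      simpa using this
    rw [variance_eq_sub (hmi i)] at h1
    simp only [Pi.pow_apply, h2] at h1
    linarith
  simp_rw [EuclideanSpace.real_norm_sq_eq]
  rw [integral_finsetSum _ fun i _ => (hmi i).integrable_sq]
  simp_rw [hi, Finset.sum_add_distrib, Matrix.trace, Matrix.diag]

/-- `(1 - ρ(W) / k) δ_0 + ρ / k`. -/
noncomputable def jumpLaw {n : ℕ} (ρ : Measure (E n × E n)) (k : ℕ) : Measure (E n × E n) :=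
  ENNReal.ofReal (1 - ρ.real Set.univ / k) • Measure.dirac 0 + ENNReal.ofReal (1 / k) • ρ

section jumpLaw
variable {n : ℕ} (ρ : Measure (E n × E n)) [IsFiniteMeasure ρ] {k : ℕ}

lemma isProbabilityMeasure_jumpLaw (hk : 0 < k) (hρ : ρ.real Set.univ ≤ k) :
    IsProbabilityMeasure (jumpLaw ρ k) := by
  have hk' : (0 : ℝ) < k := by exact_mod_cast hk
  constructor
  rw [jumpLaw, Measure.add_apply, Measure.smul_apply, Measure.smul_apply, measure_univ,
    ← ofReal_measureReal, smul_eq_mul, smul_eq_mul, mul_one,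
    ← ENNReal.ofReal_mul (by positivity), ← ENNReal.ofReal_add _ (by positivity)]
  · rw [ENNReal.ofReal_eq_one]; field_simp; ring
  · rw [sub_nonneg, div_le_one hk']; exact hρ

lemma integrable_jumpLaw {F : Type*} [NormedAddCommGroup F] {φ : E n × E n → F}
    (hφ : Integrable φ ρ) : Integrable φ (jumpLaw ρ k) := by
  refine Integrable.add_measure (Integrable.smul_measure ?_ ENNReal.ofReal_ne_top)
    (hφ.smul_measure ENNReal.ofReal_ne_top)
  exact integrable_dirac (by simp)

lemma integral_jumpLaw {F : Type*} [NormedAddCommGroup F] [NormedSpace ℝ F] [CompleteSpace F]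
    {φ : E n × E n → F} (hφ : Integrable φ ρ) (hk : 0 < k) (hρ : ρ.real Set.univ ≤ k) :
    ∫ y, φ y ∂(jumpLaw ρ k) = (1 - ρ.real Set.univ / k) • φ 0 + (1 / k : ℝ) • ∫ y, φ y ∂ρ := by
  have hk' : (0 : ℝ) < k := by exact_mod_cast hk
  rw [jumpLaw, integral_add_measure, integral_smul_measure, integral_smul_measure, integral_dirac,
    ENNReal.toReal_ofReal, ENNReal.toReal_ofReal (by positivity)]
  · rw [sub_nonneg, div_le_one hk']; exact hρ
  · exact (integrable_dirac (by simp)).smul_measure ENNReal.ofReal_ne_top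
  · exact hφ.smul_measure ENNReal.ofReal_ne_top

lemma memLp_jumpLaw {φ : E n × E n → E n} (hφ : MemLp φ 2 ρ) : MemLp φ 2 (jumpLaw ρ k) := by
  have h0 : AEStronglyMeasurable φ (jumpLaw ρ k) := by
    refine AEStronglyMeasurable.add_measure (AEStronglyMeasurable.smul_measure ?_ _)
      (hφ.aestronglyMeasurable.smul_measure _)
    exact aestronglyMeasurable_dirac
  rw [← integrable_norm_rpow_iff h0 (by norm_num) (by norm_num)]
  exact integrable_jumpLaw ρ ((integrable_norm_rpow_iff hφ.aestronglyMeasurable (by norm_num)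
    (by norm_num)).2 hφ)

lemma pairChar_jumpLaw (hk : 0 < k) (hρ : ρ.real Set.univ ≤ k) (u : E n) :
    pairChar (jumpLaw ρ k) u =
      1 + (∫ y, (Complex.exp (Complex.I * (inner ℝ u (y.1 + y.2) : ℝ)) - 1) ∂ρ) / k := by
  have hk' : (k : ℂ) ≠ 0 := by exact_mod_cast hk.ne'
  rw [pairChar, integral_jumpLaw ρ (integrable_pairExp ρ u) hk hρ,
    integral_sub (integrable_pairExp ρ u) (integrable_const _), integral_const]
  simp
  field_simp
  ring

/-- The law of `a` plus a Gaussian vector plus a compensated random walk with step law `jumpLaw`. -/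
lemma exists_law_of_finite_jumps {S : Matrix (Fin n) (Fin n) ℝ} (hS : S.PosSemidef) (a : E n)
    (hρ1 : MemLp Prod.fst 2 ρ) (hρ2 : Integrable Prod.snd ρ) (hk : 0 < k)
    (hρ : ρ.real Set.univ ≤ k) :
    ∃ μ : Measure (E n), IsProbabilityMeasure μ ∧
      ∫⁻ z, ‖z‖ₑ ∂μ ≤ ENNReal.ofReal (Real.sqrt (S.trace + ‖a‖ ^ 2 + ∫ y, ‖y.1‖ ^ 2 ∂ρ) +
        ∫ y, ‖y.2‖ ∂ρ) ∧
      ∀ u, charFun μ u = Complex.exp (Complex.I * (inner ℝ a u : ℝ) -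
          (1 / 2 : ℂ) * (inner ℝ u (mv S u) : ℝ) - Complex.I * (inner ℝ u (∫ y, y.1 ∂ρ) : ℝ)) *
        (1 + (∫ y, (Complex.exp (Complex.I * (inner ℝ u (y.1 + y.2) : ℝ)) - 1) ∂ρ) / k) ^ k := by
  have hk' : (0 : ℝ) < k := by exact_mod_cast hk
  have hkC : (k : ℂ) ≠ 0 := by exact_mod_cast hk.ne'
  have := isProbabilityMeasure_jumpLaw ρ hk hρ
  set c : E n := (1 / k : ℝ) • ∫ y, y.1 ∂ρ with hc
  have hJ1 : MemLp Prod.fst 2 (jumpLaw ρ k) := memLp_jumpLaw ρ hρ1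
  have hJ2 : Integrable Prod.snd (jumpLaw ρ k) := integrable_jumpLaw ρ hρ2
  have hJc : ∫ y, y.1 ∂(jumpLaw ρ k) = c := by
    rw [integral_jumpLaw ρ (hρ1.integrable (by norm_num)) hk hρ]; simp [hc]
  have hT : Measurable fun y : E n × E n => (y.1 - c, y.2) := by fun_prop
  -- The shift by `c` centres the first coordinate. Over `k` steps it adds up to `∫ y, y.1 ∂ρ`, the
  -- compensator in the characteristic function.
  set κ := (jumpLaw ρ k).map fun y => (y.1 - c, y.2) with hκ
  have : IsProbabilityMeasure κ := Measure.isProbabilityMeasure_map hT.aemeasurable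
  have hκ1 : MemLp Prod.fst 2 κ := by
    rw [hκ, memLp_map_measure_iff (by fun_prop) hT.aemeasurable]
    exact hJ1.sub (memLp_const c)
  have hκ2 : Integrable Prod.snd κ := by
    rw [hκ, integrable_map_measure (by fun_prop) hT.aemeasurable]
    exact hJ2
  have hκ0 : ∫ y, y.1 ∂κ = 0 := by
    rw [hκ, integral_map hT.aemeasurable (by fun_prop)]
    rw [integral_sub (hJ1.integrable (by norm_num)) (integrable_const c), hJc]
    simp
  have hκsq : k * ∫ y, ‖y.1‖ ^ 2 ∂κ ≤ ∫ y, ‖y.1‖ ^ 2 ∂ρ := by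
    have i1 : Integrable (fun y : E n × E n => ‖y.1‖ ^ 2) (jumpLaw ρ k) :=
      hJ1.integrable_norm_pow (by norm_num)
    have i2 : Integrable (fun y : E n × E n => inner ℝ c y.1) (jumpLaw ρ k) :=
      (hJ1.integrable (by norm_num)).const_inner c
    have e1 : ∫ y, ‖y.1‖ ^ 2 ∂(jumpLaw ρ k) = (1 / k : ℝ) * ∫ y, ‖y.1‖ ^ 2 ∂ρ := by
      rw [integral_jumpLaw ρ (hρ1.integrable_norm_pow (by norm_num)) hk hρ]; simp
    have e : ∫ y, ‖y.1‖ ^ 2 ∂κ = (1 / k : ℝ) * ∫ y, ‖y.1‖ ^ 2 ∂ρ - ‖c‖ ^ 2 := by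
      rw [hκ, integral_map hT.aemeasurable (by fun_prop)]
      have : ∀ y : E n × E n, ‖(y.1 - c, y.2).1‖ ^ 2 =
          ‖y.1‖ ^ 2 - 2 * inner ℝ c y.1 + ‖c‖ ^ 2 := fun y => by
        rw [norm_sub_sq_real, real_inner_comm]
      simp_rw [this]
      rw [integral_add (f := fun y : E n × E n => ‖y.1‖ ^ 2 - 2 * inner ℝ c y.1)
        (i1.sub (i2.const_mul 2)) (integrable_const _), integral_sub i1 (i2.const_mul 2),
        integral_const_mul, integral_inner (hJ1.integrable (by norm_num)), hJc,
        real_inner_self_eq_norm_sq, e1]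
      simp; ring
    rw [e, mul_sub, ← mul_assoc, mul_one_div_cancel hk'.ne', one_mul]
    nlinarith [sq_nonneg ‖c‖]
  have hκn : k * ∫ y, ‖y.2‖ ∂κ = ∫ y, ‖y.2‖ ∂ρ := by
    rw [hκ, integral_map hT.aemeasurable (by fun_prop)]
    change k * ∫ y, ‖y.2‖ ∂(jumpLaw ρ k) = _
    rw [integral_jumpLaw ρ hρ2.norm hk hρ]
    simp
    field_simp
  have hG : Measurable fun x : E n => (x, (0 : E n)) := by fun_prop
  -- Gaussian part and drift start the walk in the first coordinate, so that they enter under the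
  -- square root.
  set M := (multivariateGaussian a S).map fun x => (x, (0 : E n)) with hM
  have : IsProbabilityMeasure M := Measure.isProbabilityMeasure_map hG.aemeasurable
  have hM1 : MemLp Prod.fst 2 M := by
    rw [hM, memLp_map_measure_iff (by fun_prop) hG.aemeasurable]
    exact (IsGaussian.memLp_two_id : MemLp (id : E n → E n) 2 (multivariateGaussian a S))
  have hM2 : Integrable Prod.snd M := by
    rw [hM, integrable_map_measure (by fun_prop) hG.aemeasurable]
    exact integrable_zero _ _ _
  obtain ⟨N, hN, h1, h2, h3, h4, h5⟩ := exists_pair_walk M κ hM1 hM2 hκ1 hκ2 hκ0 k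
  have hA : Measurable fun y : E n × E n => y.1 + y.2 := by fun_prop
  refine ⟨N.map fun y => y.1 + y.2, Measure.isProbabilityMeasure_map hA.aemeasurable, ?_, ?_⟩
  · have h1i : Integrable Prod.fst N := h1.integrable (by norm_num)
    have hint : Integrable (fun y : E n × E n => y.1 + y.2) N := h1i.add h2
    rw [lintegral_map (by fun_prop) hA, ← ofReal_integral_norm_eq_lintegral_enorm hint]
    apply ENNReal.ofReal_le_ofReal
    calc ∫ y, ‖y.1 + y.2‖ ∂N ≤ ∫ y, (‖y.1‖ + ‖y.2‖) ∂N :=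
          integral_mono hint.norm (h1i.norm.add h2.norm) fun y => norm_add_le _ _
      _ = ∫ y, ‖y.1‖ ∂N + ∫ y, ‖y.2‖ ∂N := integral_add h1i.norm h2.norm
      _ ≤ _ := by
        have hMsq : ∫ y, ‖y.1‖ ^ 2 ∂M = S.trace + ‖a‖ ^ 2 := by
          rw [hM, integral_map hG.aemeasurable (by fun_prop),
            integral_norm_sq_multivariateGaussian a hS]
        have hMn : ∫ y, ‖y.2‖ ∂M = 0 := by
          rw [hM, integral_map hG.aemeasurable (by fun_prop)]; simp
        refine add_le_add ((sq_integral_norm_le N h1).trans (Real.sqrt_le_sqrt ?_)) ?_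
        · rw [h3, hMsq]; linarith
        · rw [hMn, hκn] at h4; linarith
  · intro u
    have hc1 : charFun (N.map fun y => y.1 + y.2) u = pairChar N u := by
      rw [charFun_apply, integral_map hA.aemeasurable (by fun_prop), pairChar]
      congr 1 with y
      rw [mul_comm, real_inner_comm]
    have hc2 : pairChar M u = Complex.exp (Complex.I * (inner ℝ a u : ℝ) -
          (1 / 2 : ℂ) * (inner ℝ u (mv S u) : ℝ)) := by
      rw [pairChar, hM, integral_map hG.aemeasurable (continuous_pairExp u).aestronglyMeasurable]
      have := charFun_multivariateGaussian (μ := a) hS u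
      rw [charFun_apply] at this
      have e : ∀ x : E n, Complex.exp (Complex.I * (inner ℝ u (x + 0) : ℝ)) =
          Complex.exp ((inner ℝ x u : ℝ) * Complex.I) := fun x => by
        rw [add_zero, mul_comm, real_inner_comm]
      simp_rw [e, this]
      congr 1
      rw [real_inner_comm, mul_comm]
      congr 1
      have : inner ℝ u (mv S u) = WithLp.ofLp u ⬝ᵥ S.mulVec (WithLp.ofLp u) := by
        rw [mv, EuclideanSpace.inner_eq_star_dotProduct, dotProduct_comm]; simp
      rw [this]; ring
    have hc3 : pairChar κ u = Complex.exp (-(Complex.I * (inner ℝ u c : ℝ))) *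
        pairChar (jumpLaw ρ k) u := by
      rw [pairChar, hκ, integral_map hT.aemeasurable (continuous_pairExp u).aestronglyMeasurable,
        pairChar, ← integral_const_mul]
      congr 1 with y
      rw [← Complex.exp_add]
      congr 1
      simp only [inner_add_right, inner_sub_right]
      push_cast; ring
    rw [hc1, h5, hc2, hc3, pairChar_jumpLaw ρ hk hρ, mul_pow, ← Complex.exp_nat_mul, ← mul_assoc,
      ← Complex.exp_add]
    congr 2
    rw [hc, inner_smul_right]
    push_cast
    field_simp
    ring

end jumpLaw

/-! ### Compound Poisson approximation and the first moment of an infinitely divisible law -/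

/-- Taylor's estimate for |s| ≤ 1; otherwise the trivial bound 2 + |s| is at most 3s². -/
lemma norm_exp_I_sub_one_sub_le (s : ℝ) :
    ‖Complex.exp (Complex.I * (s : ℂ)) - 1 - Complex.I * (s : ℂ)‖ ≤ 3 * s ^ 2 := by
  have hs : ‖Complex.I * (s : ℂ)‖ = |s| := by simp
  rcases le_or_gt |s| 1 with h | h
  · have := Complex.norm_exp_sub_one_sub_id_le (x := Complex.I * (s : ℂ)) (by rw [hs]; exact h)
    rw [hs, sq_abs] at this
    nlinarith [sq_nonneg s]
  · have h1 : ‖Complex.exp (Complex.I * (s : ℂ)) - 1 - Complex.I * (s : ℂ)‖ ≤ 1 + 1 + |s| := by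
      refine (norm_sub_le _ _).trans ?_
      rw [hs]
      gcongr
      refine (norm_sub_le _ _).trans ?_
      rw [norm_exp_I_real]; simp
    rw [← sq_abs]
    nlinarith

/-- Factoring out `exp (I * s)` separates the uncompensated jump t, of first order, from the
compensated jump s, of second order. -/
lemma norm_exp_I_add_sub_le (s t : ℝ) :
    ‖Complex.exp (Complex.I * ((s + t : ℝ) : ℂ)) - 1 - Complex.I * (s : ℂ)‖ ≤
      |t| + 3 * s ^ 2 := by
  have e : Complex.exp (Complex.I * ((s + t : ℝ) : ℂ)) - 1 - Complex.I * (s : ℂ) =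
      Complex.exp (Complex.I * (s : ℂ)) * (Complex.exp (Complex.I * (t : ℂ)) - 1) +
      (Complex.exp (Complex.I * (s : ℂ)) - 1 - Complex.I * (s : ℂ)) := by
    rw [Complex.ofReal_add, mul_add, Complex.exp_add]; ring
  rw [e]
  refine (norm_add_le _ _).trans (add_le_add ?_ (norm_exp_I_sub_one_sub_le s))
  rw [norm_mul, norm_exp_I_real, one_mul]
  exact Real.norm_exp_I_mul_ofReal_sub_one_le

lemma integrable_jumpExp {n : ℕ} {ρ : Measure (E n × E n)} (hρ1 : MemLp Prod.fst 2 ρ)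
    (hρ2 : Integrable Prod.snd ρ) (u : E n) :
    Integrable (fun y : E n × E n => Complex.exp (Complex.I * (inner ℝ u (y.1 + y.2) : ℝ)) - 1 -
      Complex.I * (inner ℝ u y.1 : ℝ)) ρ := by
  have h1 : Integrable (fun y : E n × E n => ‖y.1‖ ^ 2) ρ :=
    hρ1.integrable_norm_pow (by norm_num)
  refine ((hρ2.norm.const_mul ‖u‖).add (h1.const_mul (3 * ‖u‖ ^ 2))).mono' (by fun_prop)
    (Eventually.of_forall fun y => ?_)
  have h := norm_exp_I_add_sub_le (inner ℝ u y.1) (inner ℝ u y.2)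
  rw [inner_add_right]
  refine h.trans ?_
  have e1 := abs_real_inner_le_norm u y.2
  have e2 := abs_real_inner_le_norm u y.1
  have e3 : (inner ℝ u y.1) ^ 2 ≤ (‖u‖ * ‖y.1‖) ^ 2 := by
    rw [← sq_abs]; gcongr
  simp only [Pi.add_apply]
  nlinarith

lemma norm_pow_sub_pow_le {a b : ℂ} (ha : ‖a‖ ≤ 1) (hb : ‖b‖ ≤ 1) (k : ℕ) :
    ‖a ^ k - b ^ k‖ ≤ k * ‖a - b‖ := by
  induction k with
  | zero => simp
  | succ k ih =>
    have e : a ^ (k + 1) - b ^ (k + 1) = a * (a ^ k - b ^ k) + (a - b) * b ^ k := by ring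
    rw [e]
    refine (norm_add_le _ _).trans ?_
    rw [norm_mul, norm_mul, norm_pow]
    have : ‖b‖ ^ k ≤ 1 := pow_le_one₀ (norm_nonneg _) hb
    push_cast
    nlinarith [norm_nonneg (a - b), norm_nonneg (a ^ k - b ^ k),
      mul_le_mul_of_nonneg_right ha (norm_nonneg (a ^ k - b ^ k)),
      mul_le_mul_of_nonneg_left this (norm_nonneg (a - b))]

/-- Compound Poisson approximation: `(1 + z / k) ^ k` is close to `exp z`. -/
lemma norm_one_add_pow_sub_exp_le {z : ℂ} {k : ℕ} (hk : 0 < k) (hz : ‖z‖ ≤ k)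
    (h1 : ‖1 + z / k‖ ≤ 1) (hre : z.re ≤ 0) : ‖(1 + z / k) ^ k - Complex.exp z‖ ≤ ‖z‖ ^ 2 / k := by
  have hk' : (0 : ℝ) < k := by exact_mod_cast hk
  have hkC : (k : ℂ) ≠ 0 := by exact_mod_cast hk.ne'
  have e : Complex.exp z = Complex.exp (z / k) ^ k := by
    rw [← Complex.exp_nat_mul, mul_div_cancel₀ _ hkC]
  have hn : ‖z / k‖ = ‖z‖ / k := by rw [norm_div, Complex.norm_natCast]
  rw [e]
  refine (norm_pow_sub_pow_le h1 ?_ k).trans ?_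
  · rw [Complex.norm_exp, Real.exp_le_one_iff, Complex.div_natCast_re]
    exact div_nonpos_of_nonpos_of_nonneg hre hk'.le
  · have := Complex.norm_exp_sub_one_sub_id_le (x := z / k)
      (by rw [hn]; exact (div_le_one hk').2 hz)
    rw [hn] at this
    calc k * ‖1 + z / k - Complex.exp (z / k)‖ = k * ‖Complex.exp (z / k) - 1 - z / k‖ := by
          rw [← norm_neg]; congr 2; ring
      _ ≤ k * (‖z‖ / k) ^ 2 := by gcongr
      _ = ‖z‖ ^ 2 / k := by field_simp

/-- Lévy's continuity theorem gives weak convergence, and the portmanteau theorem makes the integral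
of the nonnegative continuous function `‖z‖` lower semicontinuous. -/
lemma lintegral_enorm_le_of_tendsto_charFun {n : ℕ} {μ : Measure (E n)} [IsProbabilityMeasure μ]
    {μs : ℕ → Measure (E n)} [∀ i, IsProbabilityMeasure (μs i)] {C : ℝ≥0∞}
    (h : ∀ u, Tendsto (fun i => charFun (μs i) u) atTop (𝓝 (charFun μ u)))
    (hC : ∀ i, ∫⁻ z, ‖z‖ₑ ∂(μs i) ≤ C) : ∫⁻ z, ‖z‖ₑ ∂μ ≤ C := by
  let p : ProbabilityMeasure (E n) := ⟨μ, inferInstance⟩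
  let ps : ℕ → ProbabilityMeasure (E n) := fun i => ⟨μs i, inferInstance⟩
  have hw : Tendsto ps atTop (𝓝 p) :=
    ProbabilityMeasure.tendsto_iff_tendsto_charFun.2 h
  have := lintegral_le_liminf_lintegral_of_forall_isOpen_measure_le_liminf_measure
    (μ := μ) (μs := μs) (f := fun z : E n => ‖z‖) continuous_norm (fun _ => norm_nonneg _)
    fun G hG => ProbabilityMeasure.le_liminf_measure_open_of_tendsto hw hG
  simp_rw [ofReal_norm] at this
  exact this.trans (liminf_le_of_frequently_le' (Frequently.of_forall hC))

/-- First moment bound for an infinitely divisible law whose jumps are split into a compensated,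
square integrable part `y'` and an integrable part `y''`. -/
theorem lintegral_enorm_le_of_charFun_eq {n : ℕ} {μ : Measure (E n)} [IsProbabilityMeasure μ]
    {S : Matrix (Fin n) (Fin n) ℝ} (hS : S.PosSemidef) (a : E n) {ρ : Measure (E n × E n)}
    (hρ1 : MemLp Prod.fst 2 ρ) (hρ2 : Integrable Prod.snd ρ)
    (hμ : ∀ u, charFun μ u = Complex.exp (Complex.I * (inner ℝ a u : ℝ) -
      (1 / 2 : ℂ) * (inner ℝ u (mv S u) : ℝ) +
      ∫ y, (Complex.exp (Complex.I * (inner ℝ u (y.1 + y.2) : ℝ)) - 1 -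
        Complex.I * (inner ℝ u y.1 : ℝ)) ∂ρ)) :
    ∫⁻ z, ‖z‖ₑ ∂μ ≤ ENNReal.ofReal (Real.sqrt (S.trace + ‖a‖ ^ 2 + ∫ y, ‖y.1‖ ^ 2 ∂ρ) +
      ∫ y, ‖y.2‖ ∂ρ) := by
  -- Removing the small jumps leaves a finite jump measure, by Markov's inequality in each
  -- coordinate.
  set T : ℕ → Set (E n × E n) := fun N => {y | 1 / ((N : ℝ) + 1) < ‖y.1‖ + ‖y.2‖} with hT
  have hTm : ∀ N, MeasurableSet (T N) := fun N => measurableSet_lt (by fun_prop) (by fun_prop)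
  have hTmono : Monotone T := by
    intro N N' h y hy
    simp only [hT, Set.mem_ofPred_eq] at hy ⊢
    refine lt_of_le_of_lt ?_ hy
    have : (N : ℝ) ≤ N' := by exact_mod_cast h
    gcongr
  have hTfin : ∀ N, ρ (T N) < ∞ := by
    intro N
    have hpos : (0 : ℝ) < 1 / ((N : ℝ) + 1) / 2 := by positivity
    have f1 := (hρ1.integrable_norm_pow (by norm_num)).measure_norm_ge_lt_top
      (ε := (1 / ((N : ℝ) + 1) / 2) ^ 2) (by positivity)
    have f2 := hρ2.measure_norm_ge_lt_top hpos
    refine lt_of_le_of_lt (measure_mono ?_) ((measure_union_le _ _).trans_lt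
      (ENNReal.add_lt_top.2 ⟨f1, f2⟩))
    intro y hy
    simp only [hT, Set.mem_ofPred_eq] at hy
    by_contra hcon
    simp only [Set.mem_union, Set.mem_ofPred_eq, not_or, not_le, norm_pow, norm_norm] at hcon
    have := lt_of_pow_lt_pow_left₀ 2 hpos.le hcon.1
    linarith [hcon.2]
  set ρs : ℕ → Measure (E n × E n) := fun N => ρ.restrict (T N) with hρs
  have hfin : ∀ N, IsFiniteMeasure (ρs N) := fun N => ⟨by simpa [hρs] using hTfin N⟩
  set L : ℕ → ℝ := fun N => (ρs N).real Set.univ with hL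
  have hL0 : ∀ N, 0 ≤ L N := fun N => measureReal_nonneg
  -- As `‖z N‖ ≤ 2 * L N` below, this size gives both `‖z N‖ ≤ k N` and an error `‖z N‖ ^ 2 / k N`
  -- of at most `1 / (N + 1)`.
  obtain ⟨k, hk⟩ : ∃ k : ℕ → ℕ, ∀ N : ℕ, ((N : ℝ) + 1) * (2 * L N + 1) ^ 2 ≤ k N :=
    ⟨fun N => ⌈((N : ℝ) + 1) * (2 * L N + 1) ^ 2⌉₊, fun N => Nat.le_ceil _⟩
  have hk2 : ∀ N, 2 * L N + 1 ≤ k N := fun N => by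
    have := hk N
    have h0 : (0 : ℝ) ≤ N := Nat.cast_nonneg N
    nlinarith [hL0 N, mul_nonneg h0 (sq_nonneg (2 * L N + 1)), mul_nonneg (hL0 N) (hL0 N)]
  have hkpos : ∀ N, 0 < k N := fun N => by
    have : (0 : ℝ) < k N := by linarith [hk2 N, hL0 N]
    exact_mod_cast this
  have hLk : ∀ N, L N ≤ k N := fun N => by linarith [hk2 N, hL0 N]
  choose μs hμs hb hc using fun N => exists_law_of_finite_jumps (ρs N) hS a
    (hρ1.restrict (T N)) (hρ2.restrict) (hkpos N) (hLk N)
  have hsq : Integrable (fun y : E n × E n => ‖y.1‖ ^ 2) ρ :=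
    hρ1.integrable_norm_pow (by norm_num)
  refine lintegral_enorm_le_of_tendsto_charFun (μs := μs) (fun u => ?_) fun N => ?_
  swap
  · refine (hb N).trans (ENNReal.ofReal_le_ofReal (add_le_add (Real.sqrt_le_sqrt ?_) ?_))
    · exact add_le_add le_rfl
        (setIntegral_le_integral hsq (Eventually.of_forall fun y => sq_nonneg _))
    · exact setIntegral_le_integral hρ2.norm (Eventually.of_forall fun y => norm_nonneg _)
  set A : ℂ := Complex.I * (inner ℝ a u : ℝ) - (1 / 2 : ℂ) * (inner ℝ u (mv S u) : ℝ) with hA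
  set J : E n × E n → ℂ := fun y => Complex.exp (Complex.I * (inner ℝ u (y.1 + y.2) : ℝ)) - 1 -
        Complex.I * (inner ℝ u y.1 : ℝ) with hJ
  have hJi : Integrable J ρ := integrable_jumpExp hρ1 hρ2 u
  set z : ℕ → ℂ := fun N =>
    ∫ y, (Complex.exp (Complex.I * (inner ℝ u (y.1 + y.2) : ℝ)) - 1) ∂(ρs N) with hz
  have hzi : ∀ N, Integrable
      (fun y : E n × E n => Complex.exp (Complex.I * (inner ℝ u (y.1 + y.2) : ℝ)) - 1) (ρs N) :=
    fun N => (integrable_pairExp _ u).sub (integrable_const _)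
  have hzn : ∀ N, ‖z N‖ ≤ 2 * L N := fun N => by
    have := norm_integral_le_of_norm_le_const (μ := ρs N) (C := 2)
      (f := fun y : E n × E n => Complex.exp (Complex.I * (inner ℝ u (y.1 + y.2) : ℝ)) - 1)
      (Eventually.of_forall fun y => (norm_sub_le _ _).trans (by
        rw [norm_exp_I_real]; norm_num))
    exact this
  have hzre : ∀ N, (z N).re ≤ 0 := fun N => by
    have : (z N).re = ∫ y, (Complex.exp (Complex.I * (inner ℝ u (y.1 + y.2) : ℝ)) - 1).re ∂(ρs N) :=
      (integral_re (hzi N)).symm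
    rw [this]
    refine integral_nonpos fun y => ?_
    have h := Complex.re_le_norm (Complex.exp (Complex.I * (inner ℝ u (y.1 + y.2) : ℝ)))
    rw [norm_exp_I_real] at h
    simpa using h
  -- The left side is the modulus of the characteristic function of one uncentred step.
  have hzk : ∀ N, ‖1 + z N / k N‖ ≤ 1 := fun N => by
    have := isProbabilityMeasure_jumpLaw (ρs N) (hkpos N) (hLk N)
    rw [hz, ← pairChar_jumpLaw (ρs N) (hkpos N) (hLk N), pairChar]
    refine (norm_integral_le_of_norm_le_const (C := 1)
      (Eventually.of_forall fun y => (norm_exp_I_real _).le)).trans ?_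
    simp
  have hzJ : ∀ N, z N - Complex.I * (inner ℝ u (∫ y, y.1 ∂(ρs N)) : ℝ) = ∫ y in T N, J y ∂ρ := by
    intro N
    have i1 : Integrable (fun y : E n × E n => y.1) (ρs N) :=
      (hρ1.restrict (T N)).integrable (by norm_num)
    change _ = ∫ y, J y ∂(ρs N)
    have i2 : Integrable (fun y : E n × E n => Complex.I * ((inner ℝ u y.1 : ℝ) : ℂ)) (ρs N) :=
      (i1.const_inner u).ofReal.const_mul _
    simp only [hJ]
    rw [integral_sub (hzi N) i2, integral_const_mul,
      ← integral_inner i1, ← integral_complex_ofReal]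
  have hJlim : Tendsto (fun N => ∫ y in T N, J y ∂ρ) atTop (𝓝 (∫ y, J y ∂ρ)) := by
    have := tendsto_setIntegral_of_monotone (μ := ρ) (f := J) hTm hTmono hJi.integrableOn
    -- The sets `T N` exhaust everything but the origin, where `J` vanishes.
    rwa [setIntegral_eq_integral_of_forall_compl_eq_zero] at this
    intro y hy
    have hy0 : ‖y.1‖ + ‖y.2‖ ≤ 0 := by
      by_contra hcon
      obtain ⟨N, hN⟩ := exists_nat_one_div_lt (not_le.1 hcon)
      exact hy (Set.mem_iUnion.2 ⟨N, hN⟩)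
    have h1 : y.1 = 0 := norm_le_zero_iff.1 (by linarith [norm_nonneg y.2])
    have h2 : y.2 = 0 := norm_le_zero_iff.1 (by linarith [norm_nonneg y.1])
    simp [hJ, h1, h2]
  have hexp : Tendsto (fun N => Complex.exp (A + ∫ y in T N, J y ∂ρ)) atTop
      (𝓝 (charFun μ u)) := by
    rw [hμ u]
    exact (Complex.continuous_exp.tendsto _).comp (hJlim.const_add A)
  refine tendsto_of_tendsto_of_dist hexp ?_
  refine squeeze_zero (fun _ => dist_nonneg) (g := fun N : ℕ => ‖Complex.exp A‖ * (1 / ((N : ℝ) + 1)))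
    (fun N => ?_) (by simpa using tendsto_one_div_add_atTop_nhds_zero_nat.const_mul ‖Complex.exp A‖)
  have hkr : (0 : ℝ) < k N := by exact_mod_cast hkpos N
  rw [dist_comm, dist_eq_norm, hc N u, ← hzJ N]
  -- The compensator contributes a unimodular factor, so only the difference of `(1 + z N / k N) ^ k
  -- N` and `exp (z N)` remains.
  have e : Complex.exp (A - Complex.I * (inner ℝ u (∫ y, y.1 ∂(ρs N)) : ℝ)) *
      (1 + z N / k N) ^ k N -
      Complex.exp (A + (z N - Complex.I * (inner ℝ u (∫ y, y.1 ∂(ρs N)) : ℝ))) =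
      Complex.exp A * (Complex.exp (Complex.I * ((-inner ℝ u (∫ y, y.1 ∂(ρs N)) : ℝ) : ℂ)) *
      ((1 + z N / k N) ^ k N - Complex.exp (z N))) := by
    rw [mul_sub, mul_sub, ← mul_assoc, ← mul_assoc, ← Complex.exp_add, ← Complex.exp_add]
    push_cast
    congr 2
    · congr 1; ring
    · ring
  rw [e, norm_mul, norm_mul, norm_exp_I_real, one_mul]
  refine mul_le_mul_of_nonneg_left ?_ (norm_nonneg _)
  refine (norm_one_add_pow_sub_exp_le (hkpos N) ?_ (hzk N) (hzre N)).trans ?_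
  · linarith [hzn N, hk2 N]
  · rw [div_le_div_iff₀ hkr (by positivity), one_mul]
    refine le_trans ?_ (hk N)
    rw [mul_comm]
    gcongr
    linarith [hzn N]

/-! ### Matrices acting on vectors, and the matrix functionals in the bounds -/

section mv
variable {n d : ℕ}

lemma mv_apply (M : Matrix (Fin n) (Fin d) ℝ) (x : E d) (i : Fin n) :
    mv M x i = ∑ j, M i j * x j := rfl

@[simp] lemma mv_zero (M : Matrix (Fin n) (Fin d) ℝ) : mv M 0 = 0 := by
  ext i; simp [mv_apply]

@[simp] lemma zero_mv (x : E d) : mv (0 : Matrix (Fin n) (Fin d) ℝ) x = 0 := by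
  ext i; simp [mv_apply]

lemma mv_add (M : Matrix (Fin n) (Fin d) ℝ) (x y : E d) : mv M (x + y) = mv M x + mv M y := by
  ext i; simp [mv_apply, mul_add, Finset.sum_add_distrib]

lemma sub_mv (M N : Matrix (Fin n) (Fin d) ℝ) (x : E d) : mv (M - N) x = mv M x - mv N x := by
  ext i; simp [mv_apply, sub_mul, Finset.sum_sub_distrib]

lemma mv_sum {ι : Type*} (s : Finset ι) (M : Matrix (Fin n) (Fin d) ℝ) (x : ι → E d) :
    mv M (∑ i ∈ s, x i) = ∑ i ∈ s, mv M (x i) := by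
  classical
  induction s using Finset.induction_on with
  | empty => simp
  | insert a s ha ih => rw [Finset.sum_insert ha, Finset.sum_insert ha, mv_add, ih]

lemma sum_smul_mv {ι : Type*} (s : Finset ι) (w : ι → ℝ) (M : ι → Matrix (Fin n) (Fin d) ℝ)
    (x : E d) : mv (∑ i ∈ s, w i • M i) x = ∑ i ∈ s, w i • mv (M i) x := by
  ext i
  simp only [mv_apply, Matrix.sum_apply, WithLp.ofLp_sum, Finset.sum_apply, WithLp.ofLp_smul,
    Pi.smul_apply, Matrix.smul_apply, smul_eq_mul, Finset.sum_mul, Finset.mul_sum]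
  rw [Finset.sum_comm]
  simp only [mul_assoc]

lemma mv_mul {k : ℕ} (M : Matrix (Fin n) (Fin d) ℝ) (N : Matrix (Fin d) (Fin k) ℝ) (x : E k) :
    mv (M * N) x = mv M (mv N x) := by
  simp [mv, Matrix.mulVec_mulVec]

lemma inner_mv (M : Matrix (Fin n) (Fin d) ℝ) (u : E n) (x : E d) :
    inner ℝ u (mv M x) = inner ℝ (mv M.transpose u) x := by
  simp only [PiLp.inner_apply, mv_apply, Matrix.transpose_apply, RCLike.inner_apply, conj_trivial,
    Finset.sum_mul, Finset.mul_sum]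
  rw [Finset.sum_comm]
  refine Finset.sum_congr rfl fun j _ => Finset.sum_congr rfl fun i _ => by ring

lemma continuous_mv (M : Matrix (Fin n) (Fin d) ℝ) : Continuous (mv M) := by
  unfold mv; fun_prop

lemma measurable_mv (M : Matrix (Fin n) (Fin d) ℝ) : Measurable (mv M) :=
  (continuous_mv M).measurable

/-- The sum of the absolute values of the entries. -/
def msize (M : Matrix (Fin n) (Fin d) ℝ) : ℝ := ∑ i, ∑ j, |M i j|

lemma msize_nonneg (M : Matrix (Fin n) (Fin d) ℝ) : 0 ≤ msize M :=
  Finset.sum_nonneg fun _ _ => Finset.sum_nonneg fun _ _ => abs_nonneg _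

@[simp] lemma msize_zero : msize (0 : Matrix (Fin n) (Fin d) ℝ) = 0 := by simp [msize]

lemma abs_le_msize (M : Matrix (Fin n) (Fin d) ℝ) (i : Fin n) (j : Fin d) :
    |M i j| ≤ msize M :=
  (Finset.single_le_sum (f := fun j => |M i j|) (fun _ _ => abs_nonneg _)
    (Finset.mem_univ j)).trans
    (Finset.single_le_sum (f := fun i => ∑ j, |M i j|)
      (fun _ _ => Finset.sum_nonneg fun _ _ => abs_nonneg _) (Finset.mem_univ i))

lemma norm_le_sum_abs (x : E n) : ‖x‖ ≤ ∑ i, |x i| := by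
  rw [EuclideanSpace.norm_eq]
  refine Real.sqrt_le_iff.2 ⟨Finset.sum_nonneg fun _ _ => abs_nonneg _, ?_⟩
  simp only [Real.norm_eq_abs]
  exact Finset.sum_sq_le_sq_sum_of_nonneg fun _ _ => abs_nonneg _

lemma norm_mv_le (M : Matrix (Fin n) (Fin d) ℝ) (x : E d) : ‖mv M x‖ ≤ msize M * ‖x‖ := by
  refine (norm_le_sum_abs _).trans ?_
  rw [msize, Finset.sum_mul]
  refine Finset.sum_le_sum fun i _ => ?_
  rw [mv_apply, Finset.sum_mul]
  refine (Finset.abs_sum_le_sum_abs _ _).trans (Finset.sum_le_sum fun j _ => ?_)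
  rw [abs_mul]
  have := PiLp.norm_apply_le x j
  rw [Real.norm_eq_abs] at this
  gcongr

/-- The quadratic form `tr(M Q M')`. -/
noncomputable def qform (Q : Matrix (Fin d) (Fin d) ℝ) (M : Matrix (Fin n) (Fin d) ℝ) : ℝ :=
  (M * Q * M.transpose).trace

lemma qform_eq_sum (Q : Matrix (Fin d) (Fin d) ℝ) (M : Matrix (Fin n) (Fin d) ℝ) :
    qform Q M = ∑ i, ∑ j, ∑ k, M i j * Q j k * M i k := by
  simp only [qform, Matrix.trace, Matrix.diag, Matrix.mul_apply, Matrix.transpose_apply,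
    Finset.sum_mul]
  exact Finset.sum_congr rfl fun i _ => Finset.sum_comm

@[simp] lemma qform_zero (Q : Matrix (Fin d) (Fin d) ℝ) :
    qform Q (0 : Matrix (Fin n) (Fin d) ℝ) = 0 := by simp [qform]

lemma qform_zero_left (M : Matrix (Fin n) (Fin d) ℝ) : qform 0 M = 0 := by simp [qform]

lemma qform_add_left (Q R : Matrix (Fin d) (Fin d) ℝ) (M : Matrix (Fin n) (Fin d) ℝ) :
    qform (Q + R) M = qform Q M + qform R M := by
  simp [qform, Matrix.mul_add, Matrix.add_mul]

lemma abs_qform_le (Q : Matrix (Fin d) (Fin d) ℝ) (M : Matrix (Fin n) (Fin d) ℝ) :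
    |qform Q M| ≤ n * msize Q * msize M ^ 2 := by
  have h : ∀ i : Fin n, |∑ j, ∑ k, M i j * Q j k * M i k| ≤ msize Q * msize M ^ 2 := fun i => by
    refine (Finset.abs_sum_le_sum_abs _ _).trans ?_
    unfold msize
    rw [Finset.sum_mul]
    refine Finset.sum_le_sum fun j _ => ?_
    refine (Finset.abs_sum_le_sum_abs _ _).trans ?_
    rw [Finset.sum_mul]
    refine Finset.sum_le_sum fun k _ => ?_
    rw [abs_mul, abs_mul]
    change |M i j| * |Q j k| * |M i k| ≤ |Q j k| * msize M ^ 2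
    have h1 := abs_le_msize M i j
    have h2 := abs_le_msize M i k
    calc |M i j| * |Q j k| * |M i k| = |Q j k| * (|M i j| * |M i k|) := by ring
      _ ≤ |Q j k| * (msize M * msize M) := by
        have := msize_nonneg M
        gcongr
      _ = _ := by ring
  rw [qform_eq_sum]
  refine (Finset.abs_sum_le_sum_abs _ _).trans ((Finset.sum_le_sum fun i _ => h i).trans ?_)
  simp [mul_assoc]

/-- `∫_{Kᶜ} ‖M x‖ ν(dx)`. -/
noncomputable def jumpNorm (ν : Measure (E d)) (K : Set (E d)) (M : Matrix (Fin n) (Fin d) ℝ) : ℝ :=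
  ∫ x in Kᶜ, ‖mv M x‖ ∂ν

@[simp] lemma jumpNorm_zero (ν : Measure (E d)) (K : Set (E d)) :
    jumpNorm ν K (0 : Matrix (Fin n) (Fin d) ℝ) = 0 := by simp [jumpNorm]

lemma jumpNorm_nonneg (ν : Measure (E d)) (K : Set (E d)) (M : Matrix (Fin n) (Fin d) ℝ) :
    0 ≤ jumpNorm ν K M := integral_nonneg fun _ => norm_nonneg _

end mv

/-! ### Splitting the jumps: the moment bound in terms of the triplet -/

/-- A splitting of the jumps into a compensated, square integrable part on `K` and an integrable
part on the complement of `K`, with the corresponding drift `β`. -/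
structure IsSplit {d : ℕ} (γ : E d) (Sig : Matrix (Fin d) (Fin d) ℝ) (ν : Measure (E d)) (β : E d)
    (K : Set (E d)) : Prop where
  posSemidef : Sig.PosSemidef
  meas : MeasurableSet K
  sq : IntegrableOn (fun x => ‖x‖ ^ 2) K ν
  one : IntegrableOn (fun x => ‖x‖) Kᶜ ν
  cumulant_eq : ∀ u, cumulant γ Sig ν u = Complex.I * (inner ℝ β u : ℝ) -
    (1 / 2 : ℂ) * (inner ℝ u (mv Sig u) : ℝ) +
    ∫ x, (Complex.exp (Complex.I * (inner ℝ u x : ℝ)) - 1 -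
      Complex.I * (K.indicator (fun y => inner ℝ u y) x : ℝ)) ∂ν

section moments
variable {n d : ℕ} {γ : E d} {Sig : Matrix (Fin d) (Fin d) ℝ} {ν : Measure (E d)} {β : E d}
  {K : Set (E d)}

lemma IsSplit.integrable_jumpNorm (h : IsSplit γ Sig ν β K) (M : Matrix (Fin n) (Fin d) ℝ) :
    IntegrableOn (fun x => ‖mv M x‖) Kᶜ ν :=
  (h.one.const_mul (msize M)).mono' (continuous_mv M).norm.aestronglyMeasurable
    (Eventually.of_forall fun x => by simpa using norm_mv_le M x)

lemma IsSplit.jumpNorm_le (h : IsSplit γ Sig ν β K) (M : Matrix (Fin n) (Fin d) ℝ) :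
    jumpNorm ν K M ≤ msize M * ∫ x in Kᶜ, ‖x‖ ∂ν := by
  rw [jumpNorm, ← integral_const_mul]
  exact integral_mono (h.integrable_jumpNorm M) (h.one.const_mul _) fun x => norm_mv_le M x

/-- The reverse triangle inequality under the integral; it yields the continuity of `jumpNorm ν K`.
-/
lemma IsSplit.abs_jumpNorm_sub_le (h : IsSplit γ Sig ν β K) (M N : Matrix (Fin n) (Fin d) ℝ) :
    |jumpNorm ν K M - jumpNorm ν K N| ≤ msize (M - N) * ∫ x in Kᶜ, ‖x‖ ∂ν := by
  refine le_trans ?_ (h.jumpNorm_le (M - N))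
  rw [jumpNorm, jumpNorm, ← integral_sub (h.integrable_jumpNorm M) (h.integrable_jumpNorm N),
    jumpNorm]
  refine (abs_integral_le_integral_abs).trans ?_
  refine integral_mono ((h.integrable_jumpNorm M).sub (h.integrable_jumpNorm N)).abs
    (h.integrable_jumpNorm _) fun x => ?_
  rw [sub_mv]
  exact abs_norm_sub_norm_le _ _

lemma IsSplit.integrable_mul (h : IsSplit γ Sig ν β K) (i j : Fin d) :
    IntegrableOn (fun x => x i * x j) K ν := by
  refine Integrable.mono' h.sq (by fun_prop) (Eventually.of_forall fun x => ?_)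
  rw [norm_mul, pow_two]
  exact mul_le_mul (PiLp.norm_apply_le x i) (PiLp.norm_apply_le x j) (norm_nonneg _) (norm_nonneg _)

/-- Expanding the squared norm in coordinates identifies the trace in the bounds with a second
moment of the jumps in `K`. -/
lemma IsSplit.qform_secondMoment (h : IsSplit γ Sig ν β K) (M : Matrix (Fin n) (Fin d) ℝ) :
    qform (secondMoment ν K) M = ∫ x in K, ‖mv M x‖ ^ 2 ∂ν := by
  have e : ∀ x : E d, ‖mv M x‖ ^ 2 = ∑ i, ∑ j, ∑ k, (M i j * M i k) * (x j * x k) := fun x => by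
    rw [EuclideanSpace.real_norm_sq_eq]
    refine Finset.sum_congr rfl fun i _ => ?_
    rw [mv_apply, pow_two, Finset.sum_mul_sum]
    exact Finset.sum_congr rfl fun j _ => Finset.sum_congr rfl fun k _ => by ring
  simp_rw [e]
  rw [qform_eq_sum, integral_finsetSum]
  · refine Finset.sum_congr rfl fun i _ => ?_
    rw [integral_finsetSum]
    · refine Finset.sum_congr rfl fun j _ => ?_
      rw [integral_finsetSum]
      · refine Finset.sum_congr rfl fun k _ => ?_
        rw [integral_const_mul, secondMoment, Matrix.of_apply]; ring
      · exact fun k _ => (h.integrable_mul j k).const_mul _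
    · exact fun j _ => integrable_finsetSum _ fun k _ => (h.integrable_mul j k).const_mul _
  · exact fun i _ => integrable_finsetSum _ fun j _ => integrable_finsetSum _ fun k _ =>
      (h.integrable_mul j k).const_mul _

/-- The jumps `M x`, split according to whether `x ∈ K`. -/
noncomputable def splitJump (K : Set (E d)) (M : Matrix (Fin n) (Fin d) ℝ) (x : E d) : E n × E n :=
  (mv M (K.indicator id x), mv M (Kᶜ.indicator id x))

lemma measurable_splitJump (hK : MeasurableSet K) (M : Matrix (Fin n) (Fin d) ℝ) :
    Measurable (splitJump K M) :=
  ((measurable_mv M).comp (measurable_id.indicator hK)).prodMk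
    ((measurable_mv M).comp (measurable_id.indicator hK.compl))

lemma splitJump_add (M : Matrix (Fin n) (Fin d) ℝ) (x : E d) :
    (splitJump K M x).1 + (splitJump K M x).2 = mv M x := by
  rw [splitJump, ← mv_add, Set.indicator_self_add_compl_apply]; rfl

lemma norm_splitJump_fst_sq (M : Matrix (Fin n) (Fin d) ℝ) :
    (fun x => ‖(splitJump K M x).1‖ ^ 2) = K.indicator fun x => ‖mv M x‖ ^ 2 := by
  ext x
  by_cases hx : x ∈ K <;> simp [splitJump, hx]

lemma norm_splitJump_snd (M : Matrix (Fin n) (Fin d) ℝ) :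
    (fun x => ‖(splitJump K M x).2‖) = Kᶜ.indicator fun x => ‖mv M x‖ := by
  ext x
  by_cases hx : x ∈ K <;> simp [splitJump, hx]

lemma IsSplit.integrable_sq (h : IsSplit γ Sig ν β K) (M : Matrix (Fin n) (Fin d) ℝ) :
    IntegrableOn (fun x => ‖mv M x‖ ^ 2) K ν := by
  refine (h.sq.const_mul (msize M ^ 2)).mono' ((continuous_mv M).norm.pow 2).aestronglyMeasurable
    (Eventually.of_forall fun x => ?_)
  rw [norm_pow, norm_norm, ← mul_pow]
  exact pow_le_pow_left₀ (norm_nonneg _) (norm_mv_le M x) 2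

/-- First moment bound for a law with characteristic function `u ↦ exp(∑ w_c Φ(c' u))`. -/
theorem IsSplit.lintegral_enorm_le (h : IsSplit γ Sig ν β K) {μ : Measure (E n)}
    [IsProbabilityMeasure μ] (s : Finset (Matrix (Fin n) (Fin d) ℝ))
    (w : Matrix (Fin n) (Fin d) ℝ → ℝ) (hw : ∀ c, 0 ≤ w c)
    (hμ : ∀ u, charFun μ u =
      Complex.exp (∑ c ∈ s, cumulant γ Sig ν (mv c.transpose u) * (w c : ℂ))) :
    ∫⁻ z, ‖z‖ₑ ∂μ ≤ ENNReal.ofReal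
      (Real.sqrt (∑ c ∈ s, w c * qform (Sig + secondMoment ν K) c +
        ‖∑ c ∈ s, w c • mv c β‖ ^ 2) + ∑ c ∈ s, w c * jumpNorm ν K c) := by
  have hm := fun c : Matrix (Fin n) (Fin d) ℝ => measurable_splitJump h.meas c
  -- The jump measure of a sum of independent terms `c Λ(B_c)`, with `B_c` of mass `w c`: weighted
  -- images of ν, each jump recorded as its parts in `K` and off `K`.
  set ρ : Measure (E n × E n) :=
    ∑ c ∈ s, ENNReal.ofReal (w c) • ν.map (splitJump K c) with hρ
  set S : Matrix (Fin n) (Fin n) ℝ := ∑ c ∈ s, w c • (c * Sig * c.transpose) with hS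
  have hSp : S.PosSemidef := by
    refine Matrix.posSemidef_sum _ fun c _ => Matrix.PosSemidef.smul ?_ (hw c)
    have := h.posSemidef.mul_mul_conjTranspose_same c
    rwa [Matrix.conjTranspose_eq_transpose_of_trivial] at this
  have hint : ∀ {F : Type} [NormedAddCommGroup F] (φ : E n × E n → F), Continuous φ →
      (∀ c, Integrable (fun x => φ (splitJump K c x)) ν) → Integrable φ ρ := by
    intro F _ φ hφ hi
    rw [hρ, integrable_finsetSum_measure]
    intro c _
    refine Integrable.smul_measure ?_ ENNReal.ofReal_ne_top
    rw [integrable_map_measure hφ.aestronglyMeasurable (hm c).aemeasurable]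
    exact hi c
  have heval : ∀ {F : Type} [NormedAddCommGroup F] [NormedSpace ℝ F] [CompleteSpace F]
      (φ : E n × E n → F), Continuous φ →
      (∀ c, Integrable (fun x => φ (splitJump K c x)) ν) →
      ∫ y, φ y ∂ρ = ∑ c ∈ s, w c • ∫ x, φ (splitJump K c x) ∂ν := by
    intro F _ _ _ φ hφ hi
    rw [hρ, integral_finsetSum_measure]
    · refine Finset.sum_congr rfl fun c _ => ?_
      rw [integral_smul_measure, integral_map (hm c).aemeasurable hφ.aestronglyMeasurable,
        ENNReal.toReal_ofReal (hw c)]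
    · intro c _
      refine Integrable.smul_measure ?_ ENNReal.ofReal_ne_top
      rw [integrable_map_measure hφ.aestronglyMeasurable (hm c).aemeasurable]
      exact hi c
  have hi1 : ∀ c : Matrix (Fin n) (Fin d) ℝ, Integrable (fun x => ‖(splitJump K c x).1‖ ^ 2) ν :=
    fun c => by
      rw [norm_splitJump_fst_sq, integrable_indicator_iff h.meas]; exact h.integrable_sq c
  have hi2 : ∀ c : Matrix (Fin n) (Fin d) ℝ, Integrable (fun x => ‖(splitJump K c x).2‖) ν :=
    fun c => by
      rw [norm_splitJump_snd, integrable_indicator_iff h.meas.compl]; exact h.integrable_jumpNorm c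
  have hρ1 : MemLp Prod.fst 2 ρ := by
    rw [memLp_two_iff_integrable_sq_norm continuous_fst.aestronglyMeasurable]
    exact hint (fun y => ‖y.1‖ ^ 2) (by fun_prop) hi1
  have hρ2 : Integrable Prod.snd ρ := by
    refine (integrable_norm_iff continuous_snd.aestronglyMeasurable).1 ?_
    exact hint (fun y => ‖y.2‖) (by fun_prop) hi2
  have key := lintegral_enorm_le_of_charFun_eq (μ := μ) hSp (∑ c ∈ s, w c • mv c β) hρ1 hρ2
    (fun u => ?_)
  · refine key.trans (le_of_eq ?_)
    congr 2
    · congr 1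
      rw [heval (fun y => ‖y.1‖ ^ 2) (by fun_prop) hi1, hS, Matrix.trace_sum]
      have : ∀ c : Matrix (Fin n) (Fin d) ℝ, w c * qform (Sig + secondMoment ν K) c =
          (w c • (c * Sig * c.transpose)).trace + w c • ∫ x, ‖(splitJump K c x).1‖ ^ 2 ∂ν := by
        intro c
        rw [qform_add_left, h.qform_secondMoment, norm_splitJump_fst_sq,
          integral_indicator h.meas, Matrix.trace_smul, qform, mul_add]
        rfl
      simp_rw [this, Finset.sum_add_distrib]
      ring
    · rw [heval (fun y => ‖y.2‖) (by fun_prop) hi2]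
      refine Finset.sum_congr rfl fun c _ => ?_
      rw [norm_splitJump_snd, integral_indicator h.meas.compl, jumpNorm, smul_eq_mul]
  · rw [hμ u]
    congr 1
    have hJ : ∀ c, Integrable (fun x => Complex.exp (Complex.I *
        (inner ℝ u ((splitJump K c x).1 + (splitJump K c x).2) : ℝ)) - 1 -
        Complex.I * (inner ℝ u (splitJump K c x).1 : ℝ)) ν := by
      intro c
      have h1 : MemLp Prod.fst 2 (ν.map (splitJump K c)) := by
        rw [memLp_two_iff_integrable_sq_norm continuous_fst.aestronglyMeasurable,
          integrable_map_measure (by fun_prop) (hm c).aemeasurable]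
        exact hi1 c
      have h2 : Integrable Prod.snd (ν.map (splitJump K c)) := by
        refine (integrable_norm_iff continuous_snd.aestronglyMeasurable).1 ?_
        rw [integrable_map_measure (by fun_prop) (hm c).aemeasurable]
        exact hi2 c
      exact (integrable_map_measure (by fun_prop) (hm c).aemeasurable).1
        (integrable_jumpExp h1 h2 u)
    rw [heval (fun y => Complex.exp (Complex.I * (inner ℝ u (y.1 + y.2) : ℝ)) - 1 -
        Complex.I * (inner ℝ u y.1 : ℝ)) (by fun_prop) hJ, hS, sum_smul_mv, inner_sum, sum_inner]
    push_cast
    rw [Finset.mul_sum, Finset.mul_sum, ← Finset.sum_sub_distrib, ← Finset.sum_add_distrib]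
    refine Finset.sum_congr rfl fun c _ => ?_
    rw [h.cumulant_eq]
    -- Transposition moves the matrix `c` onto the argument of the cumulant, term by term.
    have e1 : inner ℝ (w c • mv c β) u = w c * inner ℝ β (mv c.transpose u) := by
      rw [real_inner_smul_left, real_inner_comm, inner_mv, real_inner_comm]
    have e2 : inner ℝ u (w c • mv (c * Sig * c.transpose) u) =
        w c * inner ℝ (mv c.transpose u) (mv Sig (mv c.transpose u)) := by
      rw [inner_smul_right, mv_mul, mv_mul, inner_mv]
    have e3 : ∀ x, K.indicator (fun y => inner ℝ (mv c.transpose u) y) x =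
        inner ℝ u (splitJump K c x).1 := fun x => by
      by_cases hx : x ∈ K <;> simp [splitJump, hx, inner_mv]
    rw [e1, e2]
    simp_rw [e3, splitJump_add, inner_mv, Complex.real_smul]
    push_cast
    ring

end moments

/-! ### Finite additivity and independence of the Lévy basis -/

section basis
variable {Ω S : Type*} [MeasurableSpace Ω] {P : Measure Ω} [IsProbabilityMeasure P]
  [MetricSpace S] [MeasurableSpace S] {m n d : ℕ} {Λ : Set (S × E m) → Ω → E d}
  {γ : E d} {Sig : Matrix (Fin d) (Fin d) ℝ} {ν : Measure (E d)} {π : Measure S}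

lemma measure_lt_top_of_isBounded [IsProbabilityMeasure π] {B : Set (S × E m)}
    (hB : Bornology.IsBounded B) : (π.prod (volume : Measure (E m))) B < ∞ := by
  have h2 : Bornology.IsBounded (Prod.snd '' B) := hB.image_snd
  calc (π.prod (volume : Measure (E m))) B
      ≤ (π.prod (volume : Measure (E m))) (Set.univ ×ˢ (Prod.snd '' B)) :=
        measure_mono fun p hp => ⟨trivial, p, hp, rfl⟩
    _ = π Set.univ * volume (Prod.snd '' B) := Measure.prod_prod _ _
    _ < ∞ := ENNReal.mul_lt_top (by simp) h2.measure_lt_top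

/-- Along the constant sequence `∅` the partial sums converge, so their increments `Λ ∅ ω` tend to
0. -/
lemma IsLevyBasis.empty_ae (hΛ : IsLevyBasis P Λ γ Sig ν π) : ∀ᵐ ω ∂P, Λ ∅ ω = 0 := by
  have h := hΛ.sigmaAdditive (fun _ => ∅) (fun _ => MeasurableSet.empty) (by simp)
    (fun _ _ _ => disjoint_bot_left)
  filter_upwards [h] with ω hω
  have h1 := (hω.comp (tendsto_add_atTop_nat 1)).sub hω
  simp only [Function.comp_def, Finset.sum_range_succ, add_sub_cancel_left, sub_self] at h1
  exact tendsto_nhds_unique tendsto_const_nhds h1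

/-- σ-additivity along B, C, ∅, ∅, …, where the empty sets contribute 0 almost surely. -/
lemma IsLevyBasis.union_ae (hΛ : IsLevyBasis P Λ γ Sig ν π) {B C : Set (S × E m)}
    (hB : MeasurableSet B) (hC : MeasurableSet C) (hb : Bornology.IsBounded B)
    (hc : Bornology.IsBounded C) (hd : Disjoint B C) :
    ∀ᵐ ω ∂P, Λ (B ∪ C) ω = Λ B ω + Λ C ω := by
  set D : ℕ → Set (S × E m) := fun i => if i = 0 then B else if i = 1 then C else ∅ with hD
  have hU : (⋃ i, D i) = B ∪ C := by
    ext p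
    simp only [Set.mem_iUnion, Set.mem_union, hD]
    constructor
    · rintro ⟨i, hi⟩
      split_ifs at hi with h0 h1
      · exact Or.inl hi
      · exact Or.inr hi
      · exact absurd hi (Set.notMem_empty _)
    · rintro (h | h)
      · exact ⟨0, by simpa using h⟩
      · exact ⟨1, by simpa using h⟩
  have h := hΛ.sigmaAdditive D (fun i => by
      simp only [hD]; split_ifs
      exacts [hB, hC, MeasurableSet.empty]) (by rw [hU]; exact hb.union hc) (by
      intro i j hij
      simp only [hD]
      split_ifs <;> first
        | omega
        | exact disjoint_bot_left
        | exact disjoint_bot_right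
        | exact hd
        | exact hd.symm)
  rw [hU] at h
  filter_upwards [h, hΛ.empty_ae] with ω hω h0
  refine tendsto_nhds_unique hω (tendsto_const_nhds.congr' ?_)
  filter_upwards [eventually_ge_atTop 2] with N hN
  obtain ⟨k, rfl⟩ := Nat.exists_eq_add_of_le hN
  rw [Finset.sum_range_add, Finset.sum_range_succ, Finset.sum_range_one, Finset.sum_eq_zero,
    add_zero]
  · simp [hD]
  · intro i _
    have h1 : ¬ (2 + i = 0) := by omega
    have h2 : ¬ (2 + i = 1) := by omega
    simp only [hD, h1, h2, if_false, h0]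

lemma IsLevyBasis.biUnion_ae (hΛ : IsLevyBasis P Λ γ Sig ν π) {ι : Type*} (s : Finset ι)
    (B : ι → Set (S × E m)) (hB : ∀ i ∈ s, MeasurableSet (B i))
    (hb : ∀ i ∈ s, Bornology.IsBounded (B i)) (hd : (s : Set ι).PairwiseDisjoint B) :
    ∀ᵐ ω ∂P, Λ (⋃ i ∈ s, B i) ω = ∑ i ∈ s, Λ (B i) ω := by
  classical
  induction s using Finset.induction_on with
  | empty => simpa using hΛ.empty_ae
  | insert a s ha ih =>
    have hs : ∀ i ∈ s, i ∈ insert a s := fun i hi => Finset.mem_insert_of_mem hi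
    have ih' := ih (fun i hi => hB i (hs i hi)) (fun i hi => hb i (hs i hi))
      (hd.subset (by simp))
    have hu := hΛ.union_ae (hB a (Finset.mem_insert_self _ _))
      (Finset.measurableSet_biUnion s fun i hi => hB i (hs i hi))
      (hb a (Finset.mem_insert_self _ _))
      ((Bornology.isBounded_biUnion_finset s).2 fun i hi => hb i (hs i hi)) (by
        rw [Set.disjoint_iUnion₂_right]
        intro i hi
        exact hd (by simp) (by simp [hi]) (fun h => ha (h ▸ hi)))
    filter_upwards [ih', hu] with ω h1 h2
    rw [Finset.set_biUnion_insert, h2, h1, Finset.sum_insert ha]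

lemma IsLevyBasis.iIndepFun_fintype (hΛ : IsLevyBasis P Λ γ Sig ν π) {ι : Type*} [Fintype ι]
    (B : ι → Set (S × E m)) (hB : ∀ i, MeasurableSet (B i)) (hb : ∀ i, Bornology.IsBounded (B i))
    (hd : Pairwise fun i j => Disjoint (B i) (B j)) : iIndepFun (fun i => Λ (B i)) P := by
  have e := Fintype.equivFin ι
  have h := hΛ.indep (Fintype.card ι) (fun k => B (e.symm k)) (fun k => ⟨hB _, hb _⟩)
    (fun i j hij => hd (e.symm.injective.ne hij))
  simpa using h.precomp e.injective

end basis

/-! ### Integrals of simple functions -/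

section simpleInt
variable {Ω S : Type*} [MeasurableSpace Ω] {P : Measure Ω} [IsProbabilityMeasure P]
  [MetricSpace S] [MeasurableSpace S] {m n d : ℕ} {Λ : Set (S × E m) → Ω → E d}
  {γ : E d} {Sig : Matrix (Fin d) (Fin d) ℝ} {ν : Measure (E d)} {π : Measure S}

/-- Level sets of nonzero values lie in the support. The level set of 0 may be unbounded, where the
axioms say nothing about Λ; hence its separate treatment throughout. -/
lemma isBounded_preimage_of_support {β : Type*} (h : S × E m → β)
    {g : S × E m → Matrix (Fin n) (Fin d) ℝ} (hg : Bornology.IsBounded (Function.support g))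
    {φ : β → Matrix (Fin n) (Fin d) ℝ} (hφ : ∀ p, φ (h p) = g p) {b : β} (hb : φ b ≠ 0)
    (D : Set (S × E m)) : Bornology.IsBounded (h ⁻¹' {b} ∩ D) := by
  refine hg.subset fun p hp => ?_
  have : h p = b := hp.1
  rw [Function.mem_support, ← hφ, this]
  exact hb

open Classical in
/-- The simple integral may be computed along any finer partition. -/
lemma IsLevyBasis.simpleInt_map_ae (hΛ : IsLevyBasis P Λ γ Sig ν π) {β : Type*}
    (h : SimpleFunc (S × E m) β) (φ : β → Matrix (Fin n) (Fin d) ℝ)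
    (hs : Bornology.IsBounded (Function.support (h.map φ))) {D : Set (S × E m)}
    (hD : MeasurableSet D) :
    ∀ᵐ ω ∂P, simpleInt Λ (h.map φ) D ω =
      ∑ b ∈ h.range, mv (φ b) (Λ (h ⁻¹' {b} ∩ D) ω) := by
  have hpart : ∀ c ∈ (h.map φ).range, c ≠ 0 → ∀ᵐ ω ∂P, Λ ((h.map φ) ⁻¹' {c} ∩ D) ω =
      ∑ b ∈ h.range with φ b = c, Λ (h ⁻¹' {b} ∩ D) ω := by
    intro c _ hc0
    have hU : (h.map φ) ⁻¹' {c} ∩ D =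
        ⋃ b ∈ h.range.filter (fun b => φ b = c), (h ⁻¹' {b} ∩ D) := by
      ext p
      simp only [SimpleFunc.coe_map, Set.mem_inter_iff, Set.mem_preimage, Function.comp_apply,
        Set.mem_singleton_iff, Finset.mem_filter, SimpleFunc.mem_range, Set.mem_iUnion,
        Set.mem_range]
      constructor
      · rintro ⟨h1, h2⟩
        exact ⟨h p, ⟨⟨p, rfl⟩, h1⟩, rfl, h2⟩
      · rintro ⟨b, ⟨_, h1⟩, h2, h3⟩
        exact ⟨by rw [h2, h1], h3⟩
    rw [hU]
    refine hΛ.biUnion_ae _ _ (fun b _ => (h.measurableSet_fiber b).inter hD) (fun b hb => ?_) ?_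
    · refine isBounded_preimage_of_support h hs (φ := φ) (fun p => rfl) ?_ D
      rw [(Finset.mem_filter.1 hb).2]; exact hc0
    · intro b _ b' _ hbb'
      refine Set.disjoint_left.2 fun p hp hp' => hbb' ?_
      exact (hp.1 : h p = b).symm.trans hp'.1
  have hall : ∀ᵐ ω ∂P, ∀ c ∈ (h.map φ).range, c ≠ 0 → Λ ((h.map φ) ⁻¹' {c} ∩ D) ω =
      ∑ b ∈ h.range with φ b = c, Λ (h ⁻¹' {b} ∩ D) ω := by
    rw [Filter.eventually_all_finset]
    intro c hc
    by_cases hc0 : c = 0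
    · simp [hc0]
    · filter_upwards [hpart c hc hc0] with ω hω _ using hω
  filter_upwards [hall] with ω hω
  rw [← Finset.sum_fiberwise_of_maps_to (s := h.range) (t := (h.map φ).range) (g := φ)
    (fun b hb => by rw [SimpleFunc.range_map]; exact Finset.mem_image_of_mem _ hb), simpleInt]
  refine Finset.sum_congr rfl fun c hc => ?_
  by_cases hc0 : c = 0
  · subst hc0
    rw [zero_mv, Finset.sum_eq_zero]
    intro b hb
    rw [(Finset.mem_filter.1 hb).2, zero_mv]
  · rw [hω c hc hc0, mv_sum]
    exact Finset.sum_congr rfl fun b hb => by rw [(Finset.mem_filter.1 hb).2]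

/-- All three simple functions are constant on the level sets of `g.pair g'`, which serve as a
common partition. -/
lemma IsLevyBasis.simpleInt_sub_ae (hΛ : IsLevyBasis P Λ γ Sig ν π)
    {g g' : SimpleFunc (S × E m) (Matrix (Fin n) (Fin d) ℝ)}
    (hg : Bornology.IsBounded (Function.support g))
    (hg' : Bornology.IsBounded (Function.support g')) {D : Set (S × E m)} (hD : MeasurableSet D) :
    ∀ᵐ ω ∂P, simpleInt Λ (g - g') D ω = simpleInt Λ g D ω - simpleInt Λ g' D ω := by
  have e1 : (g.pair g').map Prod.fst = g := by ext; rfl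
  have e2 : (g.pair g').map Prod.snd = g' := by ext; rfl
  have e3 : (g.pair g').map (fun b => b.1 - b.2) = g - g' := by ext; rfl
  have h1 := hΛ.simpleInt_map_ae (g.pair g') Prod.fst (by rw [e1]; exact hg) hD
  have h2 := hΛ.simpleInt_map_ae (g.pair g') Prod.snd (by rw [e2]; exact hg') hD
  have h3 := hΛ.simpleInt_map_ae (g.pair g') (fun b => b.1 - b.2) (by
    rw [e3]
    refine (hg.union hg').subset fun p hp => ?_
    by_contra hcon
    rw [Set.mem_union, Function.mem_support, Function.mem_support, not_or, not_not, not_not] at hcon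
    exact hp (by simp [hcon.1, hcon.2])) hD
  rw [e1] at h1
  rw [e2] at h2
  rw [e3] at h3
  filter_upwards [h1, h2, h3] with ω w1 w2 w3
  rw [w1, w2, w3, ← Finset.sum_sub_distrib]
  exact Finset.sum_congr rfl fun b _ => sub_mv _ _ _

lemma IsLevyBasis.simpleInt_union_ae (hΛ : IsLevyBasis P Λ γ Sig ν π)
    {g : SimpleFunc (S × E m) (Matrix (Fin n) (Fin d) ℝ)}
    (hg : Bornology.IsBounded (Function.support g)) {D D' : Set (S × E m)}
    (hD : MeasurableSet D) (hD' : MeasurableSet D') (hdis : Disjoint D D') :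
    ∀ᵐ ω ∂P, simpleInt Λ g (D ∪ D') ω = simpleInt Λ g D ω + simpleInt Λ g D' ω := by
  have hall : ∀ᵐ ω ∂P, ∀ c ∈ g.range, c ≠ 0 → Λ (g ⁻¹' {c} ∩ (D ∪ D')) ω =
      Λ (g ⁻¹' {c} ∩ D) ω + Λ (g ⁻¹' {c} ∩ D') ω := by
    rw [Filter.eventually_all_finset]
    intro c hc
    by_cases hc0 : c = 0
    · simp [hc0]
    · have hb := fun D => isBounded_preimage_of_support g hg (φ := id) (fun p => rfl) hc0 D
      filter_upwards [hΛ.union_ae ((g.measurableSet_fiber c).inter hD)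
        ((g.measurableSet_fiber c).inter hD') (hb D) (hb D')
        (hdis.mono Set.inter_subset_right Set.inter_subset_right)] with ω hω _
      rw [Set.inter_union_distrib_left, hω]
  filter_upwards [hall] with ω hω
  rw [simpleInt, simpleInt, simpleInt, ← Finset.sum_add_distrib]
  refine Finset.sum_congr rfl fun c hc => ?_
  by_cases hc0 : c = 0
  · simp [hc0]
  · rw [hω c hc hc0, mv_add]

open Classical in
lemma simpleInt_eq_filter (g : SimpleFunc (S × E m) (Matrix (Fin n) (Fin d) ℝ))
    (D : Set (S × E m)) (ω : Ω) :
    simpleInt Λ g D ω = ∑ c ∈ g.range with c ≠ 0, mv c (Λ (g ⁻¹' {c} ∩ D) ω) := by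
  rw [simpleInt, Finset.sum_filter]
  refine Finset.sum_congr rfl fun c _ => ?_
  by_cases hc0 : c = 0 <;> simp [hc0]

/-- The σ-algebra on Ω is left free, so that the lemma also applies to the sub-σ-algebras `sigmaOn Λ
D`. -/
lemma measurable_simpleInt_of {g : SimpleFunc (S × E m) (Matrix (Fin n) (Fin d) ℝ)}
    {D : Set (S × E m)} (h : ∀ c ≠ 0, Measurable (Λ (g ⁻¹' {c} ∩ D))) :
    Measurable (simpleInt Λ g D) := by
  classical
  have e : simpleInt Λ g D = fun ω => ∑ c ∈ g.range with c ≠ 0, mv c (Λ (g ⁻¹' {c} ∩ D) ω) := by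
    ext1 ω; exact simpleInt_eq_filter g D ω
  rw [e]
  exact Finset.measurable_sum _ fun c hc => (measurable_mv c).comp (h c (Finset.mem_filter.1 hc).2)

lemma IsLevyBasis.measurable_simpleInt (hΛ : IsLevyBasis P Λ γ Sig ν π)
    {g : SimpleFunc (S × E m) (Matrix (Fin n) (Fin d) ℝ)}
    (hg : Bornology.IsBounded (Function.support g)) {D : Set (S × E m)} (hD : MeasurableSet D) :
    Measurable (simpleInt Λ g D) :=
  measurable_simpleInt_of fun _ hc => hΛ.measurable _ ((g.measurableSet_fiber _).inter hD)
    (isBounded_preimage_of_support g hg (φ := id) (fun _ => rfl) hc D)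

lemma charFun_map_mv {X : Ω → E d} (hX : Measurable X) (c : Matrix (Fin n) (Fin d) ℝ) (u : E n) :
    charFun (P.map fun ω => mv c (X ω)) u = charFun (P.map X) (mv c.transpose u) := by
  have hc : Measurable fun ω => mv c (X ω) := (measurable_mv c).comp hX
  rw [charFun_apply, charFun_apply, integral_map hc.aemeasurable (by fun_prop),
    integral_map hX.aemeasurable (by fun_prop)]
  congr 1 with ω
  rw [real_inner_comm, inner_mv, real_inner_comm]

-- The values of Λ on the disjoint level sets are independent, so the characteristic functions
-- multiply.
open Classical in
lemma IsLevyBasis.charFun_simpleInt (hΛ : IsLevyBasis P Λ γ Sig ν π)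
    {g : SimpleFunc (S × E m) (Matrix (Fin n) (Fin d) ℝ)}
    (hg : Bornology.IsBounded (Function.support g)) {D : Set (S × E m)} (hD : MeasurableSet D)
    (u : E n) :
    charFun (P.map (simpleInt Λ g D)) u =
      Complex.exp (∑ c ∈ g.range with c ≠ 0, cumulant γ Sig ν (mv c.transpose u) *
        (((π.prod (volume : Measure (E m))).real (g ⁻¹' {c} ∩ D) : ℝ) : ℂ)) := by
  set s := g.range.filter (fun c => c ≠ 0) with hs
  have hm : ∀ c, MeasurableSet (g ⁻¹' {c} ∩ D) := fun c => (g.measurableSet_fiber c).inter hD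
  have hb : ∀ c ∈ s, Bornology.IsBounded (g ⁻¹' {c} ∩ D) := fun c hc =>
    isBounded_preimage_of_support g hg (φ := id) (fun p => rfl) (Finset.mem_filter.1 hc).2 D
  have e : simpleInt Λ g D = fun ω => ∑ c ∈ s, mv c (Λ (g ⁻¹' {c} ∩ D) ω) := by
    ext1 ω; exact simpleInt_eq_filter g D ω
  have hi : iIndepFun (fun c : s => Λ (g ⁻¹' {c.1} ∩ D)) P := by
    refine hΛ.iIndepFun_fintype _ (fun c => hm c.1) (fun c => hb c.1 c.2) fun c c' hcc' => ?_
    refine Set.disjoint_left.2 fun p hp hp' => hcc' (Subtype.ext ?_)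
    exact (hp.1 : g p = c.1).symm.trans hp'.1
  have hi' := hi.comp (fun c : s => mv c.1) fun c => measurable_mv c.1
  have hmeas : ∀ c ∈ s, Measurable (Λ (g ⁻¹' {c} ∩ D)) := fun c hc =>
    hΛ.measurable _ (hm c) (hb c hc)
  rw [e, iIndepFun.charFun_map_fun_finsetSum_eq_prod
    (X := fun c => fun ω => mv c (Λ (g ⁻¹' {c} ∩ D) ω))
    (fun c hc => ((measurable_mv c).comp (hmeas c hc)).aemeasurable) hi', Finset.prod_apply,
    Complex.exp_sum]
  refine Finset.prod_congr rfl fun c hc => ?_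
  rw [charFun_map_mv (hmeas c hc), hΛ.charFun_eq _ (hm c) (hb c hc)]

open Classical in
lemma setIntegral_simpleFunc [IsProbabilityMeasure π] {F : Type*} [NormedAddCommGroup F]
    [NormedSpace ℝ F] [CompleteSpace F] {g : SimpleFunc (S × E m) (Matrix (Fin n) (Fin d) ℝ)}
    (hg : Bornology.IsBounded (Function.support g)) (D : Set (S × E m))
    (φ : Matrix (Fin n) (Fin d) ℝ → F) (hφ : φ 0 = 0) :
    IntegrableOn (fun p => φ (g p)) D (π.prod (volume : Measure (E m))) ∧
    ∫ p in D, φ (g p) ∂(π.prod (volume : Measure (E m))) =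
      ∑ c ∈ g.range with c ≠ 0, (π.prod (volume : Measure (E m))).real (g ⁻¹' {c} ∩ D) • φ c := by
  have e : (fun p => φ (g p)) = fun p => ∑ c ∈ g.range with c ≠ 0,
      (g ⁻¹' {c}).indicator (fun _ => φ c) p := by
    ext p
    by_cases h0 : g p = 0
    · rw [h0, hφ, Finset.sum_eq_zero]
      intro c hc
      rw [Set.indicator_of_notMem]
      intro hp
      exact (Finset.mem_filter.1 hc).2 ((hp : g p = c).symm.trans h0)
    · rw [Finset.sum_eq_single (g p)]
      · rw [Set.indicator_of_mem (by simp)]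
      · intro c _ hc
        rw [Set.indicator_of_notMem]
        exact fun hp => hc (hp : g p = c).symm
      · intro h
        exact absurd (Finset.mem_filter.2 ⟨SimpleFunc.mem_range_self g p, h0⟩) h
  have hi : ∀ c ∈ g.range.filter (fun c => c ≠ 0), IntegrableOn
      (fun p => (g ⁻¹' {c}).indicator (fun _ => φ c) p) D (π.prod (volume : Measure (E m))) := by
    intro c hc
    rw [IntegrableOn, integrable_indicator_iff (g.measurableSet_fiber c)]
    refine integrableOn_const (ne_of_lt ?_)
    rw [Measure.restrict_apply (g.measurableSet_fiber c)]
    exact measure_lt_top_of_isBounded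
      (isBounded_preimage_of_support g hg (φ := id) (fun p => rfl) (Finset.mem_filter.1 hc).2 D)
  rw [e]
  refine ⟨integrable_finsetSum _ hi, ?_⟩
  rw [integral_finsetSum _ hi]
  refine Finset.sum_congr rfl fun c _ => ?_
  rw [integral_indicator (g.measurableSet_fiber c), setIntegral_const, measureReal_def,
    Measure.restrict_apply (g.measurableSet_fiber c), measureReal_def]

/-- The first moment bound for `∫_D k dΛ`. -/
noncomputable def momentBound {T : Type*} [MeasurableSpace T] {n d : ℕ} (ctrl : Measure T)
    (Q : Matrix (Fin d) (Fin d) ℝ) (β : E d) (ν : Measure (E d)) (K : Set (E d)) (D : Set T)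
    (k : T → Matrix (Fin n) (Fin d) ℝ) : ℝ :=
  Real.sqrt (∫ p in D, qform Q (k p) ∂ctrl + ‖∫ p in D, mv (k p) β ∂ctrl‖ ^ 2) +
    ∫ p in D, jumpNorm ν K (k p) ∂ctrl

/-- With the masses of the level sets as weights, the finite sums in `IsSplit.lintegral_enorm_le`
are integrals of functionals of `g` over `D`. -/
theorem IsLevyBasis.lintegral_simpleInt_le [IsProbabilityMeasure π]
    (hΛ : IsLevyBasis P Λ γ Sig ν π) {β : E d} {K : Set (E d)} (hsp : IsSplit γ Sig ν β K)
    {g : SimpleFunc (S × E m) (Matrix (Fin n) (Fin d) ℝ)}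
    (hg : Bornology.IsBounded (Function.support g)) {D : Set (S × E m)} (hD : MeasurableSet D) :
    ∫⁻ ω, ‖simpleInt Λ g D ω‖ₑ ∂P ≤ ENNReal.ofReal
      (momentBound (π.prod volume) (Sig + secondMoment ν K) β ν K D g) := by
  classical
  have hm := hΛ.measurable_simpleInt hg hD
  have : IsProbabilityMeasure (P.map (simpleInt Λ g D)) :=
    Measure.isProbabilityMeasure_map hm.aemeasurable
  have h := hsp.lintegral_enorm_le (μ := P.map (simpleInt Λ g D)) (g.range.filter fun c => c ≠ 0)
    (fun c => (π.prod (volume : Measure (E m))).real (g ⁻¹' {c} ∩ D)) (fun _ => measureReal_nonneg)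
    (fun u => hΛ.charFun_simpleInt hg hD u)
  rw [lintegral_map (by fun_prop) hm] at h
  refine h.trans (le_of_eq ?_)
  rw [momentBound, (setIntegral_simpleFunc hg D (qform _) (qform_zero _)).2,
    (setIntegral_simpleFunc hg D (fun M => mv M β) (zero_mv β)).2,
    (setIntegral_simpleFunc hg D (jumpNorm ν K) (jumpNorm_zero ν K)).2]
  simp only [smul_eq_mul]

end simpleInt

/-! ### Independence of integrals over disjoint sets -/

section independence
variable {Ω S : Type*} [MeasurableSpace Ω] {P : Measure Ω} [IsProbabilityMeasure P]
  [MetricSpace S] [MeasurableSpace S] {m n d : ℕ} {Λ : Set (S × E m) → Ω → E d}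
  {γ : E d} {Sig : Matrix (Fin d) (Fin d) ℝ} {ν : Measure (E d)} {π : Measure S}

open Classical in
/-- The points that lie in exactly those `B i` with `i ∈ s`. -/
def atom {α ι : Type*} [Fintype ι] (B : ι → Set α) (s : Finset ι) : Set α :=
  {p | Finset.univ.filter (fun i => p ∈ B i) = s}

lemma atom_subset {α ι : Type*} [Fintype ι] (B : ι → Set α) {s : Finset ι} {i : ι} (hi : i ∈ s) :
    atom B s ⊆ B i := by
  classical
  intro p hp
  have h : Finset.univ.filter (fun i => p ∈ B i) = s := hp
  rw [← h] at hi
  exact (Finset.mem_filter.1 hi).2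

lemma disjoint_atom {α ι : Type*} [Fintype ι] (B : ι → Set α) {s t : Finset ι} (h : s ≠ t) :
    Disjoint (atom B s) (atom B t) :=
  Set.disjoint_left.2 fun _ hp hp' => h (hp.symm.trans hp')

lemma measurableSet_atom {α ι : Type*} [MeasurableSpace α] [Fintype ι] {B : ι → Set α}
    (hB : ∀ i, MeasurableSet (B i)) (s : Finset ι) : MeasurableSet (atom B s) := by
  classical
  have e : atom B s = ⋂ i, if i ∈ s then B i else (B i)ᶜ := by
    ext p
    simp only [atom, Set.mem_ofPred_eq, Set.mem_iInter, Finset.ext_iff, Finset.mem_filter,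
      Finset.mem_univ, true_and]
    refine forall_congr' fun i => ?_
    by_cases hi : i ∈ s <;> simp [hi]
  rw [e]
  refine MeasurableSet.iInter fun i => ?_
  split_ifs
  exacts [hB i, (hB i).compl]

open Classical in
lemma eq_biUnion_atom {α ι : Type*} [Fintype ι] (B : ι → Set α) (i : ι) :
    B i = ⋃ s ∈ (Finset.univ : Finset {s : Finset ι // s.Nonempty}).filter (fun s => i ∈ s.1),
      atom B s.1 := by
  ext p
  simp only [Finset.mem_filter, Finset.mem_univ, true_and, Set.mem_iUnion]
  constructor
  · intro hp
    have hi : i ∈ Finset.univ.filter (fun i => p ∈ B i) := by simp [hp]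
    exact ⟨⟨_, ⟨i, hi⟩⟩, hi, rfl⟩
  · rintro ⟨s, hi, hp⟩
    exact atom_subset B hi hp

open Classical in
lemma IsLevyBasis.ae_eq_sum_atom (hΛ : IsLevyBasis P Λ γ Sig ν π) {ι : Type*} [Fintype ι]
    {B : ι → Set (S × E m)} (hB : ∀ i, MeasurableSet (B i))
    (hBb : ∀ i, Bornology.IsBounded (B i)) :
    ∀ᵐ ω ∂P, ∀ i, Λ (B i) ω =
      ∑ s ∈ (Finset.univ : Finset {s : Finset ι // s.Nonempty}).filter (fun s => i ∈ s.1),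
        Λ (atom B s.1) ω := by
  refine ae_all_iff.2 fun i => ?_
  have h := hΛ.biUnion_ae
    ((Finset.univ : Finset {s : Finset ι // s.Nonempty}).filter (fun s => i ∈ s.1))
    (fun s : {s : Finset ι // s.Nonempty} => atom B s.1)
    (fun s _ => measurableSet_atom hB s.1)
    (fun s hs => (hBb i).subset (atom_subset B (Finset.mem_filter.1 hs).2))
    (fun s _ t _ hst => disjoint_atom B fun h => hst (Subtype.ext h))
  rwa [← eq_biUnion_atom] at h

/-- Sets within one family may overlap, while the axiom speaks of disjoint sets only. Both families
are almost surely sums over their atoms, and all these atoms are pairwise disjoint. -/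
lemma IsLevyBasis.indepFun_of_disjoint (hΛ : IsLevyBasis P Λ γ Sig ν π) {ι κ : Type*} [Fintype ι]
    [Fintype κ] {B : ι → Set (S × E m)} {C : κ → Set (S × E m)} (hB : ∀ i, MeasurableSet (B i))
    (hBb : ∀ i, Bornology.IsBounded (B i)) (hC : ∀ j, MeasurableSet (C j))
    (hCb : ∀ j, Bornology.IsBounded (C j)) (hd : ∀ i j, Disjoint (B i) (C j)) :
    IndepFun (fun ω i => Λ (B i) ω) (fun ω j => Λ (C j) ω) P := by
  classical
  set A : {s : Finset ι // s.Nonempty} ⊕ {s : Finset κ // s.Nonempty} → Set (S × E m) :=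
    Sum.elim (fun s => atom B s.1) (fun s => atom C s.1) with hA
  have hAm : ∀ t, MeasurableSet (A t) := by
    rintro (s | s)
    exacts [measurableSet_atom hB s.1, measurableSet_atom hC s.1]
  have hAb : ∀ t, Bornology.IsBounded (A t) := by
    rintro (s | s)
    · obtain ⟨i, hi⟩ := s.2
      exact (hBb i).subset (atom_subset B hi)
    · obtain ⟨i, hi⟩ := s.2
      exact (hCb i).subset (atom_subset C hi)
  have hBC : ∀ (s : {s : Finset ι // s.Nonempty}) (t : {s : Finset κ // s.Nonempty}),
      Disjoint (atom B s.1) (atom C t.1) := fun s t => by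
    obtain ⟨i, hi⟩ := s.2
    obtain ⟨j, hj⟩ := t.2
    exact (hd i j).mono (atom_subset B hi) (atom_subset C hj)
  have hAd : Pairwise fun t t' => Disjoint (A t) (A t') := by
    rintro (s | s) (t | t) hst
    · exact disjoint_atom B fun h => hst (by rw [Subtype.ext h])
    · exact hBC s t
    · exact (hBC t s).symm
    · exact disjoint_atom C fun h => hst (by rw [Subtype.ext h])
  have hind := hΛ.iIndepFun_fintype A hAm hAb hAd
  set L : Finset ({s : Finset ι // s.Nonempty} ⊕ {s : Finset κ // s.Nonempty}) :=
    Finset.univ.image Sum.inl with hL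
  set R : Finset ({s : Finset ι // s.Nonempty} ⊕ {s : Finset κ // s.Nonempty}) :=
    Finset.univ.image Sum.inr with hR
  have hLR : Disjoint L R := by
    rw [Finset.disjoint_left]
    intro t ht ht'
    obtain ⟨s, _, rfl⟩ := Finset.mem_image.1 ht
    obtain ⟨s', _, h⟩ := Finset.mem_image.1 ht'
    cases h
  have h := hind.indepFun_finset L R hLR fun t => hΛ.measurable _ (hAm t) (hAb t)
  have h' := h.comp
    (φ := fun x (i : ι) => ∑ s ∈ Finset.univ.filter
      (fun s : {s : Finset ι // s.Nonempty} => i ∈ s.1),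
      x ⟨Sum.inl s, Finset.mem_image_of_mem _ (Finset.mem_univ _)⟩)
    (ψ := fun x (j : κ) => ∑ s ∈ Finset.univ.filter
      (fun s : {s : Finset κ // s.Nonempty} => j ∈ s.1),
      x ⟨Sum.inr s, Finset.mem_image_of_mem _ (Finset.mem_univ _)⟩)
    (by fun_prop) (by fun_prop)
  refine h'.congr ?_ ?_
  · filter_upwards [hΛ.ae_eq_sum_atom hB hBb] with ω hω
    ext1 i
    exact (hω i).symm
  · filter_upwards [hΛ.ae_eq_sum_atom hC hCb] with ω hω
    ext1 i
    exact (hω i).symm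

/-- The bounded Borel subsets of `U`. -/
abbrev BoundedIn (S : Type*) [MetricSpace S] [MeasurableSpace S] {m : ℕ} (U : Set (S × E m)) :=
  {B : Set (S × E m) // MeasurableSet B ∧ Bornology.IsBounded B ∧ B ⊆ U}

/-- The σ-algebra generated by `Λ` on `U`. -/
@[reducible] def sigmaOn (Λ : Set (S × E m) → Ω → E d) (U : Set (S × E m)) : MeasurableSpace Ω :=
  ⨆ s : Finset (BoundedIn S U),
    MeasurableSpace.comap (fun ω (B : s) => Λ B.1.1 ω) MeasurableSpace.pi

lemma IsLevyBasis.measurable_family (hΛ : IsLevyBasis P Λ γ Sig ν π) {U : Set (S × E m)}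
    (s : Finset (BoundedIn S U)) : Measurable fun ω (B : s) => Λ B.1.1 ω :=
  measurable_pi_lambda _ fun B => hΛ.measurable _ B.1.2.1 B.1.2.2.1

lemma IsLevyBasis.sigmaOn_le (hΛ : IsLevyBasis P Λ γ Sig ν π) (U : Set (S × E m)) :
    sigmaOn Λ U ≤ ‹MeasurableSpace Ω› :=
  iSup_le fun s => (hΛ.measurable_family s).comap_le

lemma measurable_sigmaOn {U : Set (S × E m)} (B : BoundedIn S U) :
    Measurable[sigmaOn Λ U] (Λ B.1) := by
  have h : Measurable[MeasurableSpace.comap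
      (fun ω (C : ({B} : Finset (BoundedIn S U))) => Λ C.1.1 ω) MeasurableSpace.pi] (Λ B.1) := by
    have h1 : Measurable[MeasurableSpace.comap
      (fun ω (C : ({B} : Finset (BoundedIn S U))) => Λ C.1.1 ω) MeasurableSpace.pi]
      (fun ω (C : ({B} : Finset (BoundedIn S U))) => Λ C.1.1 ω) := comap_measurable _
    exact (measurable_pi_apply (⟨B, Finset.mem_singleton_self B⟩ :
      ({B} : Finset (BoundedIn S U)))).comp h1
  exact h.mono (le_iSup (fun s : Finset (BoundedIn S U) => MeasurableSpace.comap
    (fun ω (B : s) => Λ B.1.1 ω) MeasurableSpace.pi) {B}) le_rfl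

/-- Finite subfamilies make the supremum in `sigmaOn` directed, so that independence of its members
extends to the supremum. -/
lemma directed_family (U : Set (S × E m)) :
    Directed (· ≤ ·) fun s : Finset (BoundedIn S U) =>
      MeasurableSpace.comap (fun ω (B : s) => Λ B.1.1 ω) MeasurableSpace.pi := by
  classical
  refine directed_of_isDirected_le fun s t hst => ?_
  let r : (t → E d) → (s → E d) := fun x B => x ⟨B.1, hst B.2⟩
  have hr : Measurable r := by fun_prop
  have e : (fun ω (B : s) => Λ B.1.1 ω) = r ∘ fun ω (B : t) => Λ B.1.1 ω := rfl
  rw [e, ← MeasurableSpace.comap_comp]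
  exact MeasurableSpace.comap_mono hr.comap_le

/-- The directed supremum is taken twice, once on each side. -/
theorem IsLevyBasis.indep_sigmaOn (hΛ : IsLevyBasis P Λ γ Sig ν π) {U K : Set (S × E m)}
    (hUK : Disjoint U K) : Indep (sigmaOn Λ U) (sigmaOn Λ K) P := by
  refine indep_iSup_of_directed_le (fun s => Indep.symm ?_)
    (fun s => (hΛ.measurable_family s).comap_le) (hΛ.sigmaOn_le K) (directed_family U)
  refine indep_iSup_of_directed_le (fun t => ?_)
    (fun s => (hΛ.measurable_family s).comap_le) (hΛ.measurable_family s).comap_le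
    (directed_family K)
  exact (hΛ.indepFun_of_disjoint (fun B : t => B.1.2.1) (fun B : t => B.1.2.2.1)
    (fun B : s => B.1.2.1) (fun B : s => B.1.2.2.1)
    fun B C => (hUK.mono C.1.2.2.2 B.1.2.2.2).symm)

lemma measurable_simpleInt_sigmaOn {g : SimpleFunc (S × E m) (Matrix (Fin n) (Fin d) ℝ)}
    (hg : Bornology.IsBounded (Function.support g)) {D : Set (S × E m)} (hD : MeasurableSet D) :
    Measurable[sigmaOn Λ D] (simpleInt Λ g D) := by
  exact @measurable_simpleInt_of Ω S (sigmaOn Λ D) _ _ _ _ _ _ _ _ fun c hc =>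
    measurable_sigmaOn (Λ := Λ) (U := D) ⟨g ⁻¹' {c} ∩ D, (g.measurableSet_fiber c).inter hD,
      isBounded_preimage_of_support g hg (φ := id) (fun p => rfl) hc D, Set.inter_subset_right⟩

lemma sigmaOn_mono {U K : Set (S × E m)} (h : U ⊆ K) : sigmaOn Λ U ≤ sigmaOn Λ K := by
  refine iSup_le fun s => measurable_iff_comap_le.1 ?_
  refine @measurable_pi_lambda _ _ _ (sigmaOn Λ K) _ _ fun B => ?_
  exact measurable_sigmaOn (Λ := Λ) (U := K) ⟨B.1.1, B.1.2.1, B.1.2.2.1, B.1.2.2.2.trans h⟩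

lemma stronglyMeasurable_limUnder {Ω : Type*} [MeasurableSpace Ω] {f : ℕ → Ω → E n}
    (hf : ∀ i, Measurable (f i)) :
    StronglyMeasurable fun ω => limUnder atTop fun i => f i ω :=
  StronglyMeasurable.limUnder fun i => (hf i).stronglyMeasurable

/-- A limit in probability of integrals over `D` is, up to a null set, a function of `Λ` on `D`. -/
lemma aestronglyMeasurable_sigmaOn {g : ℕ → SimpleFunc (S × E m) (Matrix (Fin n) (Fin d) ℝ)}
    (hg : ∀ i, Bornology.IsBounded (Function.support (g i))) {D : Set (S × E m)}
    (hD : MeasurableSet D) {Z : Ω → E n}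
    (hZ : TendstoInMeasure P (fun i => simpleInt Λ (g i) D) atTop Z) :
    AEStronglyMeasurable[sigmaOn Λ D] Z P := by
  -- An almost surely convergent subsequence; its pointwise `limUnder` is measurable for `sigmaOn Λ
  -- D` because each term is.
  obtain ⟨ns, _, hns⟩ := hZ.exists_seq_tendsto_ae
  refine ⟨fun ω => limUnder atTop fun i => simpleInt Λ (g (ns i)) D ω, ?_, ?_⟩
  · exact @stronglyMeasurable_limUnder n Ω (sigmaOn Λ D) _ fun i =>
      measurable_simpleInt_sigmaOn (hg (ns i)) hD
  · filter_upwards [hns] with ω hω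
    exact hω.limUnder_eq.symm

/-- Independence depends only on almost sure classes. Countability of the index set allows all
representatives to be exchanged at once. -/
theorem IsLevyBasis.indepFun_of_aestronglyMeasurable (hΛ : IsLevyBasis P Λ γ Sig ν π)
    {U K : Set (S × E m)} (hUK : Disjoint U K) {ι : Type*} [Countable ι] {X : ι → Ω → E n}
    (hX : ∀ a, AEStronglyMeasurable[sigmaOn Λ U] (X a) P) {Z : Ω → E n}
    (hZ : AEStronglyMeasurable[sigmaOn Λ K] Z P) : IndepFun (fun ω a => X a ω) Z P := by
  have h := hΛ.indep_sigmaOn hUK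
  have h1 : Measurable[sigmaOn Λ U] fun ω a => (hX a).mk (X a) ω :=
    @measurable_pi_lambda _ _ _ (sigmaOn Λ U) _ _ fun a => (hX a).stronglyMeasurable_mk.measurable
  have h2 : Measurable[sigmaOn Λ K] (hZ.mk Z) := hZ.stronglyMeasurable_mk.measurable
  have h3 : IndepFun (fun ω a => (hX a).mk (X a) ω) (hZ.mk Z) P :=
    indep_of_indep_of_le_left (indep_of_indep_of_le_right h h2.comap_le) h1.comap_le
  refine h3.congr ?_ hZ.ae_eq_mk.symm
  filter_upwards [ae_all_iff.2 fun a => (hX a).ae_eq_mk] with ω hω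
  ext1 a
  exact (hω a).symm

end independence

/-! ### A metric for convergence in probability -/

section probDist
variable {Ω : Type*} [MeasurableSpace Ω] {P : Measure Ω} {F : Type*} [NormedAddCommGroup F]

/-- The metric `E[min(1, ‖X - Y‖)]` of convergence in probability. -/
noncomputable def probDist (P : Measure Ω) (X Y : Ω → F) : ℝ≥0∞ := ∫⁻ ω, min 1 ‖X ω - Y ω‖ₑ ∂P

lemma min_one_add_le (a b : ℝ≥0∞) : min 1 (a + b) ≤ min 1 a + min 1 b := by
  rcases le_total 1 a with ha | ha
  · exact (min_le_left _ _).trans (by rw [min_eq_left ha]; exact le_self_add)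
  · rcases le_total 1 b with hb | hb
    · exact (min_le_left _ _).trans (by rw [min_eq_left hb]; exact le_add_self)
    · rw [min_eq_right ha, min_eq_right hb]; exact min_le_right _ _

lemma probDist_comm (X Y : Ω → F) : probDist P X Y = probDist P Y X := by
  unfold probDist
  simp_rw [enorm_sub_rev]

lemma probDist_zero_le (X : Ω → F) : probDist P X 0 ≤ ∫⁻ ω, ‖X ω‖ₑ ∂P := by
  refine lintegral_mono fun ω => ?_
  simp

/-- If `X - Y = (X₁ - Y₁) + (X₂ - Y₂)`, then the distances are subadditive. -/
lemma probDist_le_add {X Y X₁ Y₁ X₂ Y₂ : Ω → F} (hX : AEStronglyMeasurable X₁ P)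
    (hY : AEStronglyMeasurable Y₁ P)
    (h : ∀ᵐ ω ∂P, X ω - Y ω = (X₁ ω - Y₁ ω) + (X₂ ω - Y₂ ω)) :
    probDist P X Y ≤ probDist P X₁ Y₁ + probDist P X₂ Y₂ := by
  have hm : AEMeasurable (fun ω => min 1 ‖X₁ ω - Y₁ ω‖ₑ) P :=
    aemeasurable_const.min (hX.sub hY).enorm
  unfold probDist
  rw [← lintegral_add_left' hm]
  refine lintegral_mono_ae ?_
  filter_upwards [h] with ω hω
  rw [hω]
  exact (min_le_min_left _ (enorm_add_le _ _)).trans (min_one_add_le _ _)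

lemma probDist_triangle {X Y Z : Ω → F} (hX : AEStronglyMeasurable X P)
    (hY : AEStronglyMeasurable Y P) : probDist P X Z ≤ probDist P X Y + probDist P Y Z :=
  probDist_le_add hX hY (Eventually.of_forall fun ω => by abel)

lemma tendsto_probDist [IsProbabilityMeasure P] {X : ℕ → Ω → F} {Z : Ω → F}
    (h : TendstoInMeasure P X atTop Z) : Tendsto (fun i => probDist P (X i) Z) atTop (𝓝 0) := by
  rw [ENNReal.tendsto_nhds_zero]
  intro ε hε
  rcases eq_or_ne ε ∞ with rfl | hε'
  · simp
  have hε2 : 0 < ε / 2 := ENNReal.half_pos hε.ne'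
  have h1 := (ENNReal.tendsto_nhds_zero.1 (tendstoInMeasure_iff_enorm.1 h (ε / 2) hε2 (by
    exact ENNReal.div_ne_top hε' (by norm_num)))) (ε / 2) hε2
  filter_upwards [h1] with i hi
  -- `B` need not be measurable, as nothing is assumed of `X i` and `Z`; its measurable hull has the
  -- same measure.
  set B := {ω | ε / 2 ≤ ‖X i ω - Z ω‖ₑ} with hB
  calc probDist P (X i) Z
      ≤ ∫⁻ ω, (ε / 2 + (toMeasurable P B).indicator 1 ω) ∂P := by
        refine lintegral_mono fun ω => ?_
        by_cases hω : ω ∈ B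
        · have : ω ∈ toMeasurable P B := subset_toMeasurable _ _ hω
          simp only [Set.indicator_of_mem this, Pi.one_apply]
          exact (min_le_left _ _).trans le_add_self
        · have : ‖X i ω - Z ω‖ₑ < ε / 2 := not_le.1 hω
          exact (min_le_right _ _).trans (this.le.trans le_self_add)
    _ = ε / 2 + P B := by
        rw [lintegral_add_left measurable_const, lintegral_const, measure_univ, mul_one,
          lintegral_indicator_one (measurableSet_toMeasurable _ _), measure_toMeasurable]
    _ ≤ ε / 2 + ε / 2 := by gcongr
    _ = ε := ENNReal.add_halves ε

lemma tendstoInMeasure_of_probDist {X : ℕ → Ω → F} {Z : Ω → F}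
    (hX : ∀ i, AEStronglyMeasurable (X i) P) (hZ : AEStronglyMeasurable Z P)
    (h : Tendsto (fun i => probDist P (X i) Z) atTop (𝓝 0)) : TendstoInMeasure P X atTop Z := by
  rw [tendstoInMeasure_iff_enorm]
  intro ε hε hε'
  have hm : min 1 ε ≠ 0 := (lt_min one_pos hε).ne'
  have hm' : min 1 ε ≠ ∞ := ne_top_of_le_ne_top ENNReal.one_ne_top (min_le_left _ _)
  have hle : ∀ i, P {ω | ε ≤ ‖X i ω - Z ω‖ₑ} ≤ probDist P (X i) Z / min 1 ε := by
    intro i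
    rw [ENNReal.le_div_iff_mul_le (Or.inl hm) (Or.inl hm'), mul_comm]
    have hm2 : AEMeasurable (fun ω => min 1 ‖X i ω - Z ω‖ₑ) P :=
      aemeasurable_const.min ((hX i).sub hZ).enorm
    refine le_trans (mul_le_mul' le_rfl (measure_mono fun ω hω => ?_))
      (mul_meas_ge_le_lintegral₀ hm2 (min 1 ε))
    rw [Set.mem_ofPred_eq] at hω ⊢
    exact min_le_min_left 1 hω
  refine tendsto_of_tendsto_of_tendsto_of_le_of_le tendsto_const_nhds ?_ (fun _ => zero_le) hle
  have := ENNReal.Tendsto.div_const h (Or.inr hm) (b := min 1 ε)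
  simpa using this

/-- Lower semicontinuity of the L¹ norm under convergence in probability. -/
lemma lintegral_enorm_le_of_tendstoInMeasure {X : ℕ → Ω → F} {Z : Ω → F}
    (hX : ∀ i, AEStronglyMeasurable (X i) P) (h : TendstoInMeasure P X atTop Z) {C : ℕ → ℝ}
    {c : ℝ} (hC : ∀ i, ∫⁻ ω, ‖X i ω‖ₑ ∂P ≤ ENNReal.ofReal (C i)) (hc : Tendsto C atTop (𝓝 c)) :
    ∫⁻ ω, ‖Z ω‖ₑ ∂P ≤ ENNReal.ofReal c := by
  have hc' : Tendsto (fun i => ENNReal.ofReal (C i)) atTop (𝓝 (ENNReal.ofReal c)) :=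
    ENNReal.tendsto_ofReal hc
  refine ENNReal.le_of_forall_pos_le_add fun ε hε hlt => ?_
  have hev : ∀ᶠ i in atTop, ENNReal.ofReal (C i) < ENNReal.ofReal c + ε :=
    hc'.eventually_lt_const (ENNReal.lt_add_right hlt.ne (by positivity))
  have := eLpNorm_le_of_tendstoInMeasure (p := 1) (C := ENNReal.ofReal c + ε)
    (hev.mono fun i hi => by
      rw [eLpNorm_one_eq_lintegral_enorm]
      exact (hC i).trans hi.le) h hX
  rwa [eLpNorm_one_eq_lintegral_enorm] at this

end probDist

/-! ### The moment bound as a function of the domain -/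

section momentBound
variable {T : Type*} [MeasurableSpace T] {n d : ℕ}

/-- The three integrands in the moment bound are integrable on `D`. -/
structure MomentIntegrableOn (ctrl : Measure T) (Q : Matrix (Fin d) (Fin d) ℝ)
    (β : E d) (ν : Measure (E d)) (K : Set (E d)) (D : Set T)
    (k : T → Matrix (Fin n) (Fin d) ℝ) : Prop where
  quad : IntegrableOn (fun p => qform Q (k p)) D ctrl
  mean : IntegrableOn (fun p => mv (k p) β) D ctrl
  jump : IntegrableOn (fun p => jumpNorm ν K (k p)) D ctrl

variable {ctrl : Measure T} {Q : Matrix (Fin d) (Fin d) ℝ} {β : E d} {ν : Measure (E d)}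
  {K : Set (E d)} {D D' : Set T} {k : T → Matrix (Fin n) (Fin d) ℝ}

lemma MomentIntegrableOn.mono (h : MomentIntegrableOn ctrl Q β ν K D k) (hD : D' ⊆ D) :
    MomentIntegrableOn ctrl Q β ν K D' k :=
  ⟨h.quad.mono_set hD, h.mean.mono_set hD, h.jump.mono_set hD⟩

lemma tendsto_momentBound {F : Filter ℕ} {a : ℕ → ℝ} {b : ℕ → E n} {c : ℕ → ℝ} {a₀ c₀ : ℝ}
    {b₀ : E n} (ha : Tendsto a F (𝓝 a₀)) (hb : Tendsto b F (𝓝 b₀)) (hc : Tendsto c F (𝓝 c₀)) :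
    Tendsto (fun i => Real.sqrt (a i + ‖b i‖ ^ 2) + c i) F
      (𝓝 (Real.sqrt (a₀ + ‖b₀‖ ^ 2) + c₀)) :=
  ((ha.add (hb.norm.pow 2)).sqrt).add hc

lemma MomentIntegrableOn.tendsto_of_monotone {D : ℕ → Set T} (hm : ∀ i, MeasurableSet (D i))
    (hmono : Monotone D) (h : MomentIntegrableOn ctrl Q β ν K (⋃ i, D i) k) :
    Tendsto (fun i => momentBound ctrl Q β ν K (D i) k) atTop
      (𝓝 (momentBound ctrl Q β ν K (⋃ i, D i) k)) :=
  tendsto_momentBound (tendsto_setIntegral_of_monotone hm hmono h.quad)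
    (tendsto_setIntegral_of_monotone hm hmono h.mean)
    (tendsto_setIntegral_of_monotone hm hmono h.jump)

/-- A version of the moment bound that is monotone in the domain of integration. -/
noncomputable def absMomentBound (ctrl : Measure T) (Q : Matrix (Fin d) (Fin d) ℝ)
    (β : E d) (ν : Measure (E d)) (K : Set (E d)) (D : Set T)
    (k : T → Matrix (Fin n) (Fin d) ℝ) : ℝ :=
  Real.sqrt (∫ p in D, |qform Q (k p)| ∂ctrl + (∫ p in D, ‖mv (k p) β‖ ∂ctrl) ^ 2) +
    ∫ p in D, jumpNorm ν K (k p) ∂ctrl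

lemma MomentIntegrableOn.momentBound_le (h : MomentIntegrableOn ctrl Q β ν K D k) (hD : D' ⊆ D) :
    momentBound ctrl Q β ν K D' k ≤ absMomentBound ctrl Q β ν K D k := by
  have h' := h.mono hD
  refine add_le_add (Real.sqrt_le_sqrt (add_le_add ?_ ?_)) ?_
  · refine (integral_mono h'.quad h'.quad.abs fun p => le_abs_self _).trans ?_
    exact setIntegral_mono_set h.quad.abs (Eventually.of_forall fun _ => abs_nonneg _)
      (Eventually.of_forall hD)
  · refine pow_le_pow_left₀ (norm_nonneg _) ((norm_integral_le_integral_norm _).trans ?_) 2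
    exact setIntegral_mono_set h.mean.norm (Eventually.of_forall fun _ => norm_nonneg _)
      (Eventually.of_forall hD)
  · exact setIntegral_mono_set h.jump (Eventually.of_forall fun _ => jumpNorm_nonneg _ _ _)
      (Eventually.of_forall hD)

lemma MomentIntegrableOn.tendsto_absMomentBound {D : ℕ → Set T} (hm : ∀ i, MeasurableSet (D i))
    (hanti : Antitone D) (hD : ⋂ i, D i = ∅) (h : MomentIntegrableOn ctrl Q β ν K (D 0) k) :
    Tendsto (fun i => absMomentBound ctrl Q β ν K (D i) k) atTop (𝓝 0) := by
  have h1 := tendsto_setIntegral_of_antitone hm hanti ⟨0, h.quad.abs⟩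
  have h2 := tendsto_setIntegral_of_antitone hm hanti ⟨0, h.mean.norm⟩
  have h3 := tendsto_setIntegral_of_antitone hm hanti ⟨0, h.jump⟩
  rw [hD] at h1 h2 h3
  simp only [Measure.restrict_empty, integral_zero_measure] at h1 h2 h3
  have := ((h1.add (h2.pow 2)).sqrt).add h3
  simpa [absMomentBound] using this

lemma momentBound_of_null (h : ctrl D = 0) : momentBound ctrl Q β ν K D k = 0 := by
  simp [momentBound, Measure.restrict_eq_zero.2 h]

lemma momentBound_of_eqOn_zero (h : ∀ p ∈ D, k p = 0) :
    momentBound ctrl Q β ν K D k = 0 := by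
  have h1 : ∫ p in D, qform Q (k p) ∂ctrl = 0 :=
    setIntegral_eq_zero_of_forall_eq_zero fun p hp => by simp [h p hp]
  have h2 : ∫ p in D, mv (k p) β ∂ctrl = 0 :=
    setIntegral_eq_zero_of_forall_eq_zero fun p hp => by simp [h p hp]
  have h3 : ∫ p in D, jumpNorm ν K (k p) ∂ctrl = 0 :=
    setIntegral_eq_zero_of_forall_eq_zero fun p hp => by simp [h p hp]
  simp [momentBound, h1, h2, h3]

end momentBound

/-! ### Uniformly small tails by Baire category -/

/-- The union of the layers `H k \ H (k + 1)` selected by `J`. -/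
def layers {α : Type*} (H : ℕ → Set α) (J : ℕ → Bool) : Set α :=
  ⋃ k, ⋃ (_ : J k = true), H k \ H (k + 1)

section layers
variable {α : Type*} {H : ℕ → Set α}

lemma mem_layers {J : ℕ → Bool} {p : α} :
    p ∈ layers H J ↔ ∃ k, J k = true ∧ p ∈ H k ∧ p ∉ H (k + 1) := by
  simp [layers, and_left_comm]

lemma measurableSet_layers [MeasurableSpace α] (hm : ∀ i, MeasurableSet (H i)) (J : ℕ → Bool) :
    MeasurableSet (layers H J) :=
  MeasurableSet.iUnion fun k => MeasurableSet.iUnion fun _ => (hm k).diff (hm (k + 1))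

/-- Layers below `L` are selected by both sequences or by neither. -/
lemma layers_diff_subset (hanti : Antitone H) {J J' : ℕ → Bool} {L : ℕ}
    (h : ∀ k < L, J k = J' k) : layers H J \ layers H J' ⊆ H L := by
  rintro p ⟨hp, hp'⟩
  obtain ⟨k, hk, h1, h2⟩ := mem_layers.1 hp
  rcases lt_or_ge k L with hkL | hkL
  · exact absurd (mem_layers.2 ⟨k, by rw [← h k hkL, hk], h1, h2⟩) hp'
  · exact hanti hkL h1

/-- A point of `H L` must leave the sets at some later stage, since their intersection is empty; so
the layers from `L` on exhaust `H L`. -/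
lemma exists_layer (hanti : Antitone H) (hH : ⋂ i, H i = ∅) {p : α} {L : ℕ} (hp : p ∈ H L) :
    ∃ k, L ≤ k ∧ p ∈ H k ∧ p ∉ H (k + 1) := by
  by_contra! hcon
  have : ∀ j, p ∈ H (L + j) := fun j => by
    induction j with
    | zero => exact hp
    | succ j ih => exact hcon (L + j) (by omega) ih
  have hall : p ∈ ⋂ i, H i := by
    refine Set.mem_iInter.2 fun i => ?_
    rcases lt_or_ge i L with h | h
    · exact hanti h.le hp
    · obtain ⟨j, rfl⟩ := Nat.exists_eq_add_of_le h
      exact this j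
  rw [hH] at hall
  exact hall

end layers

section nikodym
variable {Ω S : Type*} [MeasurableSpace Ω] {P : Measure Ω} [IsProbabilityMeasure P]
  [MetricSpace S] [MeasurableSpace S] {m n d : ℕ} {Λ : Set (S × E m) → Ω → E d}
  {γ : E d} {Sig : Matrix (Fin d) (Fin d) ℝ} {ν : Measure (E d)} {π : Measure S}
  [IsProbabilityMeasure π] {β : E d} {K : Set (E d)}

lemma momentIntegrableOn_simpleFunc
    {g : SimpleFunc (S × E m) (Matrix (Fin n) (Fin d) ℝ)}
    (hg : Bornology.IsBounded (Function.support g)) (Q : Matrix (Fin d) (Fin d) ℝ)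
    (D : Set (S × E m)) :
    MomentIntegrableOn (π.prod (volume : Measure (E m))) Q β ν K D g :=
  ⟨(setIntegral_simpleFunc hg D (qform Q) (qform_zero Q)).1,
    (setIntegral_simpleFunc hg D (fun M => mv M β) (zero_mv β)).1,
    (setIntegral_simpleFunc hg D (jumpNorm ν K) (jumpNorm_zero ν K)).1⟩

/-- Absolute continuity of `D ↦ ∫_D g dΛ`. -/
lemma IsLevyBasis.exists_probDist_simpleInt_le (hΛ : IsLevyBasis P Λ γ Sig ν π)
    (hsp : IsSplit γ Sig ν β K) {g : SimpleFunc (S × E m) (Matrix (Fin n) (Fin d) ℝ)}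
    (hg : Bornology.IsBounded (Function.support g)) {H : ℕ → Set (S × E m)}
    (hm : ∀ i, MeasurableSet (H i)) (hanti : Antitone H) (hH : ⋂ i, H i = ∅) {ε : ℝ≥0∞}
    (hε : 0 < ε) :
    ∃ L, ∀ D, MeasurableSet D → D ⊆ H L → probDist P (simpleInt Λ g D) 0 ≤ ε := by
  have hi := momentIntegrableOn_simpleFunc (π := π) (β := β) (ν := ν) (K := K) hg
    (Sig + secondMoment ν K) (H 0)
  have h1 := ENNReal.tendsto_ofReal (hi.tendsto_absMomentBound hm hanti hH)
  rw [ENNReal.ofReal_zero] at h1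
  obtain ⟨L, hL⟩ := (ENNReal.tendsto_nhds_zero.1 h1 ε hε).exists
  refine ⟨L, fun D hD hDL => ?_⟩
  refine (probDist_zero_le _).trans ((hΛ.lintegral_simpleInt_le hsp hg hD).trans ?_)
  refine (ENNReal.ofReal_le_ofReal ?_).trans hL
  exact (hi.mono (hanti (Nat.zero_le L))).momentBound_le hDL

/-- The two integrals differ by those over the two set differences; both lie in `H L`, and each
costs `ε`. -/
lemma IsLevyBasis.probDist_layers_le (hΛ : IsLevyBasis P Λ γ Sig ν π)
    {g : SimpleFunc (S × E m) (Matrix (Fin n) (Fin d) ℝ)}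
    (hg : Bornology.IsBounded (Function.support g)) {H : ℕ → Set (S × E m)}
    (hm : ∀ i, MeasurableSet (H i)) (hanti : Antitone H) {ε : ℝ≥0∞} {L : ℕ}
    (hL : ∀ D, MeasurableSet D → D ⊆ H L → probDist P (simpleInt Λ g D) 0 ≤ ε)
    {J J' : ℕ → Bool} (h : ∀ k < L, J k = J' k) :
    probDist P (simpleInt Λ g (layers H J)) (simpleInt Λ g (layers H J')) ≤ 2 * ε := by
  have mJ := measurableSet_layers hm J
  have mJ' := measurableSet_layers hm J'
  have e1 := hΛ.simpleInt_union_ae hg (mJ.inter mJ') (mJ.diff mJ')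
    (Set.disjoint_sdiff_right.mono_left Set.inter_subset_right)
  have e2 := hΛ.simpleInt_union_ae hg (mJ'.inter mJ) (mJ'.diff mJ)
    (Set.disjoint_sdiff_right.mono_left Set.inter_subset_right)
  rw [Set.inter_union_sdiff] at e1 e2
  rw [Set.inter_comm] at e2
  have h0 : AEStronglyMeasurable (0 : Ω → E n) P := aestronglyMeasurable_zero
  have := probDist_le_add (P := P) (X := simpleInt Λ g (layers H J))
    (Y := simpleInt Λ g (layers H J')) (X₁ := simpleInt Λ g (layers H J \ layers H J')) (Y₁ := 0)
    (X₂ := 0) (Y₂ := simpleInt Λ g (layers H J' \ layers H J))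
    (hΛ.measurable_simpleInt hg (mJ.diff mJ')).aestronglyMeasurable h0 (by
      filter_upwards [e1, e2] with ω w1 w2
      rw [w1, w2]
      simp only [Pi.zero_apply]
      abel)
  refine this.trans ?_
  rw [two_mul, probDist_comm 0]
  exact add_le_add (hL _ (mJ.diff mJ') (layers_diff_subset hanti h))
    (hL _ (mJ'.diff mJ) (layers_diff_subset hanti fun k hk => (h k hk).symm))

/-- The set of `J` that agree with `J₀` up to `L` is a neighbourhood of `J₀`. -/
lemma eventually_eq_lt (J₀ : ℕ → Bool) (L : ℕ) : ∀ᶠ J in 𝓝 J₀, ∀ k < L, J k = J₀ k := by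
  have h : ∀ k, ∀ᶠ J : ℕ → Bool in 𝓝 J₀, J k = J₀ k := fun k => by
    have ho : IsOpen ((fun J : ℕ → Bool => J k) ⁻¹' {J₀ k}) :=
      (isOpen_discrete _).preimage (continuous_apply k)
    filter_upwards [ho.mem_nhds (Set.mem_singleton (J₀ k))] with J hJ using hJ
  have := (Set.finite_lt_nat L).eventually_all (l := 𝓝 J₀) (p := fun k J => J k = J₀ k)
  exact this.2 fun k _ => h k

lemma exists_cylinder_subset {U : Set (ℕ → Bool)} (hU : IsOpen U) {J₀ : ℕ → Bool} (hJ : J₀ ∈ U) :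
    ∃ L, ∀ J : ℕ → Bool, (∀ k < L, J k = J₀ k) → J ∈ U := by
  obtain ⟨I, u, hu, hsub⟩ := isOpen_pi_iff.1 hU J₀ hJ
  refine ⟨I.sup id + 1, fun J h => hsub fun k hk => ?_⟩
  have : k ≤ I.sup id := Finset.le_sup (f := id) hk
  rw [h k (by omega)]
  exact (hu k hk).2

/-- A Nikodym type theorem: if `∫_D g_i dΛ` converges in probability for every `D`, then the
integrals over sets decreasing to `∅` are small uniformly in `i`. -/
theorem IsLevyBasis.exists_uniform_tail (hΛ : IsLevyBasis P Λ γ Sig ν π)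
    (hsp : IsSplit γ Sig ν β K) {g : ℕ → SimpleFunc (S × E m) (Matrix (Fin n) (Fin d) ℝ)}
    (hg : ∀ i, Bornology.IsBounded (Function.support (g i)))
    (hconv : ∀ D, MeasurableSet D → ∃ Z : Ω → E n,
      TendstoInMeasure P (fun i => simpleInt Λ (g i) D) atTop Z)
    {H : ℕ → Set (S × E m)} (hm : ∀ i, MeasurableSet (H i)) (hanti : Antitone H)
    (hH : ⋂ i, H i = ∅) {ε : ℝ≥0∞} (hε : 0 < ε) :
    ∃ L₀ : ℕ, ∀ L ≥ L₀, ∃ M, ∀ i ≥ M, probDist P (simpleInt Λ (g i) (H L)) 0 ≤ 3 * ε := by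
  set x : ℕ → (ℕ → Bool) → Ω → E n := fun i J => simpleInt Λ (g i) (layers H J) with hx
  have hxm : ∀ i J, AEStronglyMeasurable (x i J) P := fun i J =>
    (hΛ.measurable_simpleInt (hg i) (measurableSet_layers hm J)).aestronglyMeasurable
  -- Baire category on the Cantor space of selections: the `C M` are closed and cover the space, so
  -- one of them contains a cylinder, on which the Cauchy property holds uniformly.
  set C : ℕ → Set (ℕ → Bool) := fun M => {J | ∀ i ≥ M, ∀ i' ≥ M, probDist P (x i J) (x i' J) ≤ ε}
    with hC
  -- For each fixed i the map `x i` is continuous, by the absolute continuity of the integral of a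
  -- single simple function.
  have hclosed : ∀ M, IsClosed (C M) := by
    intro M
    refine isClosed_of_closure_subset fun J hJ i hi i' hi' => ?_
    refine ENNReal.le_of_forall_pos_le_add fun η hη _ => ?_
    have hη4 : (0 : ℝ≥0∞) < η / 4 := ENNReal.div_pos (by positivity) (by norm_num)
    obtain ⟨L, hL⟩ := hΛ.exists_probDist_simpleInt_le hsp (hg i) hm hanti hH hη4
    obtain ⟨L', hL'⟩ := hΛ.exists_probDist_simpleInt_le hsp (hg i') hm hanti hH hη4
    obtain ⟨J', hJ', h1, h2⟩ := mem_closure_iff_frequently.1 hJ |>.and_eventually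
      ((eventually_eq_lt J L).and (eventually_eq_lt J L')) |>.exists
    have d1 := hΛ.probDist_layers_le (hg i) hm hanti hL fun k hk => (h1 k hk).symm
    have d2 := hΛ.probDist_layers_le (hg i') hm hanti hL' h2
    calc probDist P (x i J) (x i' J)
        ≤ probDist P (x i J) (x i J') + (probDist P (x i J') (x i' J') +
            probDist P (x i' J') (x i' J)) :=
          (probDist_triangle (hxm i J) (hxm i J')).trans
            (add_le_add le_rfl (probDist_triangle (hxm i J') (hxm i' J')))
      _ ≤ 2 * (η / 4) + (ε + 2 * (η / 4)) := add_le_add d1 (add_le_add (hJ' i hi i' hi') d2)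
      _ = ε + 4 * (η / 4) := by ring
      _ = ε + η := by rw [ENNReal.mul_div_cancel (by norm_num) (by norm_num)]
  have hcover : ⋃ M, C M = Set.univ := by
    refine Set.eq_univ_of_forall fun J => Set.mem_iUnion.2 ?_
    obtain ⟨Z, hZ⟩ := hconv (layers H J) (measurableSet_layers hm J)
    have hZm : AEStronglyMeasurable Z P := hZ.aestronglyMeasurable fun i => hxm i J
    obtain ⟨M, hM⟩ := eventually_atTop.1 (ENNReal.tendsto_nhds_zero.1 (tendsto_probDist hZ) (ε / 2)
      (ENNReal.half_pos hε.ne'))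
    refine ⟨M, fun i hi i' hi' => ?_⟩
    refine (probDist_triangle (hxm i J) hZm).trans ?_
    rw [← ENNReal.add_halves ε, probDist_comm Z]
    exact add_le_add (hM i hi) (hM i' hi')
  obtain ⟨M, J₀, hJ₀⟩ := nonempty_interior_of_iUnion_of_closed hclosed hcover
  obtain ⟨L₁, hL₁⟩ := exists_cylinder_subset isOpen_interior hJ₀
  obtain ⟨L₂, hL₂⟩ := hΛ.exists_probDist_simpleInt_le hsp (hg M) hm hanti hH hε
  refine ⟨max L₁ L₂, fun L hL => ⟨M, fun i hi => ?_⟩⟩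
  -- Two members of the cylinder, with all and with none of the layers from `L` on: their unions of
  -- layers differ exactly by `H L`.
  set J₁ : ℕ → Bool := fun k => if k < L then J₀ k else true with hJ₁
  set J₂ : ℕ → Bool := fun k => if k < L then J₀ k else false with hJ₂
  have c1 : J₁ ∈ C M := interior_subset (hL₁ J₁ fun k hk => by
    have : k < L := lt_of_lt_of_le hk ((le_max_left _ _).trans hL)
    simp [hJ₁, this])
  have c2 : J₂ ∈ C M := interior_subset (hL₁ J₂ fun k hk => by
    have : k < L := lt_of_lt_of_le hk ((le_max_left _ _).trans hL)
    simp [hJ₂, this])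
  have hU : layers H J₁ = layers H J₂ ∪ H L := by
    ext p
    rw [Set.mem_union, mem_layers, mem_layers]
    constructor
    · rintro ⟨k, hk, h1, h2⟩
      rcases lt_or_ge k L with hkL | hkL
      · exact Or.inl ⟨k, by simpa [hJ₁, hJ₂, hkL] using hk, h1, h2⟩
      · exact Or.inr (hanti hkL h1)
    · rintro (⟨k, hk, h1, h2⟩ | hp)
      · have hkL : k < L := by
          by_contra hcon
          simp [hJ₂, hcon] at hk
        exact ⟨k, by simpa [hJ₁, hJ₂, hkL] using hk, h1, h2⟩
      · obtain ⟨k, hk, h1, h2⟩ := exists_layer hanti hH hp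
        exact ⟨k, by simp [hJ₁, not_lt.2 hk], h1, h2⟩
  have hdis : Disjoint (layers H J₂) (H L) := by
    refine Set.disjoint_left.2 fun p hp hpL => ?_
    obtain ⟨k, hk, h1, h2⟩ := mem_layers.1 hp
    have hkL : k < L := by
      by_contra hcon
      simp [hJ₂, hcon] at hk
    exact h2 (hanti (Nat.succ_le_of_lt hkL) hpL)
  have hadd : ∀ j, ∀ᵐ ω ∂P, x j J₁ ω = x j J₂ ω + simpleInt Λ (g j) (H L) ω := fun j => by
    have := hΛ.simpleInt_union_ae (hg j) (measurableSet_layers hm J₂) (hm L) hdis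
    rwa [← hU] at this
  have hHm : ∀ j, AEStronglyMeasurable (simpleInt Λ (g j) (H L)) P := fun j =>
    (hΛ.measurable_simpleInt (hg j) (hm L)).aestronglyMeasurable
  -- The Cauchy property at `J₁` and `J₂` compares `g i` with the fixed function `g M`, whose
  -- integral over `H L` is small by the choice of `L₂`.
  have hdist : probDist P (simpleInt Λ (g i) (H L)) (simpleInt Λ (g M) (H L)) ≤ ε + ε := by
    refine (probDist_le_add (hxm i J₁) (hxm M J₁) (X₂ := x M J₂) (Y₂ := x i J₂) ?_).trans
      (add_le_add (c1 i hi M le_rfl) (c2 M le_rfl i hi))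
    filter_upwards [hadd i, hadd M] with ω w1 w2
    rw [w1, w2]; abel
  calc probDist P (simpleInt Λ (g i) (H L)) 0
      ≤ probDist P (simpleInt Λ (g i) (H L)) (simpleInt Λ (g M) (H L)) +
          probDist P (simpleInt Λ (g M) (H L)) 0 := probDist_triangle (hHm i) (hHm M)
    _ ≤ (ε + ε) + ε := add_le_add hdist
        (hL₂ _ (hm L) (hanti ((le_max_right _ _).trans hL)))
    _ = 3 * ε := by ring

end nikodym

/-! ### Passing to the limit in the moment bound -/

section continuity
variable {n d : ℕ}

lemma continuous_msize : Continuous (msize : Matrix (Fin n) (Fin d) ℝ → ℝ) := by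
  unfold msize
  fun_prop

lemma continuous_qform (Q : Matrix (Fin d) (Fin d) ℝ) :
    Continuous (qform Q : Matrix (Fin n) (Fin d) ℝ → ℝ) := by
  unfold qform
  fun_prop

lemma continuous_mv_left (x : E d) :
    Continuous fun M : Matrix (Fin n) (Fin d) ℝ => mv M x := by
  unfold mv
  fun_prop

lemma IsSplit.continuous_jumpNorm {γ : E d} {Sig : Matrix (Fin d) (Fin d) ℝ} {ν : Measure (E d)}
    {β : E d} {K : Set (E d)} (h : IsSplit γ Sig ν β K) :
    Continuous (jumpNorm ν K : Matrix (Fin n) (Fin d) ℝ → ℝ) := by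
  rw [continuous_iff_continuousAt]
  intro M
  rw [ContinuousAt, tendsto_iff_dist_tendsto_zero]
  have h1 : Tendsto (fun N : Matrix (Fin n) (Fin d) ℝ => msize (N - M) * ∫ x in Kᶜ, ‖x‖ ∂ν) (𝓝 M)
      (𝓝 (msize (M - M) * ∫ x in Kᶜ, ‖x‖ ∂ν)) :=
    ((continuous_msize.comp (continuous_id.sub continuous_const)).mul continuous_const).tendsto M
  rw [sub_self, msize_zero, zero_mul] at h1
  exact squeeze_zero (fun _ => dist_nonneg) (fun N => h.abs_jumpNorm_sub_le N M) h1

end continuity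

section limit
variable {Ω S : Type*} [MeasurableSpace Ω] {P : Measure Ω} [IsProbabilityMeasure P]
  [MetricSpace S] [MeasurableSpace S] [BorelSpace S] {m n d : ℕ} {Λ : Set (S × E m) → Ω → E d}
  {γ : E d} {Sig : Matrix (Fin d) (Fin d) ℝ} {ν : Measure (E d)} {π : Measure S}
  [IsProbabilityMeasure π] {β : E d} {K : Set (E d)}

/-- Dominated convergence for the moment bound on a set of finite measure. -/
lemma IsSplit.tendsto_momentBound_of_bounded (hsp : IsSplit γ Sig ν β K)
    {Q : Matrix (Fin d) (Fin d) ℝ} {k : S × E m → Matrix (Fin n) (Fin d) ℝ}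
    {g : ℕ → SimpleFunc (S × E m) (Matrix (Fin n) (Fin d) ℝ)}
    (hg : ∀ i, Bornology.IsBounded (Function.support (g i)))
    (hlim : ∀ᵐ p ∂(π.prod (volume : Measure (E m))), Tendsto (fun i => g i p) atTop (𝓝 (k p)))
    {D : Set (S × E m)} (hD : (π.prod (volume : Measure (E m))) D < ∞) {B : ℝ}
    (hB : ∀ i, ∀ᵐ p ∂(π.prod (volume : Measure (E m))).restrict D, msize (g i p) ≤ B) :
    Tendsto (fun i => momentBound (π.prod volume) Q β ν K D (g i)) atTop
      (𝓝 (momentBound (π.prod volume) Q β ν K D k)) := by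
  have hl := ae_restrict_of_ae (s := D) hlim
  have hfin : IsFiniteMeasure ((π.prod (volume : Measure (E m))).restrict D) :=
    ⟨by simpa using hD⟩
  have hi := fun i => momentIntegrableOn_simpleFunc (π := π) (β := β) (ν := ν) (K := K) (hg i) Q D
  have hJ0 : 0 ≤ ∫ x in Kᶜ, ‖x‖ ∂ν := integral_nonneg fun _ => norm_nonneg _
  refine tendsto_momentBound ?_ ?_ ?_
  · refine tendsto_integral_of_dominated_convergence (fun _ => n * msize Q * B ^ 2)
      (fun i => (hi i).quad.aestronglyMeasurable) (integrable_const _) (fun i => ?_) ?_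
    · filter_upwards [hB i] with p hp
      refine (abs_qform_le Q (g i p)).trans ?_
      have := msize_nonneg Q
      have := msize_nonneg (g i p)
      gcongr
    · filter_upwards [hl] with p hp using ((continuous_qform Q).tendsto _).comp hp
  · refine tendsto_integral_of_dominated_convergence (fun _ => B * ‖β‖)
      (fun i => (hi i).mean.aestronglyMeasurable) (integrable_const _) (fun i => ?_) ?_
    · filter_upwards [hB i] with p hp
      refine (norm_mv_le _ _).trans ?_
      gcongr
    · filter_upwards [hl] with p hp using ((continuous_mv_left β).tendsto _).comp hp
  · refine tendsto_integral_of_dominated_convergence (fun _ => B * ∫ x in Kᶜ, ‖x‖ ∂ν)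
      (fun i => (hi i).jump.aestronglyMeasurable) (integrable_const _) (fun i => ?_) ?_
    · filter_upwards [hB i] with p hp
      rw [Real.norm_eq_abs, abs_of_nonneg (jumpNorm_nonneg _ _ _)]
      refine (hsp.jumpNorm_le _).trans ?_
      gcongr
    · filter_upwards [hl] with p hp using (hsp.continuous_jumpNorm.tendsto _).comp hp

/-- Sets of finite measure exhausting the space on which a convergent sequence of simple functions
is uniformly bounded. -/
lemma exists_exhaustion {k : S × E m → Matrix (Fin n) (Fin d) ℝ}
    {g : ℕ → SimpleFunc (S × E m) (Matrix (Fin n) (Fin d) ℝ)}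
    (hlim : ∀ᵐ p ∂(π.prod (volume : Measure (E m))), Tendsto (fun i => g i p) atTop (𝓝 (k p))) :
    ∃ G : ℕ → Set (S × E m), (∀ N, MeasurableSet (G N)) ∧ Monotone G ∧ (⋃ N, G N) = Set.univ ∧
      (∀ N, (π.prod (volume : Measure (E m))) (G N) < ∞) ∧
      ∀ (N : ℕ) (i : ℕ), ∀ᵐ p ∂(π.prod (volume : Measure (E m))).restrict (G N),
        msize (g i p) ≤ (N : ℝ) := by
  obtain ⟨s₀⟩ : Nonempty S := nonempty_of_isProbabilityMeasure π
  set p₀ : S × E m := (s₀, 0)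
  set F : ℕ → Set (S × E m) := fun N : ℕ =>
    Metric.closedBall p₀ (N : ℝ) ∩ ⋂ i, {p | msize (g i p) ≤ (N : ℝ)} with hF
  have hFm : ∀ N, MeasurableSet (F N) := fun N =>
    Metric.isClosed_closedBall.measurableSet.inter
      (MeasurableSet.iInter fun i => (g i).measurableSet_preimage {M | msize M ≤ N})
  have hFmono : Monotone F := by
    intro N N' h p hp
    have hc : (N : ℝ) ≤ N' := by exact_mod_cast h
    exact ⟨Metric.closedBall_subset_closedBall hc hp.1,
      Set.mem_iInter.2 fun i => le_trans (Set.mem_iInter.1 hp.2 i) hc⟩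
  have hnull : (π.prod (volume : Measure (E m))) (⋃ N, F N)ᶜ = 0 := by
    have : ∀ᵐ p ∂(π.prod (volume : Measure (E m))), p ∈ ⋃ N, F N := by
      filter_upwards [hlim] with p hp
      obtain ⟨b, hb⟩ := ((continuous_msize.tendsto _).comp hp).bddAbove_range
      obtain ⟨N, hN⟩ := exists_nat_ge (max b (dist p p₀))
      refine Set.mem_iUnion.2 ⟨N, Metric.mem_closedBall.2 ((le_max_right _ _).trans hN),
        Set.mem_iInter.2 fun i => ?_⟩
      exact (hb ⟨i, rfl⟩).trans ((le_max_left _ _).trans hN)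
    exact this
  -- The exceptional null set is added to every set, so that the union is the whole space exactly;
  -- the tail theorem needs a truly empty intersection.
  refine ⟨fun N => F N ∪ (⋃ N, F N)ᶜ, fun N => (hFm N).union (MeasurableSet.iUnion hFm).compl,
    fun N N' h => Set.union_subset_union_left _ (hFmono h), ?_, fun N => ?_, fun N i => ?_⟩
  · rw [← Set.iUnion_union, Set.union_compl_self]
  · refine (measure_union_le _ _).trans_lt ?_
    rw [hnull, add_zero]
    exact (measure_mono Set.inter_subset_left).trans_lt
      (measure_lt_top_of_isBounded Metric.isBounded_closedBall)
  · have hae : (π.prod (volume : Measure (E m))).restrict (F N ∪ (⋃ N, F N)ᶜ) =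
        (π.prod (volume : Measure (E m))).restrict (F N) :=
      Measure.restrict_congr_set (union_ae_eq_left_of_ae_eq_empty (ae_eq_empty.2 hnull))
    rw [hae]
    filter_upwards [ae_restrict_mem (hFm N)] with p hp
    exact Set.mem_iInter.1 hp.2 i

/-- The first moment bound for limits in probability of simple integrals. -/
theorem IsLevyBasis.lintegral_limit_le (hΛ : IsLevyBasis P Λ γ Sig ν π)
    (hsp : IsSplit γ Sig ν β K) {k : S × E m → Matrix (Fin n) (Fin d) ℝ}
    {g : ℕ → SimpleFunc (S × E m) (Matrix (Fin n) (Fin d) ℝ)}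
    (hg : ∀ i, Bornology.IsBounded (Function.support (g i)))
    (hlim : ∀ᵐ p ∂(π.prod (volume : Measure (E m))), Tendsto (fun i => g i p) atTop (𝓝 (k p)))
    (hconv : ∀ D, MeasurableSet D → ∃ Z : Ω → E n,
      TendstoInMeasure P (fun i => simpleInt Λ (g i) D) atTop Z)
    {D : Set (S × E m)} (hD : MeasurableSet D)
    (hk : MomentIntegrableOn (π.prod volume) (Sig + secondMoment ν K) β ν K D k) {Z : Ω → E n}
    (hZ : TendstoInMeasure P (fun i => simpleInt Λ (g i) D) atTop Z) :
    ∫⁻ ω, ‖Z ω‖ₑ ∂P ≤ ENNReal.ofReal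
      (momentBound (π.prod volume) (Sig + secondMoment ν K) β ν K D k) := by
  obtain ⟨G, hGm, hGmono, hGU, hGfin, hGb⟩ := exists_exhaustion (π := π) hlim
  have hDG : ∀ N, MeasurableSet (D ∩ G N) := fun N => hD.inter (hGm N)
  choose W hW using fun N => hconv (D ∩ G N) (hDG N)
  have hmeas : ∀ i D', MeasurableSet D' → AEStronglyMeasurable (simpleInt Λ (g i) D') P :=
    fun i D' h => (hΛ.measurable_simpleInt (hg i) h).aestronglyMeasurable
  have hWm : ∀ N, AEStronglyMeasurable (W N) P := fun N =>
    (hW N).aestronglyMeasurable fun i => hmeas i _ (hDG N)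
  have hZm : AEStronglyMeasurable Z P := hZ.aestronglyMeasurable fun i => hmeas i _ hD
  have hWb : ∀ N, ∫⁻ ω, ‖W N ω‖ₑ ∂P ≤ ENNReal.ofReal
      (momentBound (π.prod volume) (Sig + secondMoment ν K) β ν K (D ∩ G N) k) := fun N => by
    refine lintegral_enorm_le_of_tendstoInMeasure (fun i => hmeas i _ (hDG N)) (hW N)
      (fun i => hΛ.lintegral_simpleInt_le hsp (hg i) (hDG N)) ?_
    refine hsp.tendsto_momentBound_of_bounded hg hlim
      ((measure_mono Set.inter_subset_right).trans_lt (hGfin N)) (B := N) fun i => ?_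
    exact ae_restrict_of_ae_restrict_of_subset Set.inter_subset_right (hGb N i)
  -- For fixed N, an index i is chosen so large that both limits are nearly attained and the
  -- integral of `g i` over `D \ G N` is small.
  have hWZ : TendstoInMeasure P W atTop Z := by
    refine tendstoInMeasure_of_probDist hWm hZm (ENNReal.tendsto_nhds_zero.2 fun ε hε => ?_)
    have hε4 : 0 < ε / 4 := ENNReal.div_pos hε.ne' (by norm_num)
    have hε12 : 0 < ε / 4 / 3 := ENNReal.div_pos hε4.ne' (by norm_num)
    obtain ⟨L₀, hL₀⟩ := hΛ.exists_uniform_tail hsp hg hconv (H := fun N => D \ G N)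
      (fun N => hD.diff (hGm N)) (fun N N' h => Set.sdiff_subset_sdiff_right (hGmono h)) (by
        rw [← Set.sdiff_iUnion, hGU, Set.sdiff_univ]) hε12
    filter_upwards [eventually_ge_atTop L₀] with N hN
    obtain ⟨M, hM⟩ := hL₀ N hN
    have e1 := ENNReal.tendsto_nhds_zero.1 (tendsto_probDist (hW N)) _ hε4
    have e2 := ENNReal.tendsto_nhds_zero.1 (tendsto_probDist hZ) _ hε4
    obtain ⟨i, hi1, hi2, hi3⟩ := (e1.and (e2.and (eventually_ge_atTop M))).exists
    have hmid : probDist P (simpleInt Λ (g i) (D ∩ G N)) (simpleInt Λ (g i) D) ≤ ε / 4 := by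
      have hadd := hΛ.simpleInt_union_ae (hg i) (hDG N) (hD.diff (hGm N))
        (Set.disjoint_sdiff_right.mono_left Set.inter_subset_right)
      rw [Set.inter_union_sdiff] at hadd
      have hz : AEStronglyMeasurable (0 : Ω → E n) P := aestronglyMeasurable_zero
      have h3 := probDist_le_add (P := P) (X := simpleInt Λ (g i) (D ∩ G N))
        (Y := simpleInt Λ (g i) D) (X₁ := 0) (Y₁ := simpleInt Λ (g i) (D \ G N)) (X₂ := (0 : Ω → E n))
        (Y₂ := 0) hz (hmeas i _ (hD.diff (hGm N))) (by
          filter_upwards [hadd] with ω hω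
          rw [hω]; simp)
      have h4 : probDist P (0 : Ω → E n) 0 = 0 := by simp [probDist]
      rw [h4, add_zero, probDist_comm 0] at h3
      refine h3.trans ((hM i hi3).trans ?_)
      rw [ENNReal.mul_div_cancel (by norm_num) (by norm_num)]
    calc probDist P (W N) Z
        ≤ probDist P (W N) (simpleInt Λ (g i) (D ∩ G N)) +
          (probDist P (simpleInt Λ (g i) (D ∩ G N)) (simpleInt Λ (g i) D) +
            probDist P (simpleInt Λ (g i) D) Z) :=
          (probDist_triangle (hWm N) (hmeas i _ (hDG N))).trans
            (add_le_add le_rfl (probDist_triangle (hmeas i _ (hDG N)) (hmeas i _ hD)))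
      _ ≤ ε / 4 + (ε / 4 + ε / 4) := by
          rw [probDist_comm]
          exact add_le_add hi1 (add_le_add hmid hi2)
      _ ≤ ε / 4 + (ε / 4 + ε / 4) + ε / 4 := le_self_add
      _ = 4 * (ε / 4) := by ring
      _ = ε := ENNReal.mul_div_cancel (by norm_num) (by norm_num)
  -- The second limit, in N, concerns the kernel `k` itself, whose three integrands are integrable
  -- on `D`.
  refine lintegral_enorm_le_of_tendstoInMeasure hWm hWZ hWb ?_
  have hU : ⋃ N, D ∩ G N = D := by rw [← Set.inter_iUnion, hGU, Set.inter_univ]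
  have := MomentIntegrableOn.tendsto_of_monotone (D := fun N => D ∩ G N) hDG
    (fun N N' h => Set.inter_subset_inter_right _ (hGmono h)) (by rw [hU]; exact hk)
  rwa [hU] at this

end limit

/-! ### Admissible kernels and existence of the integral -/

section admissible
variable {T : Type*} [MeasurableSpace T] {n d : ℕ}

lemma stronglyMeasurable_comp_matrix {F : Type*} [TopologicalSpace F]
    {k : T → Matrix (Fin n) (Fin d) ℝ} (hk : ∀ i j, Measurable fun p => k p i j)
    {φ : Matrix (Fin n) (Fin d) ℝ → F} (hφ : Continuous φ) :
    StronglyMeasurable fun p => φ (k p) := by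
  have h1 : Measurable fun p => (fun i j => k p i j : Fin n → Fin d → ℝ) :=
    measurable_pi_lambda _ fun i => measurable_pi_lambda _ fun j => hk i j
  have h2 : Continuous fun v : Fin n → Fin d → ℝ => φ (Matrix.of v) :=
    hφ.comp (continuous_matrix fun i j => (continuous_apply j).comp (continuous_apply i))
  exact h2.comp_stronglyMeasurable h1.stronglyMeasurable

/-- Measurability and the integrability that suffices for a finite moment bound. -/
structure IsAdmissible (ctrl : Measure T) (Q : Matrix (Fin d) (Fin d) ℝ) (β : E d) (K : Set (E d))
    (k : T → Matrix (Fin n) (Fin d) ℝ) : Prop where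
  meas : ∀ i j, Measurable fun p => k p i j
  sq : Q = 0 ∨ Integrable (fun p => msize (k p) ^ 2) ctrl
  one : (β = 0 ∧ K = Set.univ) ∨ Integrable (fun p => msize (k p)) ctrl

variable {ctrl : Measure T} {γ : E d} {Sig Q : Matrix (Fin d) (Fin d) ℝ} {β : E d}
  {ν : Measure (E d)} {K : Set (E d)} {k k' : T → Matrix (Fin n) (Fin d) ℝ}

/-- Dominated convergence in each of the three integrals. Where integrability of the dominating
function is not available, the term vanishes identically: `Q = 0` in the first, `β = 0` and `Kᶜ = ∅`
in the others. -/
lemma tendsto_momentBound_zero (hsp : IsSplit γ Sig ν β K) (hk : IsAdmissible ctrl Q β K k)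
    {ι : Type*} {l : Filter ι} [l.IsCountablyGenerated] {g : ι → T → Matrix (Fin n) (Fin d) ℝ}
    (hg : ∀ a i j, Measurable fun p => g a p i j) {C : ℝ}
    (hle : ∀ a p, msize (g a p) ≤ C * msize (k p))
    (hlim : ∀ᵐ p ∂ctrl, Tendsto (fun a => msize (g a p)) l (𝓝 0)) (D : Set T) :
    Tendsto (fun a => momentBound ctrl Q β ν K D (g a)) l (𝓝 0) := by
  have hlD := ae_restrict_of_ae (s := D) hlim
  have h1 : Tendsto (fun a => ∫ p in D, qform Q (g a p) ∂ctrl) l (𝓝 0) := by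
    rcases hk.sq with rfl | hsq
    · simpa [qform_zero_left] using tendsto_const_nhds (x := (0 : ℝ))
    · rw [← integral_zero T ℝ (μ := ctrl.restrict D)]
      refine tendsto_integral_filter_of_dominated_convergence
        (fun p => n * msize Q * (C ^ 2 * msize (k p) ^ 2))
        (Eventually.of_forall fun a =>
          (stronglyMeasurable_comp_matrix (hg a) (continuous_qform Q)).aestronglyMeasurable)
        (Eventually.of_forall fun a => Eventually.of_forall fun p => ?_)
        ((hsq.integrableOn.const_mul _).const_mul _) ?_
      · refine (abs_qform_le Q _).trans ?_
        rw [← mul_pow]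
        have := msize_nonneg Q
        have := msize_nonneg (g a p)
        have := hle a p
        gcongr
      · filter_upwards [hlD] with p hp
        refine squeeze_zero_norm (fun a => abs_qform_le Q (g a p)) ?_
        simpa using (hp.pow 2).const_mul ((n : ℝ) * msize Q)
  have h2 : Tendsto (fun a => ∫ p in D, mv (g a p) β ∂ctrl) l (𝓝 0) := by
    rcases hk.one with ⟨rfl, rfl⟩ | hone
    · simpa [mv_zero] using tendsto_const_nhds (x := (0 : E n))
    · rw [← integral_zero T (E n) (μ := ctrl.restrict D)]
      refine tendsto_integral_filter_of_dominated_convergence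
        (fun p => C * msize (k p) * ‖β‖)
        (Eventually.of_forall fun a =>
          (stronglyMeasurable_comp_matrix (hg a) (continuous_mv_left β)).aestronglyMeasurable)
        (Eventually.of_forall fun a => Eventually.of_forall fun p => ?_)
        ((hone.integrableOn.const_mul _).mul_const _) ?_
      · refine (norm_mv_le _ _).trans ?_
        have := hle a p
        gcongr
      · filter_upwards [hlD] with p hp
        refine squeeze_zero_norm (fun a => norm_mv_le (g a p) β) ?_
        simpa using hp.mul_const ‖β‖
  have h3 : Tendsto (fun a => ∫ p in D, jumpNorm ν K (g a p) ∂ctrl) l (𝓝 0) := by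
    rcases hk.one with ⟨rfl, rfl⟩ | hone
    · simpa [jumpNorm] using tendsto_const_nhds (x := (0 : ℝ))
    · have hJ0 : 0 ≤ ∫ x in Kᶜ, ‖x‖ ∂ν := integral_nonneg fun _ => norm_nonneg _
      have hJ : ∀ M : Matrix (Fin n) (Fin d) ℝ, ‖jumpNorm ν K M‖ ≤ msize M * ∫ x in Kᶜ, ‖x‖ ∂ν :=
        fun M => by
          rw [Real.norm_of_nonneg (jumpNorm_nonneg _ _ _)]
          exact hsp.jumpNorm_le M
      rw [← integral_zero T ℝ (μ := ctrl.restrict D)]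
      refine tendsto_integral_filter_of_dominated_convergence
        (fun p => C * msize (k p) * ∫ x in Kᶜ, ‖x‖ ∂ν)
        (Eventually.of_forall fun a =>
          (stronglyMeasurable_comp_matrix (hg a) hsp.continuous_jumpNorm).aestronglyMeasurable)
        (Eventually.of_forall fun a => Eventually.of_forall fun p => ?_)
        ((hone.integrableOn.const_mul _).mul_const _) ?_
      · refine (hJ _).trans ?_
        have := hle a p
        gcongr
      · filter_upwards [hlD] with p hp
        refine squeeze_zero_norm (fun a => hJ (g a p)) ?_
        simpa using hp.mul_const (∫ x in Kᶜ, ‖x‖ ∂ν)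
  have := ((h1.add (h2.norm.pow 2)).sqrt).add h3
  simpa [momentBound] using this

lemma IsAdmissible.momentIntegrableOn (hsp : IsSplit γ Sig ν β K)
    (hk : IsAdmissible ctrl Q β K k) (D : Set T) : MomentIntegrableOn ctrl Q β ν K D k where
  quad := by
    rcases hk.sq with rfl | hsq
    · simp [qform_zero_left]
    · refine Integrable.integrableOn (Integrable.mono' (hsq.const_mul (n * msize Q))
        (stronglyMeasurable_comp_matrix hk.meas (continuous_qform Q)).aestronglyMeasurable
        (Eventually.of_forall fun p => abs_qform_le Q (k p)))
  mean := by
    rcases hk.one with ⟨rfl, rfl⟩ | hone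
    · simp [mv_zero]
    · exact Integrable.integrableOn (Integrable.mono' (hone.mul_const ‖β‖)
        (stronglyMeasurable_comp_matrix hk.meas (continuous_mv_left β)).aestronglyMeasurable
        (Eventually.of_forall fun p => norm_mv_le (k p) β))
  jump := by
    rcases hk.one with ⟨rfl, rfl⟩ | hone
    · simp [jumpNorm]
    · refine Integrable.integrableOn (Integrable.mono' (hone.mul_const (∫ x in Kᶜ, ‖x‖ ∂ν))
        (stronglyMeasurable_comp_matrix hk.meas hsp.continuous_jumpNorm).aestronglyMeasurable
        (Eventually.of_forall fun p => ?_))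
      rw [Real.norm_of_nonneg (jumpNorm_nonneg _ _ _)]
      exact hsp.jumpNorm_le _

end admissible

lemma msize_add_le {n d : ℕ} (M N : Matrix (Fin n) (Fin d) ℝ) :
    msize (M - N) ≤ msize M + msize N := by
  unfold msize
  rw [← Finset.sum_add_distrib]
  refine Finset.sum_le_sum fun i _ => ?_
  rw [← Finset.sum_add_distrib]
  exact Finset.sum_le_sum fun j _ => abs_sub _ _

lemma msize_le_norm {n d : ℕ} (v : Fin n → Fin d → ℝ) :
    msize (Matrix.of v) ≤ (n * d : ℝ) * ‖v‖ := by
  have h : ∀ i j, |Matrix.of v i j| ≤ ‖v‖ := fun i j =>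
    (norm_le_pi_norm (v i) j).trans (norm_le_pi_norm v i)
  calc msize (Matrix.of v) ≤ ∑ _i : Fin n, ∑ _j : Fin d, ‖v‖ :=
        Finset.sum_le_sum fun i _ => Finset.sum_le_sum fun j _ => h i j
    _ = (n * d : ℝ) * ‖v‖ := by simp [mul_assoc]

lemma norm_le_msize {n d : ℕ} (M : Matrix (Fin n) (Fin d) ℝ) :
    ‖(fun i j => M i j : Fin n → Fin d → ℝ)‖ ≤ msize M :=
  (pi_norm_le_iff_of_nonneg (msize_nonneg M)).2 fun i =>
    (pi_norm_le_iff_of_nonneg (msize_nonneg M)).2 fun j => abs_le_msize M i j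

/-- Simple functions of bounded support converging to a measurable kernel, dominated by it. -/
lemma exists_simpleFunc_tendsto {T : Type*} [PseudoMetricSpace T] [MeasurableSpace T]
    [OpensMeasurableSpace T] (p₀ : T) {n d : ℕ} {k : T → Matrix (Fin n) (Fin d) ℝ}
    (hk : ∀ i j, Measurable fun p => k p i j) :
    ∃ g : ℕ → SimpleFunc T (Matrix (Fin n) (Fin d) ℝ),
      (∀ a, Bornology.IsBounded (Function.support (g a))) ∧
      (∀ p, Tendsto (fun a => g a p) atTop (𝓝 (k p))) ∧
      ∀ a p, msize (g a p) ≤ (n * d : ℝ) * 2 * msize (k p) := by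
  set κ : T → Fin n → Fin d → ℝ := fun p i j => k p i j with hκ
  have hκm : Measurable κ :=
    measurable_pi_lambda _ fun i => measurable_pi_lambda _ fun j => hk i j
  have hball : ∀ a : ℕ, MeasurableSet (Metric.ball p₀ (a : ℝ)) := fun a =>
    Metric.isOpen_ball.measurableSet
  -- The balls make the supports bounded. `approxOn` based at 0 is bounded by twice the function in
  -- the maximum norm; the factor `n * d` passes from that norm to `msize`.
  set g₀ : ℕ → SimpleFunc T (Fin n → Fin d → ℝ) := fun a =>
    (SimpleFunc.approxOn κ hκm Set.univ 0 (Set.mem_univ _) a).restrict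
      (Metric.ball p₀ (a : ℝ)) with hg₀
  refine ⟨fun a => (g₀ a).map Matrix.of, fun a => ?_, fun p => ?_, fun a p => ?_⟩
  · refine (Metric.isBounded_ball (x := p₀) (r := (a : ℝ))).subset fun p hp => ?_
    by_contra hpb
    refine hp ?_
    simp only [SimpleFunc.map_apply, hg₀, SimpleFunc.restrict_apply _ (hball a),
      Set.indicator_of_notMem hpb]
    rfl
  · have h1 : Tendsto (fun a => SimpleFunc.approxOn κ hκm Set.univ 0 (Set.mem_univ _) a p) atTop
        (𝓝 (κ p)) := SimpleFunc.tendsto_approxOn hκm (Set.mem_univ (0 : Fin n → Fin d → ℝ)) (by simp)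
    have hc : Continuous (fun v : Fin n → Fin d → ℝ => Matrix.of v) :=
      continuous_matrix fun i j => (continuous_apply j).comp (continuous_apply i)
    refine ((hc.tendsto _).comp h1).congr' ?_
    obtain ⟨N, hN⟩ := exists_nat_gt (dist p p₀)
    filter_upwards [eventually_ge_atTop N] with a ha
    have hpb : p ∈ Metric.ball p₀ (a : ℝ) :=
      Metric.mem_ball.2 (hN.trans_le (by exact_mod_cast ha))
    simp only [SimpleFunc.map_apply, hg₀, SimpleFunc.restrict_apply _ (hball a),
      Set.indicator_of_mem hpb, Function.comp_apply]
  · rw [SimpleFunc.map_apply]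
    have h2 := SimpleFunc.norm_approxOn_zero_le hκm (s := Set.univ) (Set.mem_univ _) p a
    have h3 : ‖g₀ a p‖ ≤ ‖κ p‖ + ‖κ p‖ := by
      rw [hg₀, SimpleFunc.restrict_apply _ (hball a)]
      exact (norm_indicator_le_norm_self _ _).trans h2
    have h4 : ‖g₀ a p‖ ≤ 2 * msize (k p) := by
      have := norm_le_msize (k p)
      linarith
    have h5 : (0 : ℝ) ≤ n * d := by positivity
    exact (msize_le_norm _).trans ((mul_le_mul_of_nonneg_left h4 h5).trans_eq
      (mul_assoc _ _ _).symm)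

/-- A sequence that is Cauchy in mean converges in probability. -/
lemma exists_tendstoInMeasure_of_cauchy {Ω F : Type*} [MeasurableSpace Ω] {P : Measure Ω}
    [NormedAddCommGroup F] [CompleteSpace F] {X : ℕ → Ω → F}
    (hX : ∀ i, Integrable (X i) P)
    (h : Tendsto (fun ab : ℕ × ℕ => ∫⁻ ω, ‖X ab.1 ω - X ab.2 ω‖ₑ ∂P) atTop (𝓝 0)) :
    ∃ Z : Ω → F, TendstoInMeasure P X atTop Z := by
  have hm : ∀ i, MemLp (X i) 1 P := fun i => memLp_one_iff_integrable.2 (hX i)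
  have hf1 : Fact ((1 : ℝ≥0∞) ≤ 1) := ⟨le_rfl⟩
  have hc : CauchySeq fun i => (hm i).toLp (X i) := by
    rw [Lp.cauchySeq_Lp_iff_cauchySeq_eLpNorm]
    refine h.congr fun ab => ?_
    rw [eLpNorm_congr_ae ((hm ab.1).coeFn_toLp.sub (hm ab.2).coeFn_toLp),
      eLpNorm_one_eq_lintegral_enorm]
    rfl
  obtain ⟨Z, hZ⟩ := cauchySeq_tendsto_of_complete hc
  refine ⟨Z, ?_⟩
  refine (tendstoInMeasure_of_tendsto_Lp hZ).congr (fun i => (hm i).coeFn_toLp) ae_eq_rfl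

section existence
variable {Ω S : Type*} [MeasurableSpace Ω] {P : Measure Ω} [IsProbabilityMeasure P]
  [MetricSpace S] [MeasurableSpace S] [BorelSpace S] {m n d : ℕ}
  {Λ : Set (S × E m) → Ω → E d}
  {γ : E d} {Sig : Matrix (Fin d) (Fin d) ℝ} {ν : Measure (E d)} {π : Measure S}
  [IsProbabilityMeasure π] {β : E d} {K : Set (E d)}

/-- The approximations are dominated by the kernel, so the moment bounds of their differences tend
to 0 and the integrals over each `D` are Cauchy in mean. -/
theorem IsLevyBasis.isLevyIntegrable (hΛ : IsLevyBasis P Λ γ Sig ν π)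
    (hsp : IsSplit γ Sig ν β K) {k : S × E m → Matrix (Fin n) (Fin d) ℝ}
    (hk : IsAdmissible (π.prod volume) (Sig + secondMoment ν K) β K k) :
    IsLevyIntegrable P Λ (π.prod volume) k := by
  obtain ⟨s₀⟩ : Nonempty S := nonempty_of_isProbabilityMeasure π
  obtain ⟨g, hgb, hgl, hgd⟩ := exists_simpleFunc_tendsto ((s₀, 0) : S × E m) hk.meas
  have hconv : ∀ D, MeasurableSet D → ∃ Z : Ω → E n,
      TendstoInMeasure P (fun i => simpleInt Λ (g i) D) atTop Z := by
    intro D hD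
    refine exists_tendstoInMeasure_of_cauchy (fun i => ⟨(hΛ.measurable_simpleInt (hgb i)
      hD).aestronglyMeasurable, (hΛ.lintegral_simpleInt_le hsp (hgb i) hD).trans_lt
        ENNReal.ofReal_lt_top⟩) ?_
    have hmb : Tendsto (fun ab : ℕ × ℕ => momentBound (π.prod volume) (Sig + secondMoment ν K)
        β ν K D (g ab.1 - g ab.2 : SimpleFunc (S × E m) (Matrix (Fin n) (Fin d) ℝ)))
        atTop (𝓝 0) := by
      rw [← prod_atTop_atTop_eq]
      refine tendsto_momentBound_zero hsp hk (C := 2 * ((n * d : ℝ) * 2)) (fun ab i j => ?_)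
        (fun ab p => ?_) (Eventually.of_forall fun p => ?_) D
      · exact ((g ab.1 - g ab.2).map fun M => M i j).measurable
      · rw [SimpleFunc.coe_sub, Pi.sub_apply]
        have h1 := hgd ab.1 p
        have h2 := hgd ab.2 p
        have h3 := msize_add_le (g ab.1 p) (g ab.2 p)
        linarith
      · have h1 := ((hgl p).comp tendsto_fst).sub ((hgl p).comp (tendsto_snd (f := atTop (α := ℕ))))
        rw [sub_self] at h1
        have h2 := (continuous_msize.tendsto (0 : Matrix (Fin n) (Fin d) ℝ)).comp h1
        rw [msize_zero] at h2
        exact h2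
    have hmb' := ENNReal.tendsto_ofReal hmb
    rw [ENNReal.ofReal_zero] at hmb'
    refine tendsto_of_tendsto_of_tendsto_of_le_of_le tendsto_const_nhds hmb' (fun _ => zero_le)
      fun ab => ?_
    have hs := hΛ.simpleInt_sub_ae (hgb ab.1) (hgb ab.2) hD
    have hb : Bornology.IsBounded (Function.support (g ab.1 - g ab.2)) :=
      ((hgb ab.1).union (hgb ab.2)).subset (Function.support_sub _ _)
    refine le_trans (le_of_eq (lintegral_congr_ae ?_)) (hΛ.lintegral_simpleInt_le hsp hb hD)
    filter_upwards [hs] with ω hω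
    rw [hω]
  obtain ⟨Y, hY⟩ := hconv Set.univ MeasurableSet.univ
  exact ⟨Y, g, hgb, Eventually.of_forall hgl, hconv, hY⟩

end existence

/-! ### The covariance inequality -/

section covariance
variable {Ω : Type*} [MeasurableSpace Ω] {P : Measure Ω} [IsProbabilityMeasure P]

lemma edist_le_lipConst_mul {n : ℕ} (G : E n → ℝ) (x y : E n) :
    edist (G x) (G y) ≤ lipConst G * edist x y := by
  rcases eq_or_ne x y with rfl | hxy
  · simp
  · rw [← ENNReal.div_le_iff (edist_pos.2 hxy).ne' (edist_ne_top x y)]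
    exact le_iSup₂_of_le x y (le_iSup_of_le hxy le_rfl)

/-- Covariance bound: only the part of `Y` that is not independent of `ξ` contributes. -/
lemma abs_covariance_le {n : ℕ} {T : Type*} [MeasurableSpace T] {ξ : Ω → T} {Y Y' Z : Ω → E n}
    (hξ : Measurable ξ) (hY : AEMeasurable Y P) (hY' : AEMeasurable Y' P)
    (hsum : ∀ᵐ ω ∂P, Y ω = Y' ω + Z ω)
    (hind : IndepFun ξ Y' P) {F : T → ℝ} (hF : Measurable F) {C : ℝ} (hC : ∀ x, |F x| ≤ C)
    {G : E n → ℝ} (hG : Continuous G) {C' : ℝ} (hC' : ∀ x, |G x| ≤ C') :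
    ENNReal.ofReal |covariance (fun ω => F (ξ ω)) (fun ω => G (Y ω)) P| ≤
      2 * (∫⁻ ω, ‖Z ω‖ₑ ∂P) * (supNorm F * lipConst G) := by
  have hZ : AEMeasurable Z P := (hY.sub hY').congr (by
    filter_upwards [hsum] with ω hω
    simp [hω])
  have hA : MemLp (fun ω => F (ξ ω)) 2 P :=
    MemLp.of_bound (hF.comp hξ).aestronglyMeasurable C (Eventually.of_forall fun ω => hC _)
  have hB₁ : MemLp (fun ω => G (Y ω)) 2 P :=
    MemLp.of_bound (hG.comp_aestronglyMeasurable hY.aestronglyMeasurable) C'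
      (Eventually.of_forall fun ω => hC' _)
  have hB₂ : MemLp (fun ω => G (Y' ω)) 2 P :=
    MemLp.of_bound (hG.comp_aestronglyMeasurable hY'.aestronglyMeasurable) C'
      (Eventually.of_forall fun ω => hC' _)
  -- By independence G(Y) may be replaced by the increment G(Y) - G(Y'), which is at most Lip(G)‖Z‖.
  have h0 : covariance (fun ω => F (ξ ω)) (fun ω => G (Y' ω)) P = 0 :=
    (hind.comp hF hG.measurable).covariance_eq_zero hA hB₂
  have h1 : covariance (fun ω => F (ξ ω)) (fun ω => G (Y ω)) P =
      covariance (fun ω => F (ξ ω)) ((fun ω => G (Y ω)) - fun ω => G (Y' ω)) P := by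
    rw [covariance_sub_right hA hB₁ hB₂, h0, sub_zero]
  rw [h1, covariance_eq_sub hA (hB₁.sub hB₂), ← Real.enorm_eq_ofReal_abs]
  have hFs : ∀ ω, ‖F (ξ ω)‖ₑ ≤ supNorm F := fun ω => le_iSup (fun x => ‖F x‖ₑ) (ξ ω)
  have hD : ∫⁻ ω, ‖((fun ω => G (Y ω)) - fun ω => G (Y' ω)) ω‖ₑ ∂P ≤
      lipConst G * ∫⁻ ω, ‖Z ω‖ₑ ∂P := by
    rw [← lintegral_const_mul'' _ hZ.enorm]
    refine lintegral_mono_ae ?_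
    filter_upwards [hsum] with ω hω
    rw [Pi.sub_apply, ← edist_eq_enorm_sub]
    refine (edist_le_lipConst_mul G _ _).trans_eq ?_
    rw [edist_eq_enorm_sub, hω, add_sub_cancel_left]
  have e1 : ‖∫ ω, ((fun ω => F (ξ ω)) * ((fun ω => G (Y ω)) - fun ω => G (Y' ω))) ω ∂P‖ₑ ≤
      supNorm F * (lipConst G * ∫⁻ ω, ‖Z ω‖ₑ ∂P) := by
    refine (enorm_integral_le_lintegral_enorm _).trans ?_
    refine le_trans ?_ (mul_le_mul' le_rfl hD)
    rw [← lintegral_const_mul'' _ (hB₁.sub hB₂).aestronglyMeasurable.enorm]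
    refine lintegral_mono fun ω => ?_
    rw [Pi.mul_apply, enorm_mul]
    exact mul_le_mul' (hFs ω) le_rfl
  have e2 : ‖∫ ω, F (ξ ω) ∂P‖ₑ ≤ supNorm F := by
    refine (enorm_integral_le_lintegral_enorm _).trans ((lintegral_mono hFs).trans_eq ?_)
    simp
  have e3 : ‖∫ ω, ((fun ω => G (Y ω)) - fun ω => G (Y' ω)) ω ∂P‖ₑ ≤
      lipConst G * ∫⁻ ω, ‖Z ω‖ₑ ∂P := (enorm_integral_le_lintegral_enorm _).trans hD
  -- The factor 2: the mean of the product and the product of the means satisfy the same bound.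
  refine (enorm_sub_le).trans ((add_le_add e1 ((enorm_mul _ _).le.trans
    (mul_le_mul' e2 e3))).trans_eq ?_)
  ring

end covariance

/-! ### Geometry of the cone and of the truncated region -/

section geometry
variable {m : ℕ} {A₀ : Set (E m)} {α : E m}

lemma bddAbove_cone (A₀ : Set (E m)) (α : E m) :
    BddAbove ((fun x => inner ℝ α x / ‖x‖) '' (A₀ \ {0})) := by
  refine ⟨‖α‖, ?_⟩
  rintro _ ⟨x, hx, rfl⟩
  have hx0 : 0 < ‖x‖ := norm_pos_iff.2 hx.2
  exact (div_le_iff₀ hx0).2 (real_inner_le_norm α x)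

lemma ScalarProductCond.nonempty (h : ScalarProductCond A₀ α) : (A₀ \ {0}).Nonempty := by
  by_contra hne
  rw [Set.not_nonempty_iff_eq_empty] at hne
  have := h.2
  rw [hne, Set.image_empty, Real.sSup_empty] at this
  exact lt_irrefl _ this

lemma ScalarProductCond.bConst_neg (h : ScalarProductCond A₀ α) : bConst A₀ α < 0 := by
  have hα : 0 < ‖α‖ := norm_pos_iff.2 h.1
  refine lt_of_le_of_lt (csSup_le (h.nonempty.image _) ?_) (div_neg_of_neg_of_pos h.2 hα)
  rintro _ ⟨x, hx, rfl⟩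
  have := le_csSup (bddAbove_cone A₀ α) ⟨x, hx, rfl⟩
  simp only at this ⊢
  rw [mul_comm, ← div_div]
  gcongr

lemma ScalarProductCond.inner_le (h : ScalarProductCond A₀ α) {x : E m} (hx : x ∈ A₀) :
    inner ℝ α x ≤ bConst A₀ α * (‖α‖ * ‖x‖) := by
  have hα : 0 < ‖α‖ := norm_pos_iff.2 h.1
  rcases eq_or_ne x 0 with rfl | hx0
  · simp
  · have hpos : 0 < ‖α‖ * ‖x‖ := mul_pos hα (norm_pos_iff.2 hx0)
    rw [← div_le_iff₀ hpos]
    refine le_csSup ⟨1, ?_⟩ ⟨x, ⟨hx, hx0⟩, rfl⟩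
    rintro _ ⟨y, hy, rfl⟩
    exact div_le_one_of_le₀ (real_inner_le_norm α y) (by positivity)

lemma ScalarProductCond.neg_one_le_bConst (h : ScalarProductCond A₀ α) : -1 ≤ bConst A₀ α := by
  obtain ⟨x, hx⟩ := h.nonempty
  have hα : 0 < ‖α‖ := norm_pos_iff.2 h.1
  have hpos : 0 < ‖α‖ * ‖x‖ := mul_pos hα (norm_pos_iff.2 hx.2)
  have h1 := h.inner_le hx.1
  have h2 : -(‖α‖ * ‖x‖) ≤ inner ℝ α x := (abs_le.1 (abs_real_inner_le_norm α x)).1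
  nlinarith

/-- The isometry preserves inner products and sends α to `‖α‖ e₁`, so the inner product with α
becomes `‖α‖` times the first coordinate. -/
lemma ScalarProductCond.coord_le [NeZero m] (h : ScalarProductCond A₀ α) {O : E m ≃ₗᵢ[ℝ] E m}
    (hO : O α = ‖α‖ • EuclideanSpace.single (0 : Fin m) (1 : ℝ)) {y : E m} (hy : y ∈ O '' A₀) :
    y 0 ≤ bConst A₀ α * ‖y‖ := by
  obtain ⟨x, hx, rfl⟩ := hy
  have hα : 0 < ‖α‖ := norm_pos_iff.2 h.1
  have h1 := h.inner_le hx
  rw [← O.inner_map_map, hO, real_inner_smul_left, EuclideanSpace.inner_single_left] at h1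
  simp only [map_one, one_mul] at h1
  rw [O.norm_map]
  refine le_of_mul_le_mul_left (h1.trans_eq ?_) hα
  ring

/-- Two points of a cone with apex direction `-e₁` whose difference is lexicographically
non-positive and large: the first one is large. -/
lemma le_norm_of_mem_cone [NeZero m] {c h : ℝ} (hc : 0 ≤ c) (hc1 : c ≤ 1) (hh : 0 < h) {y w : E m}
    (hz : (y - w) 0 ≤ -c * ‖y - w‖) (hw0 : w 0 ≤ 0)
    (hw : h ≤ ‖WithLp.ofLp w‖) : c * h / Real.sqrt m ≤ ‖WithLp.ofLp y‖ := by
  have hm : 1 ≤ m := NeZero.one_le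
  have hsm : (1 : ℝ) ≤ Real.sqrt m := Real.one_le_sqrt.2 (by exact_mod_cast hm)
  have hcoord : ∀ q, |y q| ≤ ‖WithLp.ofLp y‖ := fun q => norm_le_pi_norm (WithLp.ofLp y) q
  set M := ‖WithLp.ofLp y‖ with hM
  have hM0 : 0 ≤ M := norm_nonneg _
  obtain ⟨p, hp⟩ : ∃ p, h ≤ |w p| := by
    by_contra! hlt
    exact absurd hw (not_le.2 ((pi_norm_lt_iff hh).2 hlt))
  rw [div_le_iff₀ (by linarith)]
  have hz0 : (y - w) 0 ≤ 0 := hz.trans (by nlinarith [norm_nonneg (y - w)])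
  have e0 : (y - w) 0 = y 0 - w 0 := rfl
  have ep : (y - w) p = y p - w p := rfl
  have hym := hcoord 0
  have hyp := hcoord p
  rcases eq_or_ne p 0 with rfl | hp0
  -- If the large coordinate of `w` is the first, then `y 0 ≤ w 0 ≤ -h`.
  · have hhM : h ≤ M := by
      rw [abs_of_nonpos hw0] at hp
      have := neg_abs_le (y 0)
      linarith
    nlinarith
  -- Otherwise m ≥ 2. With `h ≤ M + a`, and with `c² a² ≤ (1 - c²) M²` from the cone condition for
  -- `y - w`, it follows that `(c h)² ≤ 2 M² ≤ m M²`; this is the origin of √m.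
  · have hm2 : (2 : ℝ) ≤ m := by
      have : p.1 ≠ 0 := fun h => hp0 (Fin.ext h)
      have h2 : 2 ≤ m := by have := p.2; omega
      exact_mod_cast h2
    have hn : (y - w) 0 ^ 2 + (y - w) p ^ 2 ≤ ‖y - w‖ ^ 2 := by
      rw [EuclideanSpace.norm_sq_eq]
      calc (y - w) 0 ^ 2 + (y - w) p ^ 2
          = ∑ q ∈ ({0, p} : Finset (Fin m)), ‖(y - w) q‖ ^ 2 := by
            rw [Finset.sum_pair hp0.symm]; simp
        _ ≤ _ := Finset.sum_le_sum_of_subset_of_nonneg (Finset.subset_univ _)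
            fun _ _ _ => by positivity
    set a := |(y - w) p| with ha
    set z := -(y - w) 0 with hzdef
    have ha2 : a ^ 2 = (y - w) p ^ 2 := sq_abs _
    have hz1 : c * ‖y - w‖ ≤ z := by linarith
    have hz2 : (c * ‖y - w‖) ^ 2 ≤ z ^ 2 :=
      pow_le_pow_left₀ (mul_nonneg hc (norm_nonneg _)) hz1 2
    have hzM : z ≤ M := by
      have := neg_abs_le (y 0)
      linarith
    have hzn : 0 ≤ z := by linarith
    have hzz : z ^ 2 = (y - w) 0 ^ 2 := by rw [hzdef]; ring
    have hhM : h ≤ M + a := by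
      have : |w p| ≤ |y p| + |(y - w) p| := by
        have := abs_sub (y p) ((y - w) p)
        rwa [ep, sub_sub_cancel] at this
      linarith
    have hca : c ^ 2 * a ^ 2 ≤ (1 - c ^ 2) * M ^ 2 := by
      have h1 : c ^ 2 * (z ^ 2 + a ^ 2) ≤ z ^ 2 := by
        rw [hzz, ha2, ← hzz]
        refine le_trans ?_ hz2
        rw [mul_pow, hzz]
        exact mul_le_mul_of_nonneg_left hn (sq_nonneg c)
      have h2 : z ^ 2 ≤ M ^ 2 := pow_le_pow_left₀ hzn hzM 2
      have h3 : 0 ≤ 1 - c ^ 2 := by nlinarith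
      nlinarith
    have h4 : c * h ≤ c * M + c * a := by nlinarith
    have h5 : (c * h) ^ 2 ≤ 2 * M ^ 2 := by
      have h6 : (c * h) ^ 2 ≤ (c * M + c * a) ^ 2 := pow_le_pow_left₀ (by positivity) h4 2
      have h7 : (c * M + c * a) ^ 2 ≤ 2 * (c ^ 2 * M ^ 2) + 2 * (c ^ 2 * a ^ 2) := by
        linarith [sq_nonneg (c * M - c * a)]
      linarith
    refine abs_le_of_sq_le_sq' ?_ (by positivity) |>.2
    rw [mul_pow M, Real.sq_sqrt (by positivity)]
    have h8 := mul_le_mul_of_nonneg_left hm2 (sq_nonneg M)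
    linarith

/-- Nonzero points of the cone have negative first coordinate, so the lexicographic part of the
definition of the region is automatic. -/
lemma ScalarProductCond.mem_V_zero [NeZero m] (h : ScalarProductCond A₀ α) {O : E m ≃ₗᵢ[ℝ] E m}
    (hO : O α = ‖α‖ • EuclideanSpace.single (0 : Fin m) (1 : ℝ)) {y : E m} (hy : y ∈ O '' A₀) :
    y ∈ V (0 : E m) := by
  rcases eq_or_ne y 0 with rfl | hy0
  · exact Or.inr rfl
  · refine Or.inl ⟨0, ?_, fun q hq => absurd hq (by simp)⟩
    have := h.coord_le hO hy
    have h2 := h.bConst_neg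
    have h3 : 0 < ‖y‖ := norm_pos_iff.2 hy0
    have : y 0 < 0 := by nlinarith
    simpa using this

lemma ScalarProductCond.region_eq [NeZero m] (h : ScalarProductCond A₀ α) {O : E m ≃ₗᵢ[ℝ] E m}
    (hO : O α = ‖α‖ • EuclideanSpace.single (0 : Fin m) (1 : ℝ)) (r : ℝ) :
    region O A₀ α r = O '' A₀ ∩ {y | psi A₀ α r ≤ ‖WithLp.ofLp y‖} := by
  ext y
  constructor
  · rintro ⟨h1, h2, h3⟩
    refine ⟨h1, ?_⟩
    simpa using h3
  · rintro ⟨h1, h2⟩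
    refine ⟨h1, h.mem_V_zero hO h1, ?_⟩
    simpa using h2

lemma coord_le_of_mem_V [NeZero m] {i j : E m} (h : i ∈ V j) : i 0 ≤ j 0 := by
  rcases h with ⟨p, hp, hq⟩ | rfl
  · rcases eq_or_ne p 0 with rfl | hp0
    · exact hp.le
    · exact (hq 0 (Fin.pos_iff_ne_zero.2 hp0)).le
  · exact le_rfl

/-- Points of two spheres of influence, one of them in the lexicographic past, far away. -/
lemma ScalarProductCond.mem_region [NeZero m] (h : ScalarProductCond A₀ α) {O : E m ≃ₗᵢ[ℝ] E m}
    (hO : O α = ‖α‖ • EuclideanSpace.single (0 : Fin m) (1 : ℝ)) {i j : E m} {r : ℝ} (hr : 0 < r)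
    (hi : i ∈ Vh j r) {s : E m} (hs : s ∈ sphere A₀ (O.symm j)) (hs' : s ∈ sphere A₀ (O.symm i)) :
    O (s - O.symm j) ∈ region O A₀ α r := by
  obtain ⟨x, hx, rfl⟩ := hs
  obtain ⟨x', hx', he⟩ := hs'
  -- With `y = O x` and `w = i - j`, the common point seen from i is `y - w`, again in the rotated
  -- cone; this is the setting of `le_norm_of_mem_cone`.
  have he' : O x' = O x - (i - j) := by
    have := congrArg O he
    simp only [map_add, LinearIsometryEquiv.apply_symm_apply] at this
    rw [eq_sub_iff_add_eq, ← add_sub_assoc, add_comm, this]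
    abel
  rw [add_sub_cancel_left, h.region_eq hO]
  refine ⟨⟨x, hx, rfl⟩, ?_⟩

  have h2 := h.coord_le hO ⟨x', hx', rfl⟩
  rw [he'] at h2
  have h3 : ‖WithLp.ofLp (i - j)‖ = ‖WithLp.ofLp (j - i)‖ := by
    rw [← neg_sub j i, WithLp.ofLp_neg, norm_neg]
  have h4 := coord_le_of_mem_V hi.1
  have h5 : (i - j) 0 = i 0 - j 0 := rfl
  have h6 := hi.2
  simp only [Set.mem_ofPred_eq] at h6 ⊢
  refine le_norm_of_mem_cone (c := -bConst A₀ α) (by linarith [h.bConst_neg])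
    (by linarith [h.neg_one_le_bConst]) hr (w := i - j) (by simpa using h2)
    (by linarith) (by rw [h3]; exact h6)

lemma ScalarProductCond.measurableSet_region [NeZero m] (h : ScalarProductCond A₀ α)
    (hA : MeasurableSet A₀) {O : E m ≃ₗᵢ[ℝ] E m}
    (hO : O α = ‖α‖ • EuclideanSpace.single (0 : Fin m) (1 : ℝ)) (r : ℝ) :
    MeasurableSet (region O A₀ α r) := by
  rw [h.region_eq hO]
  refine (O.toHomeomorph.measurableEmbedding.measurableSet_image' hA).inter ?_
  have hc : Continuous fun y : E m => ‖WithLp.ofLp y‖ := by fun_prop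
  exact measurableSet_le measurable_const hc.measurable

lemma ScalarProductCond.region_antitone [NeZero m] (h : ScalarProductCond A₀ α)
    {O : E m ≃ₗᵢ[ℝ] E m}
    (hO : O α = ‖α‖ • EuclideanSpace.single (0 : Fin m) (1 : ℝ)) :
    Antitone (region O A₀ α) := by
  intro r r' hr
  rw [h.region_eq hO, h.region_eq hO]
  refine Set.inter_subset_inter_right _ fun y (hy : psi A₀ α r' ≤ ‖WithLp.ofLp y‖) =>
    (?_ : psi A₀ α r ≤ psi A₀ α r').trans hy
  have := h.bConst_neg
  unfold psi
  refine div_le_div_of_nonneg_right ?_ (Real.sqrt_nonneg _)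
  nlinarith

/-- The truncation radius tends to infinity because b < 0. -/
lemma ScalarProductCond.iInter_region [NeZero m] (h : ScalarProductCond A₀ α)
    {O : E m ≃ₗᵢ[ℝ] E m}
    (hO : O α = ‖α‖ • EuclideanSpace.single (0 : Fin m) (1 : ℝ)) :
    ⋂ N : ℕ, region O A₀ α N = ∅ := by
  rw [Set.eq_empty_iff_forall_notMem]
  intro y hy
  have hb := h.bConst_neg
  have hsm : 0 < Real.sqrt m := Real.sqrt_pos.2 (by exact_mod_cast NeZero.pos m)
  obtain ⟨N, hN⟩ := exists_nat_gt (‖WithLp.ofLp y‖ * Real.sqrt m / -bConst A₀ α)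
  have h1 := Set.mem_iInter.1 hy N
  rw [h.region_eq hO] at h1
  have h2 := h1.2
  simp only [Set.mem_ofPred_eq, psi] at h2
  rw [div_le_iff₀ hsm] at h2
  rw [div_lt_iff₀ (by linarith)] at hN
  linarith

end geometry

/-! ### Transport of kernels and moment bounds by rigid motions -/

section transport
variable {T T' : Type*} [MeasurableSpace T] [MeasurableSpace T'] {n d : ℕ} {ctrl : Measure T}
  {ctrl' : Measure T'} {Q : Matrix (Fin d) (Fin d) ℝ} {β : E d} {ν : Measure (E d)}
  {K : Set (E d)} {k k' : T → Matrix (Fin n) (Fin d) ℝ} {e : T' → T} {D : Set T}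

lemma IsAdmissible.comp (hk : IsAdmissible ctrl Q β K k) (he : MeasurePreserving e ctrl' ctrl) :
    IsAdmissible ctrl' Q β K fun p => k (e p) where
  meas i j := (hk.meas i j).comp he.measurable
  sq := hk.sq.imp id fun h =>
    he.integrable_comp_of_integrable (g := fun p => msize (k p) ^ 2) h
  one := hk.one.imp id fun h =>
    he.integrable_comp_of_integrable (g := fun p => msize (k p)) h

lemma IsAdmissible.of_le (hk : IsAdmissible ctrl Q β K k)
    (hk' : ∀ i j, Measurable fun p => k' p i j) (hle : ∀ p, msize (k' p) ≤ msize (k p)) :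
    IsAdmissible ctrl Q β K k' where
  meas := hk'
  sq := hk.sq.imp id fun h => h.mono'
    (stronglyMeasurable_comp_matrix hk' (continuous_msize.pow 2)).aestronglyMeasurable
    (Eventually.of_forall fun p => by
      have := msize_nonneg (k' p)
      rw [Real.norm_of_nonneg (by positivity)]
      exact pow_le_pow_left₀ this (hle p) 2)
  one := hk.one.imp id fun h => h.mono'
    (stronglyMeasurable_comp_matrix hk' continuous_msize).aestronglyMeasurable
    (Eventually.of_forall fun p => by
      rw [Real.norm_of_nonneg (msize_nonneg (k' p))]
      exact hle p)

lemma momentBound_preimage (he : MeasurePreserving e ctrl' ctrl) (hemb : MeasurableEmbedding e) :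
    momentBound ctrl' Q β ν K (e ⁻¹' D) (fun p => k (e p)) = momentBound ctrl Q β ν K D k := by
  unfold momentBound
  rw [he.setIntegral_preimage_emb hemb (fun p => qform Q (k p)),
    he.setIntegral_preimage_emb hemb (fun p => mv (k p) β),
    he.setIntegral_preimage_emb hemb (fun p => jumpNorm ν K (k p))]

lemma momentBound_congr (hD : MeasurableSet D) (h : ∀ p ∈ D, k p = k' p) :
    momentBound ctrl Q β ν K D k = momentBound ctrl Q β ν K D k' := by
  unfold momentBound
  rw [setIntegral_congr_fun hD fun p hp => congrArg (qform Q) (h p hp),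
    setIntegral_congr_fun hD fun p hp => congrArg (fun M => mv M β) (h p hp),
    setIntegral_congr_fun hD fun p hp => congrArg (jumpNorm ν K) (h p hp)]

end transport

section kernel
variable {S : Type*} [MeasurableSpace S] {π : Measure S} [IsProbabilityMeasure π] {m n d : ℕ}
  {Q : Matrix (Fin d) (Fin d) ℝ} {β : E d} {ν : Measure (E d)} {K : Set (E d)}
  {f : S × E m → Matrix (Fin n) (Fin d) ℝ}

lemma KernelMemLp.msize {q : ℝ≥0∞} (h : KernelMemLp f q π) :
    MemLp (fun p => msize (f p)) q (π.prod (volume : Measure (E m))) :=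
  memLp_finsetSum _ fun i _ => memLp_finsetSum _ fun j _ => (h i j).abs

lemma isAdmissible_of_memLp (hf : ∀ i j, Measurable fun p => f p i j)
    (h2 : Q = 0 ∨ KernelMemLp f 2 π) (h1 : (β = 0 ∧ K = Set.univ) ∨ KernelMemLp f 1 π) :
    IsAdmissible (π.prod (volume : Measure (E m))) Q β K f where
  meas := hf
  sq := h2.imp id fun h => h.msize.integrable_sq
  one := h1.imp id fun h => memLp_one_iff_integrable.1 h.msize

lemma measurePreserving_reflect (t : E m) :
    MeasurePreserving (fun p : S × E m => (p.1, t - p.2)) (π.prod volume) (π.prod volume) :=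
  (MeasurePreserving.id π).prod (Measure.measurePreserving_sub_left volume t)

lemma measurePreserving_rigid (O : E m ≃ₗᵢ[ℝ] E m) (t : E m) :
    MeasurePreserving (fun p : S × E m => (p.1, t + O.symm p.2)) (π.prod volume) (π.prod volume) :=
  (MeasurePreserving.id π).prod
    ((measurePreserving_add_left volume t).comp O.symm.measurePreserving)

lemma measurableEmbedding_rigid (O : E m ≃ₗᵢ[ℝ] E m) (t : E m) :
    MeasurableEmbedding (fun p : S × E m => (p.1, t + O.symm p.2)) :=
  MeasurableEmbedding.id.prodMap
    ((measurableEmbedding_addLeft t).comp O.symm.toHomeomorph.measurableEmbedding)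

lemma mem_sphere_iff {A₀ : Set (E m)} {t s : E m} : s ∈ sphere A₀ t ↔ s - t ∈ A₀ := by
  constructor
  · rintro ⟨x, hx, rfl⟩
    rwa [add_sub_cancel_left]
  · intro h
    exact ⟨s - t, h, add_sub_cancel t s⟩

lemma measurableSet_sphere {A₀ : Set (E m)} (hA : MeasurableSet A₀) (t : E m) :
    MeasurableSet (sphere A₀ t) := by
  have : sphere A₀ t = (fun s => s - t) ⁻¹' A₀ := by
    ext s
    exact mem_sphere_iff
  rw [this]
  exact hA.preimage (measurable_id.sub_const t)

lemma isAdmissible_kernelAt {A₀ : Set (E m)} (hA : MeasurableSet A₀)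
    (hf : IsAdmissible (π.prod (volume : Measure (E m))) Q β K f) (t : E m) :
    IsAdmissible (π.prod (volume : Measure (E m))) Q β K (kernelAt f A₀ t) := by
  classical
  refine (hf.comp (measurePreserving_reflect t)).of_le (fun i j => ?_) fun p => ?_
  · have h1 : Measurable fun p : S × E m => f (p.1, t - p.2) i j :=
      (hf.meas i j).comp (measurePreserving_reflect (π := π) t).measurable
    have h2 : (fun p : S × E m => kernelAt f A₀ t p i j) =
        fun p => if p ∈ Prod.snd ⁻¹' sphere A₀ t then f (p.1, t - p.2) i j else 0 := by
      ext p
      by_cases hp : p.2 ∈ sphere A₀ t <;> simp [kernelAt, hp]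
    rw [h2]
    exact Measurable.ite ((measurableSet_sphere hA t).preimage measurable_snd) h1 measurable_const
  · unfold kernelAt
    split_ifs
    · exact le_rfl
    · rw [msize_zero]
      exact msize_nonneg _

lemma isAdmissible_reflKernel (hf : IsAdmissible (π.prod (volume : Measure (E m))) Q β K f)
    (O : E m ≃ₗᵢ[ℝ] E m) :
    IsAdmissible (π.prod (volume : Measure (E m))) Q β K fun p => reflKernel O f p.1 p.2 := by
  have h := (hf.comp (measurePreserving_reflect 0)).comp (measurePreserving_rigid O 0)
  simpa [reflKernel] using h

/-- Fubini's theorem gives the iterated integrals of the final bounds. -/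
lemma momentBound_prod {g : S → E m → Matrix (Fin n) (Fin d) ℝ} {R : Set (E m)}
    (h : MomentIntegrableOn (π.prod volume) Q β ν K (Set.univ ×ˢ R) fun p => g p.1 p.2) :
    momentBound (π.prod volume) Q β ν K (Set.univ ×ˢ R) (fun p => g p.1 p.2) =
      Real.sqrt (traceTerm π g R Q + ‖meanTerm π g R β‖ ^ 2) + jumpTerm π g R ν Kᶜ := by
  unfold momentBound
  rw [setIntegral_prod _ h.quad, setIntegral_prod _ h.mean, setIntegral_prod _ h.jump,
    Measure.restrict_univ]
  rfl

/-- The moment bound over the part of a sphere of influence that is close to its apex. -/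
lemma momentBound_kernelAt {A₀ R : Set (E m)} (hR : MeasurableSet R) (O : E m ≃ₗᵢ[ℝ] E m)
    (hRA : R ⊆ O '' A₀) (t : E m) :
    momentBound (π.prod volume) Q β ν K {p : S × E m | O (p.2 - t) ∈ R} (kernelAt f A₀ t) =
      momentBound (π.prod volume) Q β ν K (Set.univ ×ˢ R) fun p => reflKernel O f p.1 p.2 := by
  rw [← momentBound_preimage (measurePreserving_rigid O t) (measurableEmbedding_rigid O t)]
  have hpre : (fun p : S × E m => (p.1, t + O.symm p.2)) ⁻¹' {p : S × E m | O (p.2 - t) ∈ R} =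
      Set.univ ×ˢ R := by
    ext p
    simp only [Set.mem_preimage, Set.mem_ofPred_eq, add_sub_cancel_left,
      LinearIsometryEquiv.apply_symm_apply, Set.mem_prod, Set.mem_univ, true_and]
  rw [hpre]
  refine momentBound_congr (MeasurableSet.univ.prod hR) fun p hp => ?_
  obtain ⟨x, hx, hxp⟩ := hRA hp.2
  have hmem : t + O.symm p.2 ∈ sphere A₀ t := by
    rw [mem_sphere_iff, add_sub_cancel_left, ← hxp, LinearIsometryEquiv.symm_apply_apply]
    exact hx
  simp [kernelAt, hmem, reflKernel]

end kernel

/-! ### Decomposition of the field and the bound for θ -/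

section core
variable {Ω S : Type*} [MeasurableSpace Ω] {P : Measure Ω} [IsProbabilityMeasure P]
  [MetricSpace S] [MeasurableSpace S] [BorelSpace S] {m n d : ℕ}
  {Λ : Set (S × E m) → Ω → E d}
  {γ : E d} {Sig : Matrix (Fin d) (Fin d) ℝ} {ν : Measure (E d)} {π : Measure S}
  [IsProbabilityMeasure π] {β : E d} {K : Set (E d)}

lemma IsLevyBasis.limit_union_ae (hΛ : IsLevyBasis P Λ γ Sig ν π)
    {g : ℕ → SimpleFunc (S × E m) (Matrix (Fin n) (Fin d) ℝ)}
    (hg : ∀ i, Bornology.IsBounded (Function.support (g i))) {D D' : Set (S × E m)}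
    (hD : MeasurableSet D) (hD' : MeasurableSet D') (hdisj : Disjoint D D') {Z Z₁ Z₂ : Ω → E n}
    (hZ : TendstoInMeasure P (fun i => simpleInt Λ (g i) (D ∪ D')) atTop Z)
    (hZ₁ : TendstoInMeasure P (fun i => simpleInt Λ (g i) D) atTop Z₁)
    (hZ₂ : TendstoInMeasure P (fun i => simpleInt Λ (g i) D') atTop Z₂) :
    ∀ᵐ ω ∂P, Z ω = Z₁ ω + Z₂ ω := by
  have hm : ∀ i {D}, MeasurableSet D → AEStronglyMeasurable (simpleInt Λ (g i) D) P :=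
    fun i _ h => (hΛ.measurable_simpleInt (hg i) h).aestronglyMeasurable
  have hm₁ : AEStronglyMeasurable Z₁ P := hZ₁.aestronglyMeasurable fun i => hm i hD
  have hm₂ : AEStronglyMeasurable Z₂ P := hZ₂.aestronglyMeasurable fun i => hm i hD'
  have h : TendstoInMeasure P (fun i => simpleInt Λ (g i) (D ∪ D')) atTop (Z₁ + Z₂) := by
    refine tendstoInMeasure_of_probDist (fun i => hm i (hD.union hD')) (hm₁.add hm₂) ?_
    have h12 := (tendsto_probDist hZ₁).add (tendsto_probDist hZ₂)
    rw [add_zero] at h12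
    refine tendsto_of_tendsto_of_tendsto_of_le_of_le tendsto_const_nhds h12 (fun _ => zero_le)
      fun i => probDist_le_add (hm i hD) hm₁ ?_
    filter_upwards [hΛ.simpleInt_union_ae (hg i) hD hD' hdisj] with ω hω
    rw [hω, Pi.add_apply]
    abel
  exact tendstoInMeasure_ae_unique hZ h

/-- The integral of a kernel vanishing outside `D ∪ D'`, as the sum of the parts over `D` and
`D'`. -/
lemma IsLevyBasis.exists_decomposition (hΛ : IsLevyBasis P Λ γ Sig ν π)
    (hsp : IsSplit γ Sig ν β K) {k : S × E m → Matrix (Fin n) (Fin d) ℝ}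
    (hk : IsAdmissible (π.prod volume) (Sig + secondMoment ν K) β K k) {Y : Ω → E n}
    (hY : IsStochInt P Λ (π.prod volume) k Y) {D D' : Set (S × E m)} (hD : MeasurableSet D)
    (hD' : MeasurableSet D') (hdisj : Disjoint D D') (hk0 : ∀ p, p ∉ D ∪ D' → k p = 0) :
    ∃ Y' Z : Ω → E n, AEStronglyMeasurable[sigmaOn Λ D] Y' P ∧
      ∫⁻ ω, ‖Z ω‖ₑ ∂P ≤ ENNReal.ofReal
        (momentBound (π.prod volume) (Sig + secondMoment ν K) β ν K D' k) ∧
      ∀ᵐ ω ∂P, Y ω = Y' ω + Z ω := by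
  obtain ⟨g, hg, hlim, hconv, hlimY⟩ := hY
  obtain ⟨Y', hY'⟩ := hconv D hD
  obtain ⟨Z, hZ⟩ := hconv D' hD'
  have hU := hD.union hD'
  obtain ⟨W, hW⟩ := hconv (D ∪ D') hU
  obtain ⟨N, hN⟩ := hconv (D ∪ D')ᶜ hU.compl
  have h1 := hΛ.limit_union_ae hg hD hD' hdisj hW hY' hZ
  have h2 := hΛ.limit_union_ae hg hU hU.compl disjoint_compl_right
    (by rw [Set.union_compl_self]; exact hlimY) hW hN
  have hNm : AEStronglyMeasurable N P := hN.aestronglyMeasurable fun i =>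
    (hΛ.measurable_simpleInt (hg i) hU.compl).aestronglyMeasurable
  -- Off `D ∪ D'` the kernel is 0, but its approximations need not be; the moment bound for limits
  -- is what makes this part vanish.
  have h3 : N =ᵐ[P] 0 := by
    have h := hΛ.lintegral_limit_le hsp hg hlim hconv hU.compl (hk.momentIntegrableOn hsp _) hN
    rw [momentBound_of_eqOn_zero (D := (D ∪ D')ᶜ) fun p hp => hk0 p hp, ENNReal.ofReal_zero,
      nonpos_iff_eq_zero, lintegral_eq_zero_iff' hNm.enorm] at h
    filter_upwards [h] with ω hω
    simpa using hω
  refine ⟨Y', Z, aestronglyMeasurable_sigmaOn hg hD hY',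
    hΛ.lintegral_limit_le hsp hg hlim hconv hD' (hk.momentIntegrableOn hsp _) hZ, ?_⟩
  filter_upwards [h1, h2, h3] with ω e1 e2 e3
  rw [e2, e1, e3, Pi.zero_apply, add_zero]

/-- The decomposition with an empty second set, whose remainder has mean norm 0. -/
lemma IsLevyBasis.aestronglyMeasurable_of_support (hΛ : IsLevyBasis P Λ γ Sig ν π)
    (hsp : IsSplit γ Sig ν β K) {k : S × E m → Matrix (Fin n) (Fin d) ℝ}
    (hk : IsAdmissible (π.prod volume) (Sig + secondMoment ν K) β K k) {Y : Ω → E n}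
    (hYm : Measurable Y)
    (hY : IsStochInt P Λ (π.prod volume) k Y) {D : Set (S × E m)} (hD : MeasurableSet D)
    (hk0 : ∀ p, p ∉ D → k p = 0) : AEStronglyMeasurable[sigmaOn Λ D] Y P := by
  obtain ⟨Y', Z, hY', hZ, hsum⟩ := hΛ.exists_decomposition hsp hk hY hD MeasurableSet.empty
    (Set.disjoint_empty D) (by simpa using hk0)
  rw [momentBound_of_null (by simp), ENNReal.ofReal_zero, nonpos_iff_eq_zero] at hZ
  have hY'm : AEStronglyMeasurable Y' P := hY'.mono (hΛ.sigmaOn_le D)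
  have hZm : AEMeasurable Z P := (hYm.aemeasurable.sub hY'm.aemeasurable).congr (by
    filter_upwards [hsum] with ω hω
    simp [hω])
  rw [lintegral_eq_zero_iff' hZm.enorm] at hZ
  refine hY'.congr ?_
  filter_upwards [hsum, hZ] with ω h1 h2
  have h3 : Z ω = 0 := by simpa using h2
  rw [h1, h3, add_zero]

variable [NeZero m] {f : S × E m → Matrix (Fin n) (Fin d) ℝ} {A₀ : Set (E m)} {α : E m}
  {O : E m ≃ₗᵢ[ℝ] E m}

/-- `D'` collects the points whose rotated offset from the apex lies in the region, `D` is the rest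
of the sphere at `t`, and `U` contains the spheres of all past points. As `U` misses `D`, the part
over `D` is independent of the past, and the part over `D'` is bounded in mean. -/
lemma IsLevyBasis.thetaLex_le (hΛ : IsLevyBasis P Λ γ Sig ν π) (hsp : IsSplit γ Sig ν β K)
    (hf : IsAdmissible (π.prod volume) (Sig + secondMoment ν K) β K f)
    (hA : MeasurableSet A₀) (hα : ScalarProductCond A₀ α)
    (hO : O α = ‖α‖ • EuclideanSpace.single (0 : Fin m) (1 : ℝ)) {X : E m → Ω → E n}
    (hX : IsInfluencedMMAF P Λ π f A₀ X) {h : ℝ} (hh : 0 < h) :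
    thetaLex P (rotate O X) h ≤ ENNReal.ofReal (2 * momentBound (π.prod volume)
      (Sig + secondMoment ν K) β ν K (Set.univ ×ˢ region O A₀ α h)
      fun p => reflKernel O f p.1 p.2) := by
  refine iSup₂_le fun u _ => iSup₂_le fun F hF => iSup₂_le fun G hG => iSup₂_le fun j Γ =>
    iSup_le fun hΓ => ENNReal.div_le_of_le_mul ?_
  obtain ⟨hFm, C, hC⟩ := hF
  obtain ⟨⟨L, hL⟩, C', hC'⟩ := hG
  set t := O.symm j with ht
  set R := region O A₀ α h with hR
  have hRm : MeasurableSet R := hα.measurableSet_region hA hO h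
  set D' : Set (S × E m) := {p | O (p.2 - t) ∈ R} with hD'
  have hD'm : MeasurableSet D' :=
    hRm.preimage (O.continuous.measurable.comp (measurable_snd.sub_const t))
  set D : Set (S × E m) := Prod.snd ⁻¹' sphere A₀ t \ D' with hD
  have hDm : MeasurableSet D := ((measurableSet_sphere hA t).preimage measurable_snd).diff hD'm
  set U : Set (S × E m) := ⋃ a, Prod.snd ⁻¹' sphere A₀ (O.symm (Γ a)) with hU
  have hUD : Disjoint U D := by
    rw [Set.disjoint_left]
    rintro p hp ⟨hp1, hp2⟩
    obtain ⟨a, ha⟩ := Set.mem_iUnion.1 hp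
    exact hp2 (hα.mem_region hO hh (hΓ.2 a) hp1 ha)
  obtain ⟨Y', Z, hY', hZ, hsum⟩ := hΛ.exists_decomposition hsp (isAdmissible_kernelAt hA hf t)
    (hX t).2 hDm hD'm Set.disjoint_sdiff_left (fun p hp => by
      have : p.2 ∉ sphere A₀ t := fun hs => hp (by
        by_cases hpD : p ∈ D'
        · exact Or.inr hpD
        · exact Or.inl ⟨hs, hpD⟩)
      simp [kernelAt, this])
  have hXa : ∀ a, AEStronglyMeasurable[sigmaOn Λ U] (X (O.symm (Γ a))) P := fun a => by
    refine (hΛ.aestronglyMeasurable_of_support hsp (isAdmissible_kernelAt hA hf (O.symm (Γ a)))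
      (hX _).1 (hX _).2 ((measurableSet_sphere hA (O.symm (Γ a))).preimage measurable_snd)
      fun p hp => ?_).mono (sigmaOn_mono (Set.subset_iUnion _ a))
    have : p.2 ∉ sphere A₀ (O.symm (Γ a)) := hp
    simp [kernelAt, this]
  have hind := hΛ.indepFun_of_aestronglyMeasurable hUD hXa hY'
  have hcov := abs_covariance_le (P := P) (ξ := fun ω a => X (O.symm (Γ a)) ω) (Y := X t)
    (measurable_pi_lambda _ fun a => (hX _).1) (hX t).1.aemeasurable
    (hY'.mono (hΛ.sigmaOn_le D)).aemeasurable hsum hind hFm hC hL.continuous hC'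
  refine hcov.trans (mul_le_mul' ?_ le_rfl)
  rw [ENNReal.ofReal_mul zero_le_two, ENNReal.ofReal_ofNat]
  refine mul_le_mul' le_rfl (hZ.trans_eq ?_)
  rw [momentBound_kernelAt hRm O Set.inter_subset_left t]

/-- The common form of the four cases; each only supplies a splitting and compares its bound with
the general one. -/
theorem IsLevyBasis.influencedThetaLex (hΛ : IsLevyBasis P Λ γ Sig ν π)
    (hsp : IsSplit γ Sig ν β K) (hfm : ∀ i j, Measurable fun p => f p i j)
    (h2 : Sig + secondMoment ν K = 0 ∨ KernelMemLp f 2 π)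
    (h1 : (β = 0 ∧ K = Set.univ) ∨ KernelMemLp f 1 π)
    (hA : MeasurableSet A₀) (hα : ScalarProductCond A₀ α)
    (hO : O α = ‖α‖ • EuclideanSpace.single (0 : Fin m) (1 : ℝ)) {bound : ℝ → ℝ}
    (hbound : ∀ h, 2 * (Real.sqrt (traceTerm π (reflKernel O f) (region O A₀ α h)
        (Sig + secondMoment ν K) + ‖meanTerm π (reflKernel O f) (region O A₀ α h) β‖ ^ 2) +
        jumpTerm π (reflKernel O f) (region O A₀ α h) ν Kᶜ) ≤ bound h) :
    InfluencedThetaLex P Λ π f A₀ O bound := by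
  have hf := isAdmissible_of_memLp (π := π) hfm h2 h1
  have hg := isAdmissible_reflKernel hf O
  refine ⟨fun t => hΛ.isLevyIntegrable hsp (isAdmissible_kernelAt hA hf t), fun X hX => ⟨?_, ?_⟩⟩
  -- The bound itself need not be monotone in h because of the norm of the mean; its monotone
  -- majorant over the regions at integers tends to 0.
  · set R : ℕ → Set (S × E m) := fun N => Set.univ ×ˢ region O A₀ α N with hR
    have hlim := MomentIntegrableOn.tendsto_absMomentBound (ctrl := π.prod volume) (D := R)
      (fun N => MeasurableSet.univ.prod (hα.measurableSet_region hA hO N))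
      (fun N N' hN => Set.prod_mono le_rfl (hα.region_antitone hO (by exact_mod_cast hN)))
      (by rw [← Set.prod_iInter, hα.iInter_region hO, Set.prod_empty])
      (hg.momentIntegrableOn hsp _)
    have hlim2 := ENNReal.tendsto_ofReal (hlim.const_mul 2)
    rw [mul_zero, ENNReal.ofReal_zero] at hlim2
    rw [IsThetaLexWeaklyDependent, ENNReal.tendsto_nhds_zero]
    intro ε hε
    obtain ⟨N, hN⟩ := (ENNReal.tendsto_nhds_zero.1 hlim2 ε hε).exists
    filter_upwards [eventually_ge_atTop (N : ℝ), eventually_gt_atTop 0] with h hNh hh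
    refine (hΛ.thetaLex_le hsp hf hA hα hO hX hh).trans (le_trans ?_ hN)
    refine ENNReal.ofReal_le_ofReal (mul_le_mul_of_nonneg_left ?_ zero_le_two)
    exact (hg.momentIntegrableOn hsp _).momentBound_le
      (Set.prod_mono le_rfl (hα.region_antitone hO hNh))
  · intro h hh
    refine (hΛ.thetaLex_le hsp hf hA hα hO hX hh).trans (ENNReal.ofReal_le_ofReal ?_)
    rw [momentBound_prod (hg.momentIntegrableOn hsp _)]
    exact hbound h

end core

/-! ### The three splittings -/

section splittings
variable {d : ℕ} {γ β : E d} {Sig : Matrix (Fin d) (Fin d) ℝ} {ν : Measure (E d)} {K : Set (E d)}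

lemma integrable_compensated (hK : MeasurableSet K) (hsq : IntegrableOn (fun x => ‖x‖ ^ 2) K ν)
    (hone : IntegrableOn (fun x => ‖x‖) Kᶜ ν) (u : E d) :
    Integrable (fun x => Complex.exp (Complex.I * (inner ℝ u x : ℝ)) - 1 -
      Complex.I * (K.indicator (fun y => inner ℝ u y) x : ℝ)) ν := by
  have hmeas : Measurable (K.indicator fun y : E d => inner ℝ u y) :=
    Measurable.indicator (by fun_prop) hK
  refine (((hsq.integrable_indicator hK).const_mul (3 * ‖u‖ ^ 2)).add
    ((hone.integrable_indicator hK.compl).const_mul ‖u‖)).mono' (by fun_prop)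
    (Eventually.of_forall fun x => ?_)
  have hx := abs_real_inner_le_norm u x
  by_cases hxK : x ∈ K
  · have h := norm_exp_I_sub_one_sub_le (inner ℝ u x)
    have hxc : x ∉ Kᶜ := fun h => h hxK
    simp only [Set.indicator_of_mem hxK, Pi.add_apply, Set.indicator_of_notMem hxc, mul_zero,
      add_zero]
    refine h.trans ?_
    have : (inner ℝ u x) ^ 2 ≤ (‖u‖ * ‖x‖) ^ 2 := sq_le_sq' (abs_le.1 hx).1 (abs_le.1 hx).2
    rw [mul_pow] at this
    linarith
  · have h := norm_exp_I_add_sub_le 0 (inner ℝ u x)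
    have hxc : x ∈ Kᶜ := hxK
    simp only [Set.indicator_of_notMem hxK, Pi.add_apply, Set.indicator_of_mem hxc, mul_zero,
      zero_add, Complex.ofReal_zero, sub_zero]
    simp only [zero_add, Complex.ofReal_zero, mul_zero, sub_zero] at h
    refine h.trans ?_
    norm_num
    exact hx

/-- Change of the truncation set in the Lévy–Khintchine formula. -/
lemma isSplit_of_truncation (hS : Sig.PosSemidef) (hK : MeasurableSet K)
    (hsq : IntegrableOn (fun x => ‖x‖ ^ 2) K ν) (hone : IntegrableOn (fun x => ‖x‖) Kᶜ ν)
    {v : E d → E d}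
    (hv : ∀ x, v x = K.indicator id x - {y : E d | ‖y‖ ≤ 1}.indicator id x)
    (hvi : Integrable v ν) (hβ : β = γ + ∫ x, v x ∂ν) : IsSplit γ Sig ν β K where
  posSemidef := hS
  meas := hK
  sq := hsq
  one := hone
  cumulant_eq u := by
    have h1 := integrable_compensated hK hsq hone u
    have h2 : Integrable (fun x => inner ℝ u (v x)) ν := hvi.const_inner u
    have h3 : Integrable (fun x => Complex.I * ((inner ℝ u (v x) : ℝ) : ℂ)) ν :=
      (Integrable.ofReal (𝕜 := ℂ) h2).const_mul _
    have hind : ∀ (B : Set (E d)) (x : E d),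
        B.indicator (fun y => inner ℝ u y) x = inner ℝ u (B.indicator id x) := fun B x => by
      by_cases hx : x ∈ B <;> simp [hx]
    have h4 : ∫ x, Complex.I * ((inner ℝ u (v x) : ℝ) : ℂ) ∂ν =
        Complex.I * ((inner ℝ u (∫ x, v x ∂ν) : ℝ) : ℂ) := by
      rw [integral_const_mul, integral_complex_ofReal, integral_inner hvi]
    have h5 : ∀ x, Complex.exp (Complex.I * (inner ℝ u x : ℝ)) - 1 -
        Complex.I * (Set.indicator {y : E d | ‖y‖ ≤ 1} (fun y => inner ℝ u y) x : ℝ) =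
        (Complex.exp (Complex.I * (inner ℝ u x : ℝ)) - 1 -
        Complex.I * (K.indicator (fun y => inner ℝ u y) x : ℝ)) +
        Complex.I * ((inner ℝ u (v x) : ℝ) : ℂ) := fun x => by
      rw [hind, hind, hv, inner_sub_right]
      push_cast
      ring
    rw [cumulant, integral_congr_ae (Eventually.of_forall h5), integral_add h1 h3, h4, hβ,
      inner_add_left, real_inner_comm u (∫ x, v x ∂ν)]
    push_cast
    ring

lemma measurableSet_unitBall : MeasurableSet {x : E d | ‖x‖ ≤ 1} :=
  measurableSet_le measurable_norm measurable_const

lemma compl_unitBall : {x : E d | ‖x‖ ≤ 1}ᶜ = {x | 1 < ‖x‖} := by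
  ext x
  simp

lemma IsLevyMeasure.integrableOn_sq (h : IsLevyMeasure ν) :
    IntegrableOn (fun x => ‖x‖ ^ 2) {x | ‖x‖ ≤ 1} ν := by
  refine ⟨by fun_prop, lt_of_le_of_lt ?_ h.2⟩
  refine (setLIntegral_mono' measurableSet_unitBall fun x (hx : ‖x‖ ≤ 1) => ?_).trans
    (setLIntegral_le_lintegral _ _)
  have hx1 : ‖x‖ₑ ≤ 1 := by
    rw [← ofReal_norm, ← ENNReal.ofReal_one]
    exact ENNReal.ofReal_le_ofReal hx
  rw [enorm_pow, enorm_norm]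
  exact le_min (pow_le_one₀ zero_le hx1) le_rfl

/-- All jumps are compensated, so the drift becomes the mean of the basis; for (i) and (ii). -/
lemma isSplit_univ (hS : Sig.PosSemidef) (hν : IsLevyMeasure ν)
    (h : IntegrableOn (fun x => ‖x‖ ^ 2) {x | 1 < ‖x‖} ν) :
    IsSplit γ Sig ν (muLambda γ ν) Set.univ := by
  have hB := measurableSet_unitBall (d := d)
  have hB' : MeasurableSet {x : E d | 1 < ‖x‖} := compl_unitBall (d := d) ▸ hB.compl
  have hi : IntegrableOn (fun x : E d => x) {x | 1 < ‖x‖} ν := by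
    refine Integrable.mono' h (by fun_prop) ?_
    filter_upwards [ae_restrict_mem hB'] with x (hx : 1 < ‖x‖)
    nlinarith
  refine isSplit_of_truncation hS MeasurableSet.univ ?_ (by simp)
    (v := {x : E d | 1 < ‖x‖}.indicator id) (fun x => ?_) (hi.integrable_indicator hB') ?_
  · rw [← Set.union_compl_self {x : E d | ‖x‖ ≤ 1}, compl_unitBall]
    exact hν.integrableOn_sq.union h
  · rw [← compl_unitBall, Set.indicator_compl, Set.indicator_univ]
    rfl
  · rw [integral_indicator hB']
    rfl

/-- No jump is compensated, so the compensator of the small jumps is removed from the drift; for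
(iii). -/
lemma isSplit_empty (hS : Sig.PosSemidef) (h : Integrable (fun x => ‖x‖) ν) :
    IsSplit γ Sig ν (gammaZero γ ν) ∅ := by
  have hB := measurableSet_unitBall (d := d)
  have hi : Integrable (fun x : E d => x) ν :=
    (integrable_norm_iff (by fun_prop)).1 h
  refine isSplit_of_truncation hS MeasurableSet.empty (by simp) (by simpa using h)
    (v := fun x => -{x : E d | ‖x‖ ≤ 1}.indicator id x) (fun x => by simp)
    (hi.indicator hB).neg ?_
  rw [integral_neg, integral_indicator hB, ← sub_eq_add_neg]
  rfl

/-- The original truncation, with unchanged drift; for (iv). -/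
lemma isSplit_unitBall (hS : Sig.PosSemidef) (hν : IsLevyMeasure ν)
    (h : IntegrableOn (fun x => ‖x‖) {x | 1 < ‖x‖} ν) : IsSplit γ Sig ν γ {x | ‖x‖ ≤ 1} :=
  isSplit_of_truncation hS measurableSet_unitBall hν.integrableOn_sq (by rwa [compl_unitBall])
    (v := 0) (fun x => by simp) (integrable_zero _ _ _) (by simp)

end splittings

lemma norm_meanTerm_le {S : Type*} [MeasurableSpace S] {m n d : ℕ} {π : Measure S}
    (g : S → E m → Matrix (Fin n) (Fin d) ℝ) (R : Set (E m)) (v : E d)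
    (h : Integrable (fun a => ∫ s in R, ‖mv (g a s) v‖) π) :
    ‖meanTerm π g R v‖ ≤ normTerm π g R v :=
  norm_integral_le_of_norm_le h (Eventually.of_forall fun _ => norm_integral_le_integral_norm _)

end MMAF

/-! ### The four cases -/

open MMAF
theorem proposition3p8
    {Ω S : Type*} [MeasurableSpace Ω] (P : Measure Ω) [IsProbabilityMeasure P]
    [MetricSpace S] [PolishSpace S] [MeasurableSpace S] [BorelSpace S]
    (π : Measure S) [IsProbabilityMeasure π]
    {m n d : ℕ} [NeZero m]
    (γ : E d) (Sig : Matrix (Fin d) (Fin d) ℝ) (ν : Measure (E d))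
    (Λ : Set (S × E m) → Ω → E d) (hΛ : IsLevyBasis P Λ γ Sig ν π)
    (f : S × E m → Matrix (Fin n) (Fin d) ℝ) (hf : ∀ i j, Measurable fun p => f p i j)
    (A₀ : Set (E m)) (hA₀ : MeasurableSet A₀) (hA₀pos : 0 < (volume : Measure (E m)) A₀)
    (α : E m) (hα : ScalarProductCond A₀ α)
    (O : E m ≃ₗᵢ[ℝ] E m) (hO : O α = ‖α‖ • EuclideanSpace.single (0 : Fin m) (1 : ℝ)) :
    -- (i)
    (IntegrableOn (fun x => ‖x‖ ^ 2) {x | 1 < ‖x‖} ν → γ + ∫ x in {x | 1 < ‖x‖}, x ∂ν = 0 →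
      KernelMemLp f 2 π →
      InfluencedThetaLex P Λ π f A₀ O fun h =>
        2 * Real.sqrt (traceTerm π (reflKernel O f) (region O A₀ α h) (sigmaLambda Sig ν))) ∧
    -- (ii)
    (IntegrableOn (fun x => ‖x‖ ^ 2) {x | 1 < ‖x‖} ν → KernelMemLp f 2 π → KernelMemLp f 1 π →
      InfluencedThetaLex P Λ π f A₀ O fun h =>
        2 * Real.sqrt (traceTerm π (reflKernel O f) (region O A₀ α h) (sigmaLambda Sig ν) +
          ‖meanTerm π (reflKernel O f) (region O A₀ α h) (muLambda γ ν)‖ ^ 2)) ∧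
    -- (iii)
    (Integrable (fun x => ‖x‖) ν → Sig = 0 → KernelMemLp f 1 π →
      InfluencedThetaLex P Λ π f A₀ O fun h =>
        2 * (normTerm π (reflKernel O f) (region O A₀ α h) (gammaZero γ ν) +
          jumpTerm π (reflKernel O f) (region O A₀ α h) ν Set.univ)) ∧
    -- (iv)
    (IntegrableOn (fun x => ‖x‖) {x | 1 < ‖x‖} ν → KernelMemLp f 1 π → KernelMemLp f 2 π →
      InfluencedThetaLex P Λ π f A₀ O fun h =>
        2 * Real.sqrt (traceTerm π (reflKernel O f) (region O A₀ α h) (sigmaLambdaOne Sig ν) +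
          ‖meanTerm π (reflKernel O f) (region O A₀ α h) γ‖ ^ 2) +
        2 * jumpTerm π (reflKernel O f) (region O A₀ α h) ν {x | 1 < ‖x‖}) := by
  refine ⟨fun hsq hμ h2 => ?_, fun hsq h2 h1 => ?_, fun hν hSig h1 => ?_, fun hν h1 h2 => ?_⟩
  -- With zero drift and no jumps off `K`, square integrability of the kernel suffices.
  · refine hΛ.influencedThetaLex (isSplit_univ hΛ.posSemidef hΛ.levyMeasure hsq) hf (Or.inr h2)
      (Or.inl ⟨hμ, rfl⟩) hA₀ hα hO fun h => le_of_eq ?_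
    have hμ' : muLambda γ ν = 0 := hμ
    simp [hμ', meanTerm, jumpTerm, mv_zero, sigmaLambda]
  · refine hΛ.influencedThetaLex (isSplit_univ hΛ.posSemidef hΛ.levyMeasure hsq) hf (Or.inr h2)
      (Or.inr h1) hA₀ hα hO fun h => le_of_eq ?_
    simp [jumpTerm, sigmaLambda]
  -- Without Gaussian part and compensated jumps the square root is the norm of the drift integral,
  -- at most the integral of the norm.
  · have hQ : Sig + secondMoment ν ∅ = 0 := by
      ext i j
      simp [hSig, secondMoment]
    have hsp := isSplit_empty (γ := γ) hΛ.posSemidef hν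
    refine hΛ.influencedThetaLex hsp hf (Or.inl hQ) (Or.inr h1) hA₀ hα hO fun h => ?_
    have hadm := isAdmissible_reflKernel (isAdmissible_of_memLp (π := π) (β := gammaZero γ ν)
      (K := ∅) hf (Or.inl hQ) (Or.inr h1)) O
    have hint := (hadm.momentIntegrableOn hsp (Set.univ ×ˢ region O A₀ α h)).mean.norm
    rw [← Measure.prod_restrict, Measure.restrict_univ] at hint
    have hle := norm_meanTerm_le (π := π) (reflKernel O f) (region O A₀ α h) (gammaZero γ ν)
      hint.integral_prod_left
    rw [hQ, Set.compl_empty]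
    have h0 : traceTerm π (reflKernel O f) (region O A₀ α h) (0 : Matrix (Fin d) (Fin d) ℝ) = 0 := by
      simp [traceTerm]
    rw [h0, zero_add, Real.sqrt_sq (norm_nonneg _)]
    linarith
  · refine hΛ.influencedThetaLex (isSplit_unitBall hΛ.posSemidef hΛ.levyMeasure hν) hf (Or.inr h2)
      (Or.inr h1) hA₀ hα hO fun h => le_of_eq ?_
    rw [compl_unitBall, mul_add]
    rfl
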